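/- **Setting.** Let $\mathcal X$ be a standard Borel space with a probability measure $\nu$, and let $\mathcal H$ be a separable real reproducing kernel Hilbert space on $\mathcal X$ with measurable kernel $k$, $k(x,x)\le\kappa^2$ for all $x$ ($\kappa>0$), and feature map $\Phi(x)=k(\cdot,x)$. Let $B_\nu=\mathbb E_{X\sim\nu}[\Phi(X)\otimes\Phi(X)]$ be the covariance operator, and assume it has infinitely many positive eigenvalues $\mu_1\ge\mu_2\ge\dots>0$ (listed with multiplicity), $\mu_j\to0$. For $r>0$ put, for $t>0$, $$F(t)=\#\{j:\mu_j\ge t\},\qquad G(t)=\frac{t^{2r+1}}{F(t)}\ (=\infty\text{ if }F(t)=0),\qquad G^{-1}(u)=\max\{t>0: G(t)\le u\}\quad(u>0).$$ *Eigenvalue decay:* for some $\nu^*>1$, $\mu_{2j}/\mu_j\le 2^{-\nu^*}$ for all sufficiently large $j$. *Model:* for $M,\sigma,R>0$, $\mathcal M_{M,\sigma,R}$ is the class of probability distributions $P$ of $(X,Y)$ on $\mathcal X\times\mathbb R$ with $X$-marginal $\nu$ whose regression function $f^*(x)=\mathbb E[Y\mid X=x]$ is ($\nu$-a.e.) given by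 an element $f^*\in B_\nu^r\{h\in\mathcal H:\|h\|_{\mathcal H}\le R\}$ (source condition) and whose noise $\varepsilon=Y-f^*(X)$ satisfies $\mathbb E[\varepsilon^m\mid X]\le\frac12 m!\,\sigma^2M^{m-2}$ a.s. for every integer $m\ge2$ (Bernstein condition). *Regularization:* functions $g_\lambda:[0,1]\to\mathbb R$, $0<\lambda\le1$, such that for constants $D,E,\gamma_0,\gamma_q$ and all $\lambda,t\in(0,1]$: $|tg_\lambda(t)|\le D$, $|g_\lambda(t)|\le E/\lambda$, $|1-tg_\lambda(t)|\le\gamma_0$, and $|1-tg_\lambda(t)|\,t^q\le\gamma_q\lambda^q$ (the qualification is at least $q$). *Estimator:* for $\mathbf z=((x_i,y_i))_{i\le n}$ let $S_{\mathbf x}^*\mathbf y=\frac1n\sum_i y_i\Phi(x_i)$, $B_{\mathbf x}=\frac1n\sum_i\Phi(x_i)\otimes\Phi(x_i)$ and $f_{\mathbf z}^\lambda=g_\lambda(\kappa^{-2}B_{\mathbf x})\,\kappa^{-2}S_{\mathbf x}^*\mathbf y$. **Theorem (upper rate).** Let $r>0$, $\nu^*>1$, $q\ge r$. There is a constant $C>0$,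 depending only on $r,\nu^*,\kappa$ and the regularization constants $q,D,E,\gamma_0,\gamma_q$ (in particular not on $M,\sigma,R,\eta,n$), such that in the above setting, under the eigenvalue decay condition and with $$\lambda_n=\min\Big(G^{-1}\Big(\frac{\sigma^2}{R^2n}\Big),1\Big),$$ the following holds. For all $M,\sigma,R>0$ there is $n_0$ such that for every $P\in\mathcal M_{M,\sigma,R}$, every $n\ge n_0$ and every $\eta\in(0,1)$ with $\log(8/\eta)\le C\lambda_n^{-r}$, with $P^{\otimes n}$-probability at least $1-\eta$, $$\|f^*-f_{\mathbf z}^{\lambda_n}\|_{\mathcal H}\le C\,\log(8/\eta)\,R\;G^{-1}\Big(\frac{\sigma^2}{R^2n}\Big)^{r},$$ and, if moreover $q\ge r+\frac12$, with $P^{\otimes n}$-probability at least $1-\eta$, $$\|f^*-f_{\mathbf z}^{\lambda_n}\|_{L^2(\nu)}\le C\,\log(8/\eta)\,R\;G^{-1}\Big(\frac{\sigma^2}{R^2n}\Big)^{r+\frac12}.$$ -/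

import Mathlib

open MeasureTheory ProbabilityTheory Filter Set
open scoped ENNReal RealInnerProductSpace

noncomputable section

namespace KernelRegression

section Spectral

variable {H : Type*} [NormedAddCommGroup H] [InnerProductSpace ℝ H] [CompleteSpace H]

/-- Orthogonal projection onto the eigenspace `ker (T - t)` (zero if `t` is not an eigenvalue). -/
def eigenProj (T : H →L[ℝ] H) (t : ℝ) : H →L[ℝ] H :=
  (T - t • ContinuousLinearMap.id ℝ H).ker.starProjection

/-- The functional calculus `φ(T) f = ∑ₜ φ(t) Pₜ f` of a compact self-adjoint operator `T`, where
`t` runs over the eigenvalues of `T` (for other `t` the summand vanishes) and `Pₜ` is the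
orthogonal projection onto the eigenspace of `t`. -/
def spectralApply (T : H →L[ℝ] H) (φ : ℝ → ℝ) (f : H) : H :=
  ∑' t : ℝ, φ t • eigenProj T t f

/-- `μ 1 ≥ μ 2 ≥ ⋯ > 0` are the positive eigenvalues of `T`, listed with multiplicity and tending
to zero, and `e` are corresponding orthonormal eigenvectors; `T` vanishes on the orthogonal
complement of the `e j`, so that no positive eigenvalue is missing. -/
structure IsEigendecomposition (T : H →L[ℝ] H) (μ : ℕ+ → ℝ) (e : ℕ+ → H) : Prop where
  orthonormal : Orthonormal ℝ e
  apply_eq : ∀ j, T (e j) = μ j • e j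
  complete : ∀ f : H, (∀ j, ⟪e j, f⟫ = 0) → T f = 0
  pos : ∀ j, 0 < μ j
  antitone : Antitone μ
  tendsto_zero : Tendsto μ atTop (nhds 0)

end Spectral

section Counting

/-- The counting function `F(t) = #{j : μ_j ≥ t}`, for `t > 0` (a finite set if `μ_j → 0`). -/
def countF (μ : ℕ+ → ℝ) (t : ℝ) : ℕ := {j : ℕ+ | t ≤ μ j}.ncard

/-- `G(t) = t ^ (2r+1) / F(t)` for `t > 0`, with value `∞` if `F(t) = 0`. -/
def funG (μ : ℕ+ → ℝ) (r t : ℝ) : ℝ≥0∞ := ENNReal.ofReal (t ^ (2 * r + 1)) / (countF μ t : ℝ≥0∞)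

/-- The generalized inverse `G⁻¹(u) = max {t > 0 : G(t) ≤ u}`, for `u > 0`. -/
def invG (μ : ℕ+ → ℝ) (r u : ℝ) : ℝ := sSup {t : ℝ | 0 < t ∧ funG μ r t ≤ ENNReal.ofReal u}

/-- The upper eigenvalue decay condition: `μ_{2j} / μ_j ≤ 2 ^ (-νs)` for all large `j`. -/
def EigUpper (μ : ℕ+ → ℝ) (νs : ℝ) : Prop :=
  ∀ᶠ j : ℕ+ in atTop, μ (2 * j) / μ j ≤ (2 : ℝ) ^ (-νs)

/-- The parameter choice `λ_n = min (G⁻¹(σ² / (R² n))) 1`. -/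
def lambdaSeq (μ : ℕ+ → ℝ) (r σ R : ℝ) (n : ℕ) : ℝ := min (invG μ r (σ ^ 2 / (R ^ 2 * n))) 1

end Counting

section Regularization

/-- Linear spectral regularization functions `g_λ : [0,1] → ℝ`, `0 < λ ≤ 1`
(values outside `[0,1]` are irrelevant), with constants `D`, `E`, `γ₀`. -/
structure IsRegularization (g : ℝ → ℝ → ℝ) (D E γ₀ : ℝ) : Prop where
  mul_le : ∀ l ∈ Ioc (0 : ℝ) 1, ∀ t ∈ Ioc (0 : ℝ) 1, |t * g l t| ≤ D
  le_div : ∀ l ∈ Ioc (0 : ℝ) 1, ∀ t ∈ Ioc (0 : ℝ) 1, |g l t| ≤ E / l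
  residual_le : ∀ l ∈ Ioc (0 : ℝ) 1, ∀ t ∈ Ioc (0 : ℝ) 1, |1 - g l t * t| ≤ γ₀

/-- The qualification inequality with exponent `q` and constant `γq`. -/
def QualificationBound (g : ℝ → ℝ → ℝ) (q γq : ℝ) : Prop :=
  ∀ l ∈ Ioc (0 : ℝ) 1, ∀ t ∈ Ioc (0 : ℝ) 1, |1 - g l t * t| * t ^ q ≤ γq * l ^ q

end Regularization

section Learning

variable {X H : Type*} [NormedAddCommGroup H] [InnerProductSpace ℝ H] [CompleteSpace H]
  [RKHS ℝ H X ℝ]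

variable (H) in
/-- The canonical feature map `Φ(x) = k(·, x)`. -/
def feature (x : X) : H := RKHS.kerFun H x (1 : ℝ)

variable (H) in
/-- The real-valued reproducing kernel `k` of `H`. -/
def kern (x y : X) : ℝ := RKHS.kernel H x y (1 : ℝ)

variable (H) in
/-- The covariance operator `B_ν = 𝔼[Φ(X) ⊗ Φ(X)]`, `X ∼ ν`. -/
def covOp [MeasurableSpace X] (ν : Measure X) : H →L[ℝ] H :=
  ∫ x, InnerProductSpace.rankOne ℝ (feature H x) (feature H x) ∂ν

variable (H) in
/-- The sampling operator `(S_x f)_i = ⟪f, Φ(x_i)⟫`. -/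
def sampling {n : ℕ} (x : Fin n → X) : H →L[ℝ] (Fin n → ℝ) :=
  ContinuousLinearMap.pi fun i => innerSL ℝ (feature H (x i))

variable (H) in
/-- The adjoint `S_x^* y = n⁻¹ ∑ᵢ yᵢ Φ(xᵢ)` of `S_x` with respect to the empirical inner product
`n⁻¹ ∑ᵢ aᵢ bᵢ` on `ℝⁿ`. -/
def samplingAdj {n : ℕ} (x : Fin n → X) : (Fin n → ℝ) →L[ℝ] H :=
  (n : ℝ)⁻¹ • ∑ i, (ContinuousLinearMap.proj i : (Fin n → ℝ) →L[ℝ] ℝ).smulRight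
    (feature H (x i))

variable (H) in
/-- The empirical covariance operator `B_x = S_x^* S_x = n⁻¹ ∑ᵢ Φ(xᵢ) ⊗ Φ(xᵢ)`. -/
def empCov {n : ℕ} (x : Fin n → X) : H →L[ℝ] H := samplingAdj H x ∘L sampling H x

/-- The spectral regularization estimator `f_z^λ = g_λ(κ⁻² B_x) κ⁻² S_x^* y`. -/
def estimator (κ : ℝ) (g : ℝ → ℝ → ℝ) (l : ℝ) {n : ℕ} (z : Fin n → X × ℝ) : H :=
  spectralApply ((κ ^ 2)⁻¹ • empCov H fun i => (z i).1) (g l)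
    ((κ ^ 2)⁻¹ • samplingAdj H (fun i => (z i).1) fun i => (z i).2)

variable [MeasurableSpace X]

/-- The source condition `f ∈ B_ν^r B(H, R)`. -/
def SourceCondition (ν : Measure X) (r R : ℝ) (f : H) : Prop :=
  ∃ h : H, ‖h‖ ≤ R ∧ f = spectralApply (covOp H ν) (fun t => t ^ r) h

/-- Bernstein's moment condition on the noise `ε = Y - f(X)`, conditionally on `X`:
`𝔼[ε ^ m | X] ≤ ½ m! σ² M ^ (m-2)` almost surely, for all integers `m ≥ 2`. -/
def BernsteinNoise (P : Measure (X × ℝ)) [IsProbabilityMeasure P] (σ M : ℝ) (f : H) : Prop :=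
  ∀ m : ℕ, 2 ≤ m → ∀ᵐ x ∂P.fst,
    Integrable (fun y => (y - f x) ^ m) (P.condKernel x) ∧
      ∫ y, (y - f x) ^ m ∂(P.condKernel x) ≤ 1 / 2 * (m.factorial : ℝ) * σ ^ 2 * M ^ (m - 2)

/-- `P` belongs to the model with parameters `(M, σ, R)`, smoothness `r` and `X`-marginal `ν`, and
`f` is its regression function `f(x) = 𝔼[Y | X = x]`. -/
structure InModel (ν : Measure X) (r M σ R : ℝ) (P : Measure (X × ℝ)) [IsProbabilityMeasure P]
    (f : H) : Prop where
  marginal : P.fst = ν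
  regression : ∀ᵐ x ∂P.fst, Integrable (fun y => y) (P.condKernel x) ∧
    ∫ y, y ∂(P.condKernel x) = f x
  bernstein : BernsteinNoise P σ M f
  source : SourceCondition ν r R f

end Learning

end KernelRegression

end

/-! Divide by `κ ^ 2`: the covariance operator A and its empirical version T have eigenbases b and
v, with eigenvalues m_j and t_i in [0,1]. For large n the parameter is l = λ_n = G⁻¹(σ²/(R²n)). The
data vector is T f + ξ with ξ the averaged noise, so the error is residual(T) f - g_l(T) ξ
(`inner_sub_estimator`). With L = log(8/η), it suffices to bound (T + l)^s times the error by a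
multiple of L R l^(r+s): s = 0 gives the norm of H, s = 1/2 the L² norm.

Comparing A with T. All operators are matrices in the mixed bases: (T + l)⁻¹(A - T) has entries (m_j
- t_i)/(t_i + l) ⟪v_i, b_j⟫. Hilbert-Schmidt norms are monotone in the absolute values of entries,
so scalar inequalities become operator inequalities. From |x^p - 1| ≤ |x - 1| for 0 ≤ p ≤ 1 one gets
that (T + l)^(-p) is dominated by 2 (A + l)^(-p) (`sqSumLE_rpow_transfer`), and from the Lipschitz
bound for x^r, r ≥ 1, that A^r - T^r is controlled by A - T (`sqSumLE_rpow_sub`). Together with the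
bounds on g_l and the qualification this gives the deterministic estimate `sqSumLE_error`;
`inner_apply_le_of_sqSumLE` returns from T to A for the L² norm.

Concentration. Three random quantities must be small: (A + l)⁻¹(A - T) and A - T in Hilbert-Schmidt
norm, and (A + l)^(-1/2) ξ. Each is a sum of independent centred vectors in a Hilbert space, handled
by `bernstein_norm_sum`, whose proof follows the expectation of cosh of the norm of the partial
sums. Only even moments enter, which is why a condition on 𝔼[ε^m | X] without absolute values is
enough.

Calibration. The variances involve the effective dimension ∑ m_j/(m_j + l). Eigenvalue decay bounds
it by a multiple of the number k of eigenvalues above l (`exists_effDim_le`), and the definition of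
G⁻¹ gives σ² k/(R² n) ≤ l^(2r+1) (`mul_le_invG_rpow`). Hence the noise has order R l^(r+1/2),
matching the approximation error. -/

noncomputable section

namespace KernelRegression

/-! ### Square-summable families, via finite partial sums -/

section SquareSums

variable {ι : Type*}

/-- Every finite partial sum of the squares of `a` is at most `B`. -/
def SqSumLE (a : ι → ℝ) (B : ℝ) : Prop := ∀ s : Finset ι, ∑ i ∈ s, a i ^ 2 ≤ B

lemma SqSumLE.nonneg {a : ι → ℝ} {B : ℝ} (h : SqSumLE a B) : 0 ≤ B := by
  simpa using h ∅

lemma SqSumLE.mono_right {a : ι → ℝ} {B B' : ℝ} (h : SqSumLE a B) (hB : B ≤ B') :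
    SqSumLE a B' := fun s => (h s).trans hB

lemma SqSumLE.mono_mul {a a' : ι → ℝ} {B c : ℝ} (h : SqSumLE a B)
    (ha : ∀ i, |a' i| ≤ c * |a i|) : SqSumLE a' (c ^ 2 * B) := by
  intro s
  calc ∑ i ∈ s, a' i ^ 2 ≤ ∑ i ∈ s, c ^ 2 * a i ^ 2 := by
        refine Finset.sum_le_sum fun i _ => ?_
        rw [← sq_abs (a' i), ← sq_abs (a i), ← mul_pow]
        exact pow_le_pow_left₀ (abs_nonneg _) (ha i) 2
    _ = c ^ 2 * ∑ i ∈ s, a i ^ 2 := by rw [Finset.mul_sum]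
    _ ≤ c ^ 2 * B := mul_le_mul_of_nonneg_left (h s) (sq_nonneg c)

lemma SqSumLE.add {a a' : ι → ℝ} {B B' : ℝ} (h : SqSumLE a B) (h' : SqSumLE a' B') :
    SqSumLE (fun i => a i + a' i) (2 * B + 2 * B') := by
  intro s
  calc ∑ i ∈ s, (a i + a' i) ^ 2 ≤ ∑ i ∈ s, (2 * a i ^ 2 + 2 * a' i ^ 2) := by
        refine Finset.sum_le_sum fun i _ => ?_
        nlinarith [sq_nonneg (a i - a' i)]
    _ = 2 * ∑ i ∈ s, a i ^ 2 + 2 * ∑ i ∈ s, a' i ^ 2 := by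
        rw [Finset.sum_add_distrib, Finset.mul_sum, Finset.mul_sum]
    _ ≤ _ := by linarith [h s, h' s]

lemma SqSumLE.summable {a : ι → ℝ} {B : ℝ} (h : SqSumLE a B) : Summable fun i => a i ^ 2 :=
  summable_of_sum_le (fun _ => sq_nonneg _) h

end SquareSums

/-! ### Diagonal operators and functional calculus in a Hilbert basis -/

section HilbertBasis

variable {H : Type*} [NormedAddCommGroup H] [InnerProductSpace ℝ H] {ι : Type*}
  (b : HilbertBasis ι ℝ H)

lemma hasSum_sq_inner (w : H) : HasSum (fun i => ⟪b i, w⟫ ^ 2) (‖w‖ ^ 2) := by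
  have := b.hasSum_inner_mul_inner w w
  rw [real_inner_self_eq_norm_sq] at this
  refine this.congr_fun fun i => ?_
  rw [real_inner_comm w (b i)]; ring

lemma sqSumLE_inner (w : H) : SqSumLE (fun i => ⟪b i, w⟫) (‖w‖ ^ 2) := fun s =>
  sum_le_hasSum s (fun _ _ => sq_nonneg _) (hasSum_sq_inner b w)

lemma norm_sq_le_of_sqSumLE {w : H} {B : ℝ} (h : SqSumLE (fun i => ⟪b i, w⟫) B) :
    ‖w‖ ^ 2 ≤ B :=
  hasSum_le_of_sum_le (hasSum_sq_inner b w) h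

/-- Riesz-Fischer. It supplies vectors such as (A + l)^(-p) ζ from their coefficients, so no
fractional power of an operator has to be constructed. -/
lemma exists_inner_eq {c : ι → ℝ} {B : ℝ} (hc : SqSumLE c B) :
    ∃ w : H, ∀ i, ⟪b i, w⟫ = c i := by
  have hmem : Memℓp c 2 := by
    refine memℓp_gen ?_
    simpa using hc.summable
  refine ⟨b.repr.symm ⟨c, hmem⟩, fun i => ?_⟩
  rw [← b.repr_apply_apply, LinearIsometryEquiv.apply_symm_apply]

lemma ext_inner_basis {x y : H} (h : ∀ i, ⟪b i, x⟫ = ⟪b i, y⟫) : x = y := by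
  apply b.repr.injective
  ext i
  simp [b.repr_apply_apply, h]

lemma exists_diag {c : ι → ℝ} {C : ℝ} (hc : ∀ i, |c i| ≤ C) :
    ∃ D : H →L[ℝ] H, ∀ f i, ⟪b i, D f⟫ = c i * ⟪b i, f⟫ := by
  have hex : ∀ f : H, ∃ w : H, ∀ i, ⟪b i, w⟫ = c i * ⟪b i, f⟫ := fun f =>
    exists_inner_eq b ((sqSumLE_inner b f).mono_mul (a' := fun i => c i * ⟪b i, f⟫) (c := C)
      fun i => by rw [abs_mul]; exact mul_le_mul_of_nonneg_right (hc i) (abs_nonneg _))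
  choose D hD using hex
  have hbound : ∀ f, ‖D f‖ ≤ |C| * ‖f‖ := by
    intro f
    refine le_of_sq_le_sq ?_ (by positivity)
    rw [mul_pow, sq_abs]
    refine norm_sq_le_of_sqSumLE b ((sqSumLE_inner b f).mono_mul (c := C) fun i => ?_)
    rw [hD, abs_mul]
    exact mul_le_mul_of_nonneg_right (hc i) (abs_nonneg _)
  refine ⟨LinearMap.mkContinuous
    { toFun := D
      map_add' := fun x y => ext_inner_basis b fun i => by
        rw [hD, inner_add_right, inner_add_right, hD, hD]; ring
      map_smul' := fun a x => ext_inner_basis b fun i => by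
        rw [hD, RingHom.id_apply, inner_smul_right, inner_smul_right, hD]; ring } |C| hbound,
    fun f i => hD f i⟩

/-- The bounded operator that is diagonal in the basis `b` with bounded entries `c`. -/
def diagOp (c : ι → ℝ) : H →L[ℝ] H :=
  open Classical in
  if h : ∃ D : H →L[ℝ] H, ∀ f i, ⟪b i, D f⟫ = c i * ⟪b i, f⟫ then h.choose else 0

lemma inner_diagOp {c : ι → ℝ} {C : ℝ} (hc : ∀ i, |c i| ≤ C) (f : H) (i : ι) :
    ⟪b i, diagOp b c f⟫ = c i * ⟪b i, f⟫ := by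
  have h := exists_diag b hc
  rw [diagOp, dif_pos h]
  exact h.choose_spec f i

/-- `T` is diagonal in the Hilbert basis `b`, with eigenvalues `m`. -/
def IsDiag (T : H →L[ℝ] H) (m : ι → ℝ) : Prop := ∀ i, T (b i) = m i • b i

variable {b} in
lemma IsDiag.inner_apply {T : H →L[ℝ] H} {m : ι → ℝ} (h : IsDiag b T m) (w : H) (i : ι) :
    ⟪b i, T w⟫ = m i * ⟪b i, w⟫ := by
  classical
  have h1 : HasSum (fun j => ⟪b i, T (b.repr w j • b j)⟫) ⟪b i, T w⟫ :=
    ((innerSL ℝ (b i)).comp T).hasSum (b.hasSum_repr w)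
  have h2 : (fun j => ⟪b i, T (b.repr w j • b j)⟫)
      = fun j => if j = i then m i * ⟪b i, w⟫ else 0 := by
    funext j
    rw [map_smul, h j, inner_smul_right, inner_smul_right, b.repr_apply_apply,
      orthonormal_iff_ite.1 b.orthonormal]
    by_cases hij : j = i
    · subst hij; simp [mul_comm]
    · rw [if_neg hij, if_neg (Ne.symm hij)]; simp
  rw [h2] at h1
  exact h1.unique (hasSum_ite_eq i _)

variable {b} in
-- A basis vector lies in the eigenspace of t or is orthogonal to it: if T u = t u, comparing
-- coefficients gives (m_i - t) ⟪b_i, u⟫ = 0.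
lemma IsDiag.inner_eigenProj [CompleteSpace H] {T : H →L[ℝ] H} {m : ι → ℝ} (h : IsDiag b T m)
    (t : ℝ) (f : H) (i : ι) :
    ⟪b i, eigenProj T t f⟫ = {i | m i = t}.indicator (fun i => ⟪b i, f⟫) i := by
  rw [eigenProj, ← Submodule.inner_starProjection_left_eq_right]
  by_cases hi : m i = t
  · rw [indicator_of_mem (by exact hi), Submodule.starProjection_eq_self_iff.2]
    simp [h i, hi]
  · rw [indicator_of_notMem (by exact hi), (Submodule.starProjection_apply_eq_zero_iff _).2,
      inner_zero_left]
    rw [Submodule.mem_orthogonal]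
    intro u hu
    have hu' : T u = t • u := by
      simpa [sub_eq_zero] using hu
    have h1 := h.inner_apply u i
    rw [hu', inner_smul_right] at h1
    have h2 : (m i - t) * ⟪b i, u⟫ = 0 := by linarith
    rw [real_inner_comm]
    exact (mul_eq_zero.1 h2).resolve_left (sub_ne_zero.2 hi)

variable {b} in
/-- In an eigenbasis the functional calculus multiplies the coefficients. -/
lemma IsDiag.inner_spectralApply [CompleteSpace H] {T : H →L[ℝ] H} {m : ι → ℝ}
    (h : IsDiag b T m) {φ : ℝ → ℝ} {C : ℝ} (hφ : ∀ i, |φ (m i)| ≤ C) (f : H) (i : ι) :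
    ⟪b i, spectralApply T φ f⟫ = φ (m i) * ⟪b i, f⟫ := by
  obtain ⟨D, hD⟩ := exists_diag b hφ
  have hsum : HasSum (fun j => (φ (m j) * ⟪b j, f⟫) • b j) (D f) := by
    have := b.hasSum_repr (D f)
    simpa only [b.repr_apply_apply, hD] using this
  -- Regroup the basis expansion along the fibres of m; the fibre over t sums to φ(t) P_t f.
  have hsig := (Equiv.sigmaFiberEquiv m).hasSum_iff.2 hsum
  have hfib : ∀ t : ℝ, HasSum (fun j : {j // m j = t} =>
      (φ (m j) * ⟪b j, f⟫) • b j) (φ t • eigenProj T t f) := by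
    intro t
    have h1 := (b.hasSum_repr (eigenProj T t f)).const_smul (φ t)
    have h2 : (fun j => φ t • (b.repr (eigenProj T t f) j • b j))
        = {j | m j = t}.indicator fun j => (φ (m j) * ⟪b j, f⟫) • b j := by
      funext j
      rw [b.repr_apply_apply, h.inner_eigenProj]
      by_cases hj : m j = t
      · rw [indicator_of_mem (by exact hj), indicator_of_mem (by exact hj), hj, smul_smul]
      · rw [indicator_of_notMem (by exact hj), indicator_of_notMem (by exact hj), zero_smul,
          smul_zero]
    rw [h2] at h1
    exact hasSum_subtype_iff_indicator.2 h1
  have hS : HasSum (fun t : ℝ => φ t • eigenProj T t f) (D f) :=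
    hsig.sigma hfib
  rw [spectralApply, hS.tsum_eq, hD]

end HilbertBasis

/-! ### Existence of eigenbases -/

section Existence

variable {H : Type*} [NormedAddCommGroup H] [InnerProductSpace ℝ H] [CompleteSpace H]

/-- The eigenvectors of an eigendecomposition extend to a Hilbert basis of eigenvectors. -/
lemma IsEigendecomposition.exists_hilbertBasis {T : H →L[ℝ] H} {μ : ℕ+ → ℝ} {e : ℕ+ → H}
    (h : IsEigendecomposition T μ e) :
    ∃ (w : Set H) (b : HilbertBasis w ℝ H) (m : w → ℝ) (ι : ℕ+ → w),
      IsDiag b T m ∧ Function.Injective ι ∧ (∀ j, m (ι j) = μ j) ∧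
        ∀ i, i ∉ range ι → m i = 0 := by
  classical
  obtain ⟨w, b, hw, hb⟩ := h.orthonormal.toSubtypeRange.exists_hilbertBasis_extension
  let ι : ℕ+ → w := fun j => ⟨e j, hw (mem_range_self j)⟩
  have hbι : ∀ j, b (ι j) = e j := fun j => by rw [hb]
  have hι : Function.Injective ι := fun i j hij =>
    h.orthonormal.linearIndependent.injective (congrArg Subtype.val hij)
  refine ⟨w, b, fun i => if hi : i ∈ range ι then μ hi.choose else 0, ι, ?_, hι, ?_, ?_⟩
  · intro i
    by_cases hi : i ∈ range ι
    · simp only [dif_pos hi]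
      have hbi : b i = e hi.choose := (congrArg b hi.choose_spec).symm.trans (hbι _)
      rw [hbi, h.apply_eq]
    · simp only [dif_neg hi, zero_smul]
      apply h.complete
      intro j
      rw [← hbι]
      exact b.orthonormal.2 fun hij => hi ⟨j, hij⟩
  · intro j
    have hj : ι j ∈ range ι := mem_range_self j
    simp only [dif_pos hj]
    rw [hι hj.choose_spec]
  · intro i hi
    simp only [dif_neg hi]

/-- A finite-rank operator of the form `∑ₖ ⟨φₖ, ·⟩ φₖ` has a Hilbert basis of eigenvectors. -/
lemma exists_hilbertBasis_isDiag_sum {n : ℕ} (φ : Fin n → H) (T : H →L[ℝ] H)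
    (hT : ∀ w, T w = ∑ k, ⟪φ k, w⟫ • φ k) :
    ∃ (s : Set H) (v : HilbertBasis s ℝ H) (t : s → ℝ), IsDiag v T t := by
  classical
  let V : Submodule ℝ H := Submodule.span ℝ (range φ)
  have hφV : ∀ k, φ k ∈ V := fun k => Submodule.subset_span (mem_range_self k)
  have hTV : ∀ w, T w ∈ V := fun w => by
    rw [hT]; exact Submodule.sum_mem _ fun k _ => V.smul_mem _ (hφV k)
  have : FiniteDimensional ℝ V := FiniteDimensional.span_of_finite ℝ (finite_range φ)
  let T' : V →ₗ[ℝ] V := (T.toLinearMap.restrict (p := V) (q := V) fun w _ => hTV w)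
  have hsym : T'.IsSymmetric := by
    intro x y
    change ⟪T x, (y : H)⟫ = ⟪(x : H), T y⟫
    rw [hT, hT, sum_inner, inner_sum]
    refine Finset.sum_congr rfl fun k _ => ?_
    rw [inner_smul_left, inner_smul_right, real_inner_comm (φ k) (x : H)]
    simp [mul_comm]
  let c := hsym.eigenvectorBasis rfl
  let c' : Fin (Module.finrank ℝ V) → H := fun i => (c i : H)
  have hc' : Orthonormal ℝ c' := c.orthonormal.comp_linearIsometry V.subtypeₗᵢ
  have hc'T : ∀ i, T (c' i) = hsym.eigenvalues rfl i • c' i := fun i => by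
    have := hsym.apply_eigenvectorBasis rfl i
    exact congrArg Subtype.val this
  obtain ⟨s, v, hs, hv⟩ := hc'.toSubtypeRange.exists_hilbertBasis_extension
  have key : ∀ i : s, ∃ t : ℝ, T (v i) = t • v i := by
    intro i
    by_cases hi : (i : H) ∈ range c'
    · obtain ⟨j, hj⟩ := hi
      refine ⟨hsym.eigenvalues rfl j, ?_⟩
      rw [hv, ← hj, hc'T]
    · refine ⟨0, ?_⟩
      -- The vectors added when the eigenbasis of V is extended are orthogonal to V, hence to every
      -- φ_k, and T kills them.
      have horth : ∀ x ∈ V, ⟪x, v i⟫ = 0 := by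
        intro x hx
        have h1 := c.sum_repr ⟨x, hx⟩
        have h2 : x = ∑ j, c.repr ⟨x, hx⟩ j • c' j := by
          have h3 : x = ((∑ j, c.repr ⟨x, hx⟩ j • c j : V) : H) := (congrArg Subtype.val h1).symm
          refine h3.trans ?_
          simp [c']
        rw [h2, sum_inner]
        refine Finset.sum_eq_zero fun j _ => ?_
        have : v ⟨c' j, hs (mem_range_self j)⟩ = c' j := by rw [hv]
        rw [inner_smul_left, ← this, v.orthonormal.2, mul_zero]
        intro hij
        exact hi ⟨j, congrArg Subtype.val hij⟩
      rw [hT, zero_smul]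
      exact Finset.sum_eq_zero fun k _ => by rw [horth _ (hφV k), zero_smul]
  choose t ht using key
  exact ⟨s, v, t, ht⟩

end Existence

/-! ### Bernstein's inequality in Hilbert space -/

section Bernstein

/-- cosh √z = ∑ zⁿ/(2n)! is a power series with nonnegative coefficients, and each zⁿ is convex on
[0, ∞). -/
lemma cosh_sqrt_convex {x y α β : ℝ} (hx : 0 ≤ x) (hy : 0 ≤ y) (hα : 0 ≤ α) (hβ : 0 ≤ β)
    (hαβ : α + β = 1) :
    Real.cosh √(α * x + β * y) ≤ α * Real.cosh √x + β * Real.cosh √y := by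
  have hs : ∀ z : ℝ, 0 ≤ z →
      HasSum (fun n : ℕ => z ^ n / ((2 * n).factorial : ℝ)) (Real.cosh √z) := by
    intro z hz
    have := Real.hasSum_cosh √z
    simpa only [pow_mul, Real.sq_sqrt hz] using this
  have hz : 0 ≤ α * x + β * y := by positivity
  refine hasSum_le (fun n => ?_) (hs _ hz) (((hs x hx).mul_left α).add ((hs y hy).mul_left β))
  have h := (convexOn_pow n).2 (mem_Ici.2 hx) (mem_Ici.2 hy) hα hβ hαβ
  simp only [smul_eq_mul] at h
  rw [← mul_div_assoc, ← mul_div_assoc, ← add_div]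
  gcongr

lemma sinh_sub_self_le {b : ℝ} : Real.sinh b - b ≤ Real.cosh b - 1 := by
  have h1 := Real.cosh_sub_sinh b
  have h2 := Real.add_one_le_exp (-b)
  linarith

variable {G : Type*} [NormedAddCommGroup G] [InnerProductSpace ℝ G]

/-- A one-step estimate whose second term is linear in x, so that it vanishes on averaging over a
centred x. With a = ‖s‖, b = ‖x‖ and d the cosine of the angle, convexity gives cosh ‖s + x‖ ≤ cosh
a cosh b + d sinh a sinh b; splitting off d b sinh a leaves sinh b - b, which is at most cosh b - 1.
-/
lemma cosh_norm_add_le (s x : G) :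
    Real.cosh ‖s + x‖ ≤ Real.cosh ‖s‖ * (1 + 2 * (Real.cosh ‖x‖ - 1))
      + Real.sinh ‖s‖ / ‖s‖ * ⟪s, x⟫ := by
  have hcb : 1 ≤ Real.cosh ‖x‖ := Real.one_le_cosh _
  rcases eq_or_ne s 0 with rfl | hs
  · simp; linarith
  rcases eq_or_ne x 0 with rfl | hx
  · simp
  set a := ‖s‖ with ha
  set b := ‖x‖ with hb
  set c := ⟪s, x⟫ with hc
  have ha0 : 0 < a := norm_pos_iff.2 hs
  have hb0 : 0 < b := norm_pos_iff.2 hx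
  have hcab : |c| ≤ a * b := abs_real_inner_le_norm s x
  obtain ⟨hc1, hc2⟩ := abs_le.1 hcab
  have hab : 0 < a * b := mul_pos ha0 hb0
  -- The squared norm is a convex combination of its extreme values (a + b)² and (a - b)², with
  -- weights (1 ± d)/2.
  have hnorm : ‖s + x‖ = √((1 + c / (a * b)) / 2 * (a + b) ^ 2
      + (1 - c / (a * b)) / 2 * (a - b) ^ 2) := by
    rw [← Real.sqrt_sq (norm_nonneg (s + x)), norm_add_sq_real]
    congr 1
    rw [← ha, ← hb, ← hc]
    field_simp
    ring
  have hd1 : c / (a * b) ≤ 1 := (div_le_one hab).2 hc2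
  have hd2 : -1 ≤ c / (a * b) := by rw [le_div_iff₀ hab]; linarith
  rw [hnorm]
  refine (cosh_sqrt_convex (sq_nonneg _) (sq_nonneg _) (by linarith) (by linarith)
    (by ring)).trans ?_
  rw [Real.sqrt_sq_eq_abs, Real.sqrt_sq_eq_abs, Real.cosh_abs, Real.cosh_abs, Real.cosh_add,
    Real.cosh_sub]
  set d := c / (a * b) with hd
  have hcd : Real.sinh a / a * c = Real.sinh a * (d * b) := by
    rw [hd]; field_simp
  rw [hcd]
  have h1 : Real.sinh a ≤ Real.cosh a := (Real.sinh_lt_cosh a).le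
  have h0 : 0 ≤ Real.sinh a := Real.sinh_nonneg_iff.2 ha0.le
  have h2 : 0 ≤ Real.sinh b - b := sub_nonneg.2 (Real.self_le_sinh_iff.2 hb0.le)
  have h3 := @sinh_sub_self_le b
  have h4 : d * (Real.sinh a * (Real.sinh b - b)) ≤ 1 * (Real.cosh a * (Real.cosh b - 1)) :=
    (mul_le_mul_of_nonneg_right hd1 (mul_nonneg h0 h2)).trans
      (mul_le_mul_of_nonneg_left (mul_le_mul h1 h3 h2 (h0.trans h1)) zero_le_one)
  nlinarith [h4]

variable {Ω : Type*} [MeasurableSpace Ω] (P : Measure Ω)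

/-- The exponential moment bound implied by Bernstein's condition on the even moments. -/
lemma lintegral_cosh_sub_one_le {ξ : Ω → G} (hm : StronglyMeasurable ξ) {v L t : ℝ}
    (hv : 0 ≤ v) (hL : 0 ≤ L) (ht : 0 ≤ t) (htL : t * L ≤ 1 / 2)
    (hmom : ∀ p : ℕ, ∫⁻ x, ENNReal.ofReal (‖ξ x‖ ^ (2 * (p + 1))) ∂P
      ≤ ENNReal.ofReal (1 / 2 * (2 * (p + 1)).factorial * v * L ^ (2 * p))) :
    ∫⁻ x, ENNReal.ofReal (2 * (Real.cosh ‖t • ξ x‖ - 1)) ∂P ≤ ENNReal.ofReal (2 * t ^ 2 * v) := by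
  have hser : ∀ x, ENNReal.ofReal (2 * (Real.cosh ‖t • ξ x‖ - 1))
      = ∑' p : ℕ, ENNReal.ofReal (2 * t ^ (2 * (p + 1)) / (2 * (p + 1)).factorial)
          * ENNReal.ofReal (‖ξ x‖ ^ (2 * (p + 1))) := by
    intro x
    have h1 := Real.hasSum_cosh ‖t • ξ x‖
    rw [← hasSum_nat_add_iff' 1] at h1
    simp only [Finset.range_one, Finset.sum_singleton, mul_zero, pow_zero, Nat.factorial_zero,
      Nat.cast_one, div_one] at h1
    have h2 := h1.mul_left 2
    rw [← h2.tsum_eq, ENNReal.ofReal_tsum_of_nonneg (fun p => by positivity) h2.summable]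
    refine tsum_congr fun p => ?_
    rw [← ENNReal.ofReal_mul (by positivity), norm_smul, Real.norm_of_nonneg ht, mul_pow]
    congr 1
    ring
  simp_rw [hser]
  rw [lintegral_tsum fun p => by
    exact ((ENNReal.continuous_ofReal.comp
      (by fun_prop : Continuous fun y : G => ‖y‖ ^ (2 * (p + 1)))).comp_stronglyMeasurable hm).measurable.aemeasurable.const_mul _]
  have hterm : ∀ p : ℕ, ∫⁻ x, ENNReal.ofReal (2 * t ^ (2 * (p + 1)) / (2 * (p + 1)).factorial)
          * ENNReal.ofReal (‖ξ x‖ ^ (2 * (p + 1))) ∂P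
      ≤ ENNReal.ofReal (t ^ 2 * v * (1 / 4) ^ p) := by
    intro p
    rw [lintegral_const_mul' _ _ ENNReal.ofReal_ne_top]
    refine (mul_le_mul_right (hmom p) _).trans ?_
    rw [← ENNReal.ofReal_mul (by positivity)]
    apply ENNReal.ofReal_le_ofReal
    have hf : (0 : ℝ) < ((2 * (p + 1)).factorial : ℝ) := by positivity
    have h4 : (t * L) ^ (2 * p) ≤ (1 / 4) ^ p := by
      rw [pow_mul]
      have h5 : (t * L) ^ 2 ≤ 1 / 4 := by nlinarith [mul_nonneg ht hL]
      exact pow_le_pow_left₀ (sq_nonneg _) h5 p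
    have h6 : 2 * t ^ (2 * (p + 1)) / ((2 * (p + 1)).factorial : ℝ)
        * (1 / 2 * ((2 * (p + 1)).factorial : ℝ) * v * L ^ (2 * p))
        = t ^ 2 * v * (t * L) ^ (2 * p) := by
      field_simp
      ring
    rw [h6]
    exact mul_le_mul_of_nonneg_left h4 (by positivity)
  -- The geometric series gives 4/3 t² v, rounded up to 2 t² v.
  refine (ENNReal.tsum_le_tsum hterm).trans ?_
  have hgeo : HasSum (fun p : ℕ => t ^ 2 * v * (1 / 4 : ℝ) ^ p) (t ^ 2 * v * (1 - 1 / 4)⁻¹) :=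
    (hasSum_geometric_of_lt_one (by norm_num) (by norm_num)).mul_left _
  rw [← ENNReal.ofReal_tsum_of_nonneg (fun p => by positivity) hgeo.summable, hgeo.tsum_eq]
  apply ENNReal.ofReal_le_ofReal
  have : 0 ≤ t ^ 2 * v := by positivity
  norm_num
  linarith

variable [CompleteSpace G] [IsProbabilityMeasure P]

/-- Adding one independent centred summand multiplies the expected cosh by at most 1 + V; iterating
gives the factor (1 + V)ⁿ for n summands. -/
lemma lintegral_cosh_norm_add_le {ξ : Ω → G} (hξ : Integrable ξ P) (h0 : ∫ x, ξ x ∂P = 0)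
    {V : ℝ} (hV : 0 ≤ V)
    (hcosh : ∫⁻ x, ENNReal.ofReal (2 * (Real.cosh ‖ξ x‖ - 1)) ∂P ≤ ENNReal.ofReal V) (s : G) :
    ∫⁻ x, ENNReal.ofReal (Real.cosh ‖s + ξ x‖) ∂P
      ≤ ENNReal.ofReal (Real.cosh ‖s‖) * ENNReal.ofReal (1 + V) := by
  have hnn : ∀ x, 0 ≤ 2 * (Real.cosh ‖ξ x‖ - 1) := fun x => by
    linarith [Real.one_le_cosh ‖ξ x‖]
  have hm : AEStronglyMeasurable (fun x => 2 * (Real.cosh ‖ξ x‖ - 1)) P :=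
    (by fun_prop : Continuous fun y : G => 2 * (Real.cosh ‖y‖ - 1)).comp_aestronglyMeasurable
      hξ.aestronglyMeasurable
  have hint : Integrable (fun x => 2 * (Real.cosh ‖ξ x‖ - 1)) P :=
    (lintegral_ofReal_ne_top_iff_integrable hm (ae_of_all _ hnn)).1
      (hcosh.trans_lt ENNReal.ofReal_lt_top).ne
  have hle : ∫ x, 2 * (Real.cosh ‖ξ x‖ - 1) ∂P ≤ V := by
    rw [integral_eq_lintegral_of_nonneg_ae (ae_of_all _ hnn) hm]
    exact ENNReal.toReal_le_of_le_ofReal hV hcosh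
  have hinner : Integrable (fun x => Real.sinh ‖s‖ / ‖s‖ * ⟪s, ξ x⟫) P :=
    (hξ.const_inner s).const_mul _
  have hinner0 : ∫ x, Real.sinh ‖s‖ / ‖s‖ * ⟪s, ξ x⟫ ∂P = 0 := by
    rw [integral_const_mul, integral_inner hξ, h0, inner_zero_right, mul_zero]
  have hint2 : Integrable (fun x => Real.cosh ‖s‖ * (1 + 2 * (Real.cosh ‖ξ x‖ - 1))) P :=
    ((integrable_const 1).add hint).const_mul _
  calc ∫⁻ x, ENNReal.ofReal (Real.cosh ‖s + ξ x‖) ∂P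
      ≤ ∫⁻ x, ENNReal.ofReal (Real.cosh ‖s‖ * (1 + 2 * (Real.cosh ‖ξ x‖ - 1))
          + Real.sinh ‖s‖ / ‖s‖ * ⟪s, ξ x⟫) ∂P :=
        lintegral_mono fun x => ENNReal.ofReal_le_ofReal (cosh_norm_add_le s (ξ x))
    _ = ENNReal.ofReal (∫ x, (Real.cosh ‖s‖ * (1 + 2 * (Real.cosh ‖ξ x‖ - 1))
          + Real.sinh ‖s‖ / ‖s‖ * ⟪s, ξ x⟫) ∂P) := by
        exact (ofReal_integral_eq_lintegral_ofReal (hint2.add hinner)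
          (ae_of_all _ fun x => (Real.cosh_pos _).le.trans (cosh_norm_add_le s (ξ x)))).symm
    _ = ENNReal.ofReal (Real.cosh ‖s‖ * (1 + ∫ x, 2 * (Real.cosh ‖ξ x‖ - 1) ∂P)) := by
        rw [integral_add hint2 hinner, hinner0, add_zero, integral_const_mul,
          integral_add (integrable_const 1) hint]
        simp
    _ ≤ ENNReal.ofReal (Real.cosh ‖s‖) * ENNReal.ofReal (1 + V) := by
        rw [← ENNReal.ofReal_mul (Real.cosh_pos _).le]
        gcongr

lemma lintegral_cosh_norm_sum_le {ξ : Ω → G} (hm : StronglyMeasurable ξ) (hξ : Integrable ξ P)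
    (h0 : ∫ x, ξ x ∂P = 0) {V : ℝ} (hV : 0 ≤ V)
    (hcosh : ∫⁻ x, ENNReal.ofReal (2 * (Real.cosh ‖ξ x‖ - 1)) ∂P ≤ ENNReal.ofReal V) (n : ℕ) :
    ∫⁻ z, ENNReal.ofReal (Real.cosh ‖∑ i, ξ (z i)‖) ∂(Measure.pi fun _ : Fin n => P)
      ≤ ENNReal.ofReal (1 + V) ^ n := by
  have hmeas : ∀ n : ℕ, StronglyMeasurable fun z : Fin n → Ω => ∑ i, ξ (z i) := fun n =>
    Finset.stronglyMeasurable_fun_sum _ fun i _ => hm.comp_measurable (measurable_pi_apply i)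
  have hcont : Continuous fun y : G => ENNReal.ofReal (Real.cosh ‖y‖) :=
    ENNReal.continuous_ofReal.comp (by fun_prop)
  induction n with
  | zero => simp
  | succ n ih =>
    have hp := measurePreserving_piFinSuccAbove (fun _ : Fin (n + 1) => P) 0
    have hp' := hp.symm
    rw [← hp'.lintegral_comp_emb (MeasurableEquiv.measurableEmbedding _)]
    have heq : ∀ p : Ω × (Fin n → Ω),
        ENNReal.ofReal (Real.cosh ‖∑ i, ξ ((MeasurableEquiv.piFinSuccAbove
          (fun _ : Fin (n + 1) => Ω) 0).symm p i)‖)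
          = ENNReal.ofReal (Real.cosh ‖(∑ i, ξ (p.2 i)) + ξ p.1‖) := by
      intro p
      rw [Fin.sum_univ_succ, add_comm (∑ i, ξ (p.2 i))]
      simp [MeasurableEquiv.piFinSuccAbove, Fin.insertNthEquiv]
    simp_rw [heq]
    have hsm : StronglyMeasurable fun p : Ω × (Fin n → Ω) => (∑ i, ξ (p.2 i)) + ξ p.1 :=
      ((hmeas n).comp_measurable measurable_snd).add (hm.comp_measurable measurable_fst)
    rw [lintegral_prod_symm _ (hcont.comp_stronglyMeasurable hsm).measurable.aemeasurable]
    calc _ ≤ ∫⁻ z, ENNReal.ofReal (Real.cosh ‖∑ i, ξ (z i)‖) * ENNReal.ofReal (1 + V)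
          ∂(Measure.pi fun _ : Fin n => P) :=
          lintegral_mono fun z => lintegral_cosh_norm_add_le P hξ h0 hV hcosh _
      _ = (∫⁻ z, ENNReal.ofReal (Real.cosh ‖∑ i, ξ (z i)‖) ∂(Measure.pi fun _ : Fin n => P))
            * ENNReal.ofReal (1 + V) :=
          lintegral_mul_const _ (hcont.comp_stronglyMeasurable (hmeas n)).measurable
      _ ≤ _ := by
          rw [pow_succ]
          gcongr

/-- Bernstein's inequality for sums of independent, identically distributed, centred random
vectors in a Hilbert space. -/
theorem bernstein_norm_sum {ξ : Ω → G} (hm : StronglyMeasurable ξ) (hξ : Integrable ξ P)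
    (h0 : ∫ x, ξ x ∂P = 0) {v L l : ℝ} (hv : 0 ≤ v) (hL : 0 < L) (hl : 0 < l)
    (hmom : ∀ p : ℕ, ∫⁻ x, ENNReal.ofReal (‖ξ x‖ ^ (2 * (p + 1))) ∂P
      ≤ ENNReal.ofReal (1 / 2 * (2 * (p + 1)).factorial * v * L ^ (2 * p))) (n : ℕ) :
    (Measure.pi fun _ : Fin n => P)
        {z | 2 * L * l + 2 * √(2 * n * v * l) < ‖∑ i, ξ (z i)‖}
      ≤ ENNReal.ofReal (2 * Real.exp (-l)) := by
  set w := √(2 * n * v / l) with hw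
  have hw0 : 0 ≤ w := Real.sqrt_nonneg _
  have hw2 : w ^ 2 * l = 2 * n * v := by
    rw [hw, Real.sq_sqrt (by positivity)]; field_simp
  have hwl : √(2 * n * v * l) = w * l := by
    rw [← hw2, show w ^ 2 * l * l = (w * l) ^ 2 by ring, Real.sqrt_sq (by positivity)]
  -- This choice respects t L ≤ 1/2 and balances the exponent: t r = l + t w l, while the moment
  -- bound contributes 2 n t² v = (t w)² l ≤ t w l, so e^(-l) is what remains.
  set t := (2 * L + w)⁻¹ with ht
  have hden : 0 < 2 * L + w := by positivity
  have ht0 : 0 < t := inv_pos.2 hden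
  have htL : t * L ≤ 1 / 2 := by
    rw [ht, inv_mul_le_iff₀ hden]; linarith
  have htw : t * w ≤ 1 := by
    rw [ht, inv_mul_le_iff₀ hden]; linarith
  have htLw : t * (2 * L + w) = 1 := inv_mul_cancel₀ hden.ne'
  set r := 2 * L * l + 2 * √(2 * n * v * l) with hr
  have hr0 : 0 ≤ r := by positivity
  have hmain := lintegral_cosh_norm_sum_le P (hm.const_smul t) (hξ.smul t)
    (by simp only [Pi.smul_apply]; rw [integral_smul, h0, smul_zero]) (V := 2 * t ^ 2 * v)
    (by positivity)
    (lintegral_cosh_sub_one_le P hm hv hL.le ht0.le htL hmom) n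
  simp only [Pi.smul_apply, ← Finset.smul_sum] at hmain
  have hsub : {z : Fin n → Ω | r < ‖∑ i, ξ (z i)‖} ⊆
      {z | ENNReal.ofReal (Real.exp (t * r) / 2)
        ≤ ENNReal.ofReal (Real.cosh ‖t • ∑ i, ξ (z i)‖)} := by
    intro z hz
    apply ENNReal.ofReal_le_ofReal
    have h1 : t * r ≤ ‖t • ∑ i, ξ (z i)‖ := by
      rw [norm_smul, Real.norm_of_nonneg ht0.le]
      exact mul_le_mul_of_nonneg_left (le_of_lt hz) ht0.le
    calc Real.exp (t * r) / 2 ≤ Real.exp ‖t • ∑ i, ξ (z i)‖ / 2 := by gcongr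
      _ ≤ _ := by
          rw [Real.cosh_eq]
          have := Real.exp_pos (-‖t • ∑ i, ξ (z i)‖)
          linarith
  have hpos : 0 < Real.exp (t * r) / 2 := by positivity
  refine (measure_mono hsub).trans ?_
  have hmk := mul_meas_ge_le_lintegral₀ (μ := Measure.pi fun _ : Fin n => P)
    (f := fun z => ENNReal.ofReal (Real.cosh ‖t • ∑ i, ξ (z i)‖))
    (((ENNReal.continuous_ofReal.comp (by fun_prop : Continuous fun y : G => Real.cosh ‖t • y‖)).comp_stronglyMeasurable (Finset.stronglyMeasurable_fun_sum Finset.univ fun (i : Fin n) _ =>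
        hm.comp_measurable (measurable_pi_apply i))).measurable.aemeasurable)
    (ENNReal.ofReal (Real.exp (t * r) / 2))
  have hE : ENNReal.ofReal (1 + 2 * t ^ 2 * v) ^ n
      ≤ ENNReal.ofReal (Real.exp (t * r) / 2) * ENNReal.ofReal (2 * Real.exp (-l)) := by
    rw [← ENNReal.ofReal_pow (by positivity), ← ENNReal.ofReal_mul hpos.le]
    apply ENNReal.ofReal_le_ofReal
    calc (1 + 2 * t ^ 2 * v) ^ n ≤ Real.exp (2 * t ^ 2 * v) ^ n := by
          gcongr
          linarith [Real.add_one_le_exp (2 * t ^ 2 * v)]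
      _ = Real.exp (t ^ 2 * (2 * n * v)) := by
          rw [← Real.exp_nat_mul]; congr 1; ring
      _ ≤ Real.exp (t * r - l) := by
          apply Real.exp_le_exp.2
          rw [← hw2, hr, hwl]
          have h1 : t * (2 * L * l + 2 * (w * l)) = l + t * w * l := by
            linear_combination l * htLw
          have h2 : t ^ 2 * (w ^ 2 * l) = (t * w) ^ 2 * l := by ring
          rw [h1, h2]
          have h3 : (t * w) ^ 2 ≤ t * w := by nlinarith [mul_nonneg ht0.le hw0]
          nlinarith
      _ = Real.exp (t * r) / 2 * (2 * Real.exp (-l)) := by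
          rw [sub_eq_add_neg, Real.exp_add]; ring
  have := hmk.trans (hmain.trans hE)
  exact (ENNReal.mul_le_mul_iff_right (by simpa using hpos) ENNReal.ofReal_ne_top).1 this

end Bernstein

/-! ### The counting function, G⁻¹ and the effective dimension -/

section CountingBounds

variable {μ : ℕ+ → ℝ}

lemma finite_setOf_le (h0 : Tendsto μ atTop (nhds 0)) {t : ℝ} (ht : 0 < t) :
    {j : ℕ+ | t ≤ μ j}.Finite := by
  obtain ⟨J, hJ⟩ := eventually_atTop.1 (h0.eventually (gt_mem_nhds ht))
  refine (Set.finite_Iio J).subset fun j hj => ?_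
  by_contra hJj
  exact absurd (hJ j (not_lt.1 hJj)) (not_lt.2 hj)

lemma le_countF (hμ : Antitone μ) (h0 : Tendsto μ atTop (nhds 0)) {t : ℝ} (ht : 0 < t) {k : ℕ+}
    (hk : t ≤ μ k) : (k : ℕ) ≤ countF μ t := by
  have hsub : ((Finset.Icc 1 k : Finset ℕ+) : Set ℕ+) ⊆ {j : ℕ+ | t ≤ μ j} := fun j hj =>
    hk.trans (hμ (Finset.mem_Icc.1 hj).2)
  have := Set.ncard_le_ncard hsub (finite_setOf_le h0 ht)
  rw [Set.ncard_coe_finset, PNat.card_Icc] at this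
  simpa [countF] using this

lemma countF_eq_zero (hμ : Antitone μ) {t : ℝ} (ht : μ 1 < t) : countF μ t = 0 := by
  have : {j : ℕ+ | t ≤ μ j} = ∅ := by
    ext j
    simpa using (hμ one_le).trans_lt ht
  rw [countF, this, Set.ncard_empty]

lemma mul_countF_le_of_not_funG_le {r u t : ℝ} (ht : 0 < t)
    (h : ¬ funG μ r t ≤ ENNReal.ofReal u) : u * countF μ t ≤ t ^ (2 * r + 1) := by
  by_contra hlt
  rw [not_le] at hlt
  have htp : 0 < t ^ (2 * r + 1) := Real.rpow_pos_of_pos ht _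
  refine h ?_
  rw [funG]
  refine ENNReal.div_le_of_le_mul ?_
  rw [← ENNReal.ofReal_natCast, ← ENNReal.ofReal_mul' (by positivity)]
  exact ENNReal.ofReal_le_ofReal hlt.le

lemma bddAbove_invG (hμ : Antitone μ) (r u : ℝ) :
    BddAbove {t : ℝ | 0 < t ∧ funG μ r t ≤ ENNReal.ofReal u} := by
  refine ⟨μ 1, fun t ht => ?_⟩
  by_contra hlt
  rw [not_le] at hlt
  have h1 := ht.2
  have htp : 0 < t ^ (2 * r + 1) := Real.rpow_pos_of_pos ht.1 _
  rw [funG, countF_eq_zero hμ hlt, Nat.cast_zero, ENNReal.div_zero (by simpa using htp)] at h1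
  exact absurd (top_le_iff.1 h1) ENNReal.ofReal_ne_top

lemma invG_pos (hμ : Antitone μ) (hpos : ∀ j, 0 < μ j) (h0 : Tendsto μ atTop (nhds 0))
    {r u : ℝ} (hr : 0 < r) (hu : 0 < u) : 0 < invG μ r u := by
  have hr1 : 0 < 2 * r + 1 := by linarith
  -- This t belongs to the set defining G⁻¹(u): F(t) ≥ 1 since t ≤ μ₁, and t^(2r+1) ≤ u.
  set t := min (μ 1) (u ^ (2 * r + 1)⁻¹) with ht
  have ht0 : 0 < t := lt_min (hpos 1) (Real.rpow_pos_of_pos hu _)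
  refine ht0.trans_le (le_csSup (bddAbove_invG hμ r u) ⟨ht0, ?_⟩)
  by_contra hG
  have h2 : (1 : ℕ) ≤ countF μ t := le_countF hμ h0 ht0 (k := 1) (min_le_left _ _)
  rw [funG] at hG
  refine hG (ENNReal.div_le_of_le_mul ?_)
  have h3 : t ^ (2 * r + 1) ≤ u := by
    calc t ^ (2 * r + 1) ≤ (u ^ (2 * r + 1)⁻¹) ^ (2 * r + 1) :=
          Real.rpow_le_rpow ht0.le (min_le_right _ _) hr1.le
      _ = u := Real.rpow_inv_rpow hu.le hr1.ne'
  calc ENNReal.ofReal (t ^ (2 * r + 1)) ≤ ENNReal.ofReal u * 1 := by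
        rw [mul_one]; exact ENNReal.ofReal_le_ofReal h3
    _ ≤ _ := by gcongr; exact_mod_cast h2

/-- The number of eigenvalues above `G⁻¹(u)` is at most `G⁻¹(u) ^ (2 * r + 1) / u`. -/
lemma mul_le_invG_rpow (hμ : Antitone μ) (hpos : ∀ j, 0 < μ j) (h0 : Tendsto μ atTop (nhds 0))
    {r u : ℝ} (hr : 0 < r) (hu : 0 < u) {k : ℕ+} (hk : invG μ r u < μ k) :
    u * k ≤ invG μ r u ^ (2 * r + 1) := by
  have hl := invG_pos hμ hpos h0 hr hu
  set l := invG μ r u with hldef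
  -- Approach l from the right: every t > l fails G(t) ≤ u, so whether the supremum is attained does
  -- not matter.
  have hcont : Tendsto (fun t : ℝ => t ^ (2 * r + 1)) (nhdsWithin l (Ioi l))
      (nhds (l ^ (2 * r + 1))) :=
    (Real.continuousAt_rpow_const l _ (Or.inl hl.ne')).tendsto.mono_left nhdsWithin_le_nhds
  refine ge_of_tendsto hcont ?_
  filter_upwards [Ioo_mem_nhdsGT hk] with t ht
  have ht0 : 0 < t := hl.trans ht.1
  have hnot : ¬ funG μ r t ≤ ENNReal.ofReal u := fun hG =>
    notMem_of_csSup_lt ht.1 (bddAbove_invG hμ r u) ⟨ht0, hG⟩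
  calc u * k ≤ u * countF μ t := by
        gcongr
        exact_mod_cast le_countF hμ h0 ht0 ht.2.le
    _ ≤ _ := mul_countF_le_of_not_funG_le ht0 hnot

/-- For t > ε the numerator of G is at least ε^(2r+1) and the denominator at most F(ε), so G is
bounded below there. The extra 1 in the choice of δ covers F(ε) = 0. -/
lemma exists_invG_le (hμ : Antitone μ) (hpos : ∀ j, 0 < μ j) (h0 : Tendsto μ atTop (nhds 0))
    {r ε : ℝ} (hr : 0 < r) (hε : 0 < ε) :
    ∃ δ : ℝ, 0 < δ ∧ ∀ u, 0 < u → u < δ → invG μ r u ≤ ε := by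
  refine ⟨ε ^ (2 * r + 1) / (countF μ ε + 1), by positivity, fun u hu hlt => ?_⟩
  by_contra hlε
  rw [not_le] at hlε
  obtain ⟨t, ⟨ht0, htG⟩, hεt⟩ := exists_lt_of_lt_csSup (by
    by_contra hne
    rw [Set.not_nonempty_iff_eq_empty] at hne
    have := invG_pos hμ hpos h0 hr hu
    rw [invG, hne, Real.sSup_empty] at this
    exact lt_irrefl _ this) hlε
  rw [lt_div_iff₀ (by positivity)] at hlt
  have hcount : countF μ t ≤ countF μ ε :=
    Set.ncard_le_ncard (fun j hj => hεt.le.trans hj) (finite_setOf_le h0 hε)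
  have hpow : ε ^ (2 * r + 1) ≤ t ^ (2 * r + 1) :=
    Real.rpow_le_rpow hε.le hεt.le (by linarith)
  have h1 : ENNReal.ofReal (t ^ (2 * r + 1)) ≤ ENNReal.ofReal u * ((countF μ ε : ℕ) + 1 : ℝ≥0∞) := by
    have h2 : ENNReal.ofReal (t ^ (2 * r + 1)) / ((countF μ ε : ℕ) + 1 : ℝ≥0∞)
        ≤ ENNReal.ofReal u := by
      refine le_trans ?_ htG
      rw [funG]
      gcongr
      exact (Nat.cast_le.2 hcount).trans le_self_add
    exact (ENNReal.div_le_iff_le_mul (Or.inl (by simp)) (Or.inl (by simp))).1 h2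
  have h3 : ENNReal.ofReal u * ((countF μ ε : ℕ) + 1 : ℝ≥0∞)
      = ENNReal.ofReal (u * (countF μ ε + 1)) := by
    rw [ENNReal.ofReal_mul hu.le, ENNReal.ofReal_add (by positivity) zero_le_one,
      ENNReal.ofReal_natCast, ENNReal.ofReal_one]
  rw [h3, ENNReal.ofReal_le_ofReal_iff (by positivity)] at h1
  linarith

/-- Dyadic blocks: the block starting at J 2^a has J 2^a terms, each at most θ^a l. -/
lemma sum_Ico_le_of_decay (hμ : Antitone μ) {θ l : ℝ} (hθ : 0 ≤ θ) {J : ℕ+}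
    (hdecay : ∀ j, J ≤ j → μ (2 * j) ≤ θ * μ j) (hJ : μ J ≤ l) (i : ℕ) :
    ∑ j ∈ Finset.Ico J (J * 2 ^ i), μ j ≤ J * l * ∑ a ∈ Finset.range i, (2 * θ) ^ a := by
  have hJi : ∀ i : ℕ, J ≤ J * 2 ^ i := fun i => by
    rw [← PNat.coe_le_coe]; push_cast
    exact Nat.le_mul_of_pos_right _ (by positivity)
  have hdy : ∀ i : ℕ, μ (J * 2 ^ i) ≤ θ ^ i * l := by
    intro i
    induction i with
    | zero => simpa using hJ
    | succ i ih =>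
      rw [show J * 2 ^ (i + 1) = 2 * (J * 2 ^ i) by rw [pow_succ]; ac_rfl]
      calc _ ≤ θ * μ (J * 2 ^ i) := hdecay _ (hJi i)
        _ ≤ θ * (θ ^ i * l) := mul_le_mul_of_nonneg_left ih hθ
        _ = _ := by ring
  induction i with
  | zero => simp
  | succ i ih =>
    have hle2 : J * 2 ^ i ≤ J * 2 ^ (i + 1) := by
      rw [← PNat.coe_le_coe]; push_cast
      exact Nat.mul_le_mul_left _ (Nat.pow_le_pow_right (by norm_num) (Nat.le_succ i))
    rw [← Finset.Ico_union_Ico_eq_Ico (hJi i) hle2,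
      Finset.sum_union (Finset.Ico_disjoint_Ico_consecutive _ _ _), Finset.sum_range_succ, mul_add]
    refine add_le_add ih ?_
    calc ∑ j ∈ Finset.Ico (J * 2 ^ i) (J * 2 ^ (i + 1)), μ j
        ≤ (Finset.Ico (J * 2 ^ i) (J * 2 ^ (i + 1))).card • (θ ^ i * l) :=
          Finset.sum_le_card_nsmul _ _ _ fun j hj =>
            (hμ (Finset.mem_Ico.1 hj).1).trans (hdy i)
      _ = J * l * (2 * θ) ^ i := by
          rw [PNat.card_Ico, nsmul_eq_mul]
          have : ((J * 2 ^ (i + 1) : ℕ+) : ℕ) - ((J * 2 ^ i : ℕ+) : ℕ) = J * 2 ^ i := by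
            push_cast; rw [pow_succ, ← mul_assoc, mul_two, Nat.add_sub_cancel]
          rw [this, mul_pow]; push_cast; ring

/-- The constant of the effective dimension bound. -/
def effDimConst (νs κ : ℝ) : ℝ := 1 + 2 * (κ ^ 2)⁻¹ * (1 - 2 * 2 ^ (-νs))⁻¹

lemma two_mul_two_rpow_lt_one {νs : ℝ} (hνs : 1 < νs) : 2 * (2 : ℝ) ^ (-νs) < 1 := by
  have : (2 : ℝ) ^ (-νs) < 2 ^ (-1 : ℝ) :=
    Real.rpow_lt_rpow_of_exponent_lt (by norm_num) (by linarith)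
  rw [Real.rpow_neg_one] at this
  linarith

lemma one_le_effDimConst {νs : ℝ} (hνs : 1 < νs) (κ : ℝ) : 1 ≤ effDimConst νs κ := by
  have h1 : 0 < 1 - 2 * (2 : ℝ) ^ (-νs) := by linarith [two_mul_two_rpow_lt_one hνs]
  have : 0 ≤ 2 * (κ ^ 2)⁻¹ * (1 - 2 * (2 : ℝ) ^ (-νs))⁻¹ := by positivity
  rw [effDimConst]; linarith

/-- For small `l`, the effective dimension is bounded by a multiple of the number of eigenvalues
above `l`. -/
lemma exists_effDim_le (hμ : Antitone μ) (hpos : ∀ j, 0 < μ j) (h0 : Tendsto μ atTop (nhds 0))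
    {νs κ : ℝ} (hνs : 1 < νs) (hκ : 0 < κ) (hdecay : EigUpper μ νs) :
    ∃ Λ : ℝ, 0 < Λ ∧ ∀ l, 0 < l → l < Λ → ∃ k : ℕ+, l < μ k ∧
      ∀ s : Finset ℕ+, ∑ j ∈ s, μ j / (μ j + κ ^ 2 * l) ≤ effDimConst νs κ * k := by
  obtain ⟨J₀, hJ₀⟩ := eventually_atTop.1 hdecay
  refine ⟨μ J₀, hpos _, fun l hl hlt => ?_⟩
  have hex : ∃ j, μ j ≤ l := by
    obtain ⟨j, hj⟩ := (h0.eventually (gt_mem_nhds hl)).exists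
    exact ⟨j, hj.le⟩
  classical
  -- J is the first index with μ_J ≤ l, and k = J - 1 counts the eigenvalues above l. The condition
  -- l < μ_{J₀} forces J > J₀, so k ≥ 1 and the decay holds from J on.
  set J := PNat.find hex with hJ
  have hJl : μ J ≤ l := PNat.find_spec hex
  have hJ₀J : J₀ < J := by
    by_contra hle
    exact absurd (hμ (not_lt.1 hle)) (not_le.2 (hJl.trans_lt hlt))
  have hJ1 : 1 < J := one_le.trans_lt hJ₀J
  have hk1 : J - 1 + 1 = J := PNat.sub_add_of_lt hJ1
  set k : ℕ+ := J - 1 with hk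
  have hkJ : k < J := by
    rw [← hk1]; exact PNat.lt_add_right k 1
  have hkl : l < μ k := not_le.1 (PNat.find_min hex hkJ)
  have hkJ' : (J : ℝ) = k + 1 := by rw [← hk1]; push_cast; ring
  have hk1' : (1 : ℝ) ≤ k := by exact_mod_cast k.pos
  have hdec : ∀ j, J ≤ j → μ (2 * j) ≤ 2 ^ (-νs) * μ j := fun j hj =>
    (div_le_iff₀ (hpos j)).1 (hJ₀ j (hJ₀J.le.trans hj))
  refine ⟨k, hkl, fun s => ?_⟩
  obtain ⟨N, hN⟩ := s.bddAbove
  have hκ2 : 0 < κ ^ 2 := by positivity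
  have hterm0 : ∀ j, 0 ≤ μ j / (μ j + κ ^ 2 * l) := fun j => by
    have := hpos j; positivity
  have hsub : s ⊆ Finset.Ico 1 J ∪ Finset.Ico J (J * 2 ^ (N : ℕ)) := by
    intro j hj
    have hjN : j ≤ N := hN hj
    rw [Finset.mem_union, Finset.mem_Ico, Finset.mem_Ico]
    by_cases hjJ : j < J
    · exact Or.inl ⟨one_le, hjJ⟩
    · refine Or.inr ⟨not_lt.1 hjJ, hjN.trans_lt ?_⟩
      rw [← PNat.coe_lt_coe]; push_cast
      calc (N : ℕ) < 2 ^ (N : ℕ) := Nat.lt_two_pow_self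
        _ ≤ J * 2 ^ (N : ℕ) := Nat.le_mul_of_pos_left _ J.pos
  have hθ1 := two_mul_two_rpow_lt_one hνs
  have hθ0 : (0 : ℝ) < 2 ^ (-νs) := by positivity
  have hA : ∑ j ∈ Finset.Ico 1 J, μ j / (μ j + κ ^ 2 * l) ≤ k := by
    calc ∑ j ∈ Finset.Ico 1 J, μ j / (μ j + κ ^ 2 * l) ≤ (Finset.Ico 1 J).card • (1 : ℝ) :=
          Finset.sum_le_card_nsmul _ _ _ fun j _ => by
            have := hpos j
            rw [div_le_one (by positivity)]
            have : 0 ≤ κ ^ 2 * l := by positivity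
            linarith
      _ = k := by
          rw [PNat.card_Ico, nsmul_eq_mul, mul_one, ← hk1]
          push_cast; simp
  have hB : ∑ j ∈ Finset.Ico J (J * 2 ^ (N : ℕ)), μ j / (μ j + κ ^ 2 * l)
      ≤ 2 * (κ ^ 2)⁻¹ * (1 - 2 * 2 ^ (-νs))⁻¹ * k := by
    have hgeo : ∑ a ∈ Finset.range (N : ℕ), (2 * (2 : ℝ) ^ (-νs)) ^ a
        ≤ (1 - 2 * 2 ^ (-νs))⁻¹ :=
      sum_le_hasSum _ (fun _ _ => by positivity)
        (hasSum_geometric_of_lt_one (by positivity) hθ1)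
    calc ∑ j ∈ Finset.Ico J (J * 2 ^ (N : ℕ)), μ j / (μ j + κ ^ 2 * l)
        ≤ ∑ j ∈ Finset.Ico J (J * 2 ^ (N : ℕ)), (κ ^ 2 * l)⁻¹ * μ j := by
          refine Finset.sum_le_sum fun j _ => ?_
          rw [div_eq_inv_mul]
          have := hpos j
          gcongr
          linarith
      _ = (κ ^ 2 * l)⁻¹ * ∑ j ∈ Finset.Ico J (J * 2 ^ (N : ℕ)), μ j := by rw [Finset.mul_sum]
      _ ≤ (κ ^ 2 * l)⁻¹ * (J * l * (1 - 2 * 2 ^ (-νs))⁻¹) := by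
          gcongr
          exact (sum_Ico_le_of_decay hμ hθ0.le hdec hJl N).trans
            (mul_le_mul_of_nonneg_left hgeo (by positivity))
      _ = (κ ^ 2)⁻¹ * (1 - 2 * 2 ^ (-νs))⁻¹ * J := by field_simp
      -- J = k + 1 ≤ 2 k, the source of the 2 in `effDimConst`.
      _ ≤ (κ ^ 2)⁻¹ * (1 - 2 * 2 ^ (-νs))⁻¹ * (2 * k) := by
          have : 0 < (1 - 2 * (2 : ℝ) ^ (-νs))⁻¹ := inv_pos.2 (by linarith)
          gcongr
          linarith
      _ = _ := by ring
  calc ∑ j ∈ s, μ j / (μ j + κ ^ 2 * l)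
      ≤ ∑ j ∈ Finset.Ico 1 J ∪ Finset.Ico J (J * 2 ^ (N : ℕ)), μ j / (μ j + κ ^ 2 * l) :=
        Finset.sum_le_sum_of_subset_of_nonneg hsub fun j _ _ => hterm0 j
    _ = ∑ j ∈ Finset.Ico 1 J, μ j / (μ j + κ ^ 2 * l)
        + ∑ j ∈ Finset.Ico J (J * 2 ^ (N : ℕ)), μ j / (μ j + κ ^ 2 * l) :=
        Finset.sum_union (Finset.Ico_disjoint_Ico_consecutive _ _ _)
    _ ≤ effDimConst νs κ * k := by rw [effDimConst]; linarith

end CountingBounds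

/-! ### Comparison of A and T through Hilbert-Schmidt matrices -/

section Transfer

/-- The matrix `c` has Hilbert-Schmidt norm at most `√K`. -/
def HSBound {ι ι' : Type*} (c : ι → ι' → ℝ) (K : ℝ) : Prop :=
  ∀ (s : Finset ι) (s' : Finset ι'), ∑ i ∈ s, ∑ j ∈ s', c i j ^ 2 ≤ K

lemma HSBound.mono_mul {ι ι' : Type*} {c c' : ι → ι' → ℝ} {K a : ℝ} (h : HSBound c K)
    (hc : ∀ i j, |c' i j| ≤ a * |c i j|) : HSBound c' (a ^ 2 * K) := by
  intro s s'
  calc ∑ i ∈ s, ∑ j ∈ s', c' i j ^ 2 ≤ ∑ i ∈ s, ∑ j ∈ s', a ^ 2 * c i j ^ 2 := by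
        refine Finset.sum_le_sum fun i _ => Finset.sum_le_sum fun j _ => ?_
        rw [← sq_abs (c' i j), ← sq_abs (c i j), ← mul_pow]
        exact pow_le_pow_left₀ (abs_nonneg _) (hc i j) 2
    _ = a ^ 2 * ∑ i ∈ s, ∑ j ∈ s', c i j ^ 2 := by simp_rw [Finset.mul_sum]
    _ ≤ a ^ 2 * K := mul_le_mul_of_nonneg_left (h s s') (sq_nonneg a)

variable {H : Type*} [NormedAddCommGroup H] [InnerProductSpace ℝ H] {ι ι' : Type*}
  {v : HilbertBasis ι ℝ H} {b : HilbertBasis ι' ℝ H}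

lemma hsBound_of_sum_norm_sq_le {x : ι' → H} {K : ℝ}
    (hx : ∀ s : Finset ι', ∑ j ∈ s, ‖x j‖ ^ 2 ≤ K) : HSBound (fun i j => ⟪v i, x j⟫) K := by
  intro s s'
  rw [Finset.sum_comm]
  exact (Finset.sum_le_sum fun j _ => sqSumLE_inner v (x j) s).trans (hx s')

/-- The Hilbert-Schmidt norm dominates the operator norm: Cauchy-Schwarz on finite truncations, then
a limit. -/
lemma HSBound.sqSumLE {c : ι → ι' → ℝ} {K : ℝ} (hc : HSBound c K) (h : H) {y : ι → ℝ}
    (hy : ∀ i, HasSum (fun j => c i j * ⟪b j, h⟫) (y i)) : SqSumLE y (K * ‖h‖ ^ 2) := by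
  intro s
  have hlim : Tendsto (fun s' : Finset ι' => ∑ i ∈ s, (∑ j ∈ s', c i j * ⟪b j, h⟫) ^ 2) atTop
      (nhds (∑ i ∈ s, y i ^ 2)) :=
    tendsto_finsetSum _ fun i _ => (hy i).pow 2
  refine le_of_tendsto' hlim fun s' => ?_
  calc ∑ i ∈ s, (∑ j ∈ s', c i j * ⟪b j, h⟫) ^ 2
      ≤ ∑ i ∈ s, (∑ j ∈ s', c i j ^ 2) * ∑ j ∈ s', ⟪b j, h⟫ ^ 2 :=
        Finset.sum_le_sum fun i _ => Finset.sum_mul_sq_le_sq_mul_sq _ _ _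
    _ = (∑ i ∈ s, ∑ j ∈ s', c i j ^ 2) * ∑ j ∈ s', ⟪b j, h⟫ ^ 2 := by rw [Finset.sum_mul]
    _ ≤ K * ‖h‖ ^ 2 :=
        mul_le_mul (hc s s') (sqSumLE_inner b h s') (Finset.sum_nonneg fun _ _ => sq_nonneg _)
          ((Finset.sum_nonneg fun _ _ => Finset.sum_nonneg fun _ _ => sq_nonneg _).trans (hc s s'))

/-- x^p lies between 1 and x. -/
lemma abs_rpow_sub_one_le {x p : ℝ} (hx : 0 < x) (hp0 : 0 ≤ p) (hp1 : p ≤ 1) :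
    |x ^ p - 1| ≤ |x - 1| := by
  rcases le_total 1 x with h | h
  · have h1 : 1 ≤ x ^ p := Real.one_le_rpow h hp0
    have h2 : x ^ p ≤ x ^ (1 : ℝ) := Real.rpow_le_rpow_of_exponent_le h hp1
    rw [Real.rpow_one] at h2
    rw [abs_of_nonneg (by linarith), abs_of_nonneg (by linarith)]
    linarith
  · have h1 : x ^ p ≤ 1 := Real.rpow_le_one hx.le h hp0
    have h2 : x ^ (1 : ℝ) ≤ x ^ p := Real.rpow_le_rpow_of_exponent_ge hx h hp1
    rw [Real.rpow_one] at h2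
    rw [abs_of_nonpos (by linarith), abs_of_nonpos (by linarith)]
    linarith

lemma abs_rpow_sub_rpow_le {x y r : ℝ} (hr : 1 ≤ r) (hx : x ∈ Icc (0 : ℝ) 1)
    (hy : y ∈ Icc (0 : ℝ) 1) : |x ^ r - y ^ r| ≤ r * |x - y| := by
  have h := Convex.norm_image_sub_le_of_norm_hasDerivWithin_le (f := fun z : ℝ => z ^ r)
    (f' := fun z => r * z ^ (r - 1)) (s := Icc (0 : ℝ) 1) (C := r)
    (fun z _ => (Real.hasDerivAt_rpow_const (Or.inr hr)).hasDerivWithinAt)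
    (fun z hz => by
      rw [Real.norm_of_nonneg (mul_nonneg (by linarith) (Real.rpow_nonneg hz.1 _))]
      have := Real.rpow_le_one hz.1 hz.2 (by linarith : 0 ≤ r - 1)
      nlinarith) (convex_Icc 0 1) hy hx
  simpa using h

lemma hasSum_inner_basis (x h : H) : HasSum (fun j => ⟪x, b j⟫ * ⟪b j, h⟫) ⟪x, h⟫ :=
  b.hasSum_inner_mul_inner x h

variable {m : ι' → ℝ} {t : ι → ℝ} {l : ℝ}

/-- Comparison of negative fractional powers of two shifted operators whose resolvent difference
is bounded in Hilbert-Schmidt norm. -/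
lemma sqSumLE_rpow_transfer (hm : ∀ j, 0 ≤ m j) (ht : ∀ i, 0 ≤ t i) (hl : 0 < l)
    (hK : HSBound (fun i j => (m j - t i) / (t i + l) * ⟪v i, b j⟫) 1) {p : ℝ} (hp0 : 0 ≤ p)
    (hp1 : p ≤ 1) {ζ : H} {B : ℝ} (hζ : SqSumLE (fun j => (m j + l) ^ (-p) * ⟪b j, ζ⟫) B) :
    SqSumLE (fun i => (t i + l) ^ (-p) * ⟪v i, ζ⟫) (4 * B) := by
  obtain ⟨h, hh⟩ := exists_inner_eq b hζ
  have hml : ∀ j, 0 < m j + l := fun j => by linarith [hm j]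
  have htl : ∀ i, 0 < t i + l := fun i => by linarith [ht i]
  have hhB : ‖h‖ ^ 2 ≤ B := norm_sq_le_of_sqSumLE b (by simpa only [hh] using hζ)
  -- This is the matrix of (T + l)^(-p) (A + l)^p - 1. Since (m_j + l)/(t_i + l) - 1 = (m_j -
  -- t_i)/(t_i + l), it is dominated entrywise by the resolvent difference. Applied to h = (A +
  -- l)^(-p) ζ it produces (T + l)^(-p) ζ - h.
  have hc : HSBound (fun i j => (((m j + l) / (t i + l)) ^ p - 1) * ⟪v i, b j⟫) (1 ^ 2 * 1) := by
    refine hK.mono_mul fun i j => ?_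
    rw [abs_mul, abs_mul, one_mul]
    refine mul_le_mul_of_nonneg_right ?_ (abs_nonneg _)
    refine (abs_rpow_sub_one_le (div_pos (hml j) (htl i)) hp0 hp1).trans (le_of_eq ?_)
    congr 1
    have := (htl i).ne'
    field_simp
    ring
  have hsum : ∀ i, HasSum (fun j => ((((m j + l) / (t i + l)) ^ p - 1) * ⟪v i, b j⟫) * ⟪b j, h⟫)
      ((t i + l) ^ (-p) * ⟪v i, ζ⟫ - ⟪v i, h⟫) := by
    intro i
    refine (((hasSum_inner_basis (b := b) (v i) ζ).mul_left ((t i + l) ^ (-p))).sub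
      (hasSum_inner_basis (b := b) (v i) h)).congr_fun fun j => ?_
    rw [hh, Real.div_rpow (hml j).le (htl i).le, Real.rpow_neg (hml j).le,
      Real.rpow_neg (htl i).le]
    have h1 : (m j + l) ^ p ≠ 0 := (Real.rpow_pos_of_pos (hml j) p).ne'
    have h2 : (t i + l) ^ p ≠ 0 := (Real.rpow_pos_of_pos (htl i) p).ne'
    field_simp
  have h1 := (hc.sqSumLE h hsum).add (sqSumLE_inner v h)
  simp only [sub_add_cancel] at h1
  exact h1.mono_right (by linarith)

/-- In the mixed bases A^r - T^r has entries (m_j^r - t_i^r) ⟪v_i, b_j⟫, so the scalar Lipschitz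
constant r carries over to Hilbert-Schmidt norm. -/
lemma sqSumLE_rpow_sub (hm : ∀ j, m j ∈ Icc (0 : ℝ) 1) (ht : ∀ i, t i ∈ Icc (0 : ℝ) 1) {r K : ℝ}
    (hr : 1 ≤ r) (hK : HSBound (fun i j => (m j - t i) * ⟪v i, b j⟫) K) {f h : H}
    (hf : ∀ j, ⟪b j, f⟫ = m j ^ r * ⟪b j, h⟫) :
    SqSumLE (fun i => ⟪v i, f⟫ - t i ^ r * ⟪v i, h⟫) (r ^ 2 * K * ‖h‖ ^ 2) := by
  have hc : HSBound (fun i j => (m j ^ r - t i ^ r) * ⟪v i, b j⟫) (r ^ 2 * K) := by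
    refine hK.mono_mul fun i j => ?_
    rw [abs_mul, abs_mul, ← mul_assoc]
    exact mul_le_mul_of_nonneg_right (abs_rpow_sub_rpow_le hr (hm j) (ht i)) (abs_nonneg _)
  refine hc.sqSumLE (b := b) h fun i => ?_
  refine ((hasSum_inner_basis (b := b) (v i) f).sub
    ((hasSum_inner_basis (b := b) (v i) h).mul_left (t i ^ r))).congr_fun fun j => ?_
  rw [hf]; ring

variable {A T : H →L[ℝ] H}

lemma inner_sub_apply_basis (hT : IsDiag v T t) (hA : IsDiag b A m) (i : ι) (j : ι') :
    ⟪v i, (A - T) (b j)⟫ = (m j - t i) * ⟪v i, b j⟫ := by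
  rw [sub_apply, inner_sub_right, hA j, hT.inner_apply, inner_smul_right]
  ring

lemma hsBound_sub (hT : IsDiag v T t) (hA : IsDiag b A m) {K : ℝ}
    (hK : ∀ s : Finset ι', ∑ j ∈ s, ‖(A - T) (b j)‖ ^ 2 ≤ K) :
    HSBound (fun i j => (m j - t i) * ⟪v i, b j⟫) K := by
  simpa only [inner_sub_apply_basis hT hA] using hsBound_of_sum_norm_sq_le (v := v) hK

lemma abs_inv_add_le {x l : ℝ} (hx : 0 ≤ x) (hl : 0 < l) : |(x + l)⁻¹| ≤ l⁻¹ := by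
  rw [abs_of_nonneg (by positivity)]
  gcongr
  linarith

/-- If `(A + l)⁻¹ (A - T)` has Hilbert-Schmidt norm at most `1 / 2`, then `(T + l)⁻¹ (A - T)` has
Hilbert-Schmidt norm at most `1`. -/
lemma hsBound_resolvent (hT : IsDiag v T t) (hA : IsDiag b A m) (hm : ∀ j, 0 ≤ m j)
    (ht : ∀ i, 0 ≤ t i) (hl : 0 < l)
    (hK : ∀ s : Finset ι',
      ∑ j ∈ s, ‖diagOp b (fun j => (m j + l)⁻¹) ((A - T) (b j))‖ ^ 2 ≤ 1 / 4) :
    HSBound (fun i j => (m j - t i) / (t i + l) * ⟪v i, b j⟫) 1 := by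
  set RA := diagOp b (fun j => (m j + l)⁻¹) with hRA
  set RT := diagOp v (fun i => (t i + l)⁻¹) with hRT
  have hRAi : ∀ f j, ⟪b j, RA f⟫ = (m j + l)⁻¹ * ⟪b j, f⟫ :=
    inner_diagOp b fun j => abs_inv_add_le (hm j) hl
  have hRTi : ∀ f i, ⟪v i, RT f⟫ = (t i + l)⁻¹ * ⟪v i, f⟫ :=
    inner_diagOp v fun i => abs_inv_add_le (ht i) hl
  have hZ : ∀ q, ‖RA ((A - T) q)‖ ^ 2 ≤ 1 / 4 * ‖q‖ ^ 2 := by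
    intro q
    refine norm_sq_le_of_sqSumLE b ((hsBound_of_sum_norm_sq_le (v := b) hK).sqSumLE (b := b) q
      fun i => ?_)
    have h1 := ((innerSL ℝ (b i)).comp (RA.comp (A - T))).hasSum (b.hasSum_repr q)
    refine h1.congr_fun fun j => ?_
    simp only [ContinuousLinearMap.comp_apply, map_smul, innerSL_apply_apply, smul_eq_mul,
      b.repr_apply_apply]
    ring
  have hX : ∀ j, ‖RT ((A - T) (b j))‖ ^ 2 ≤ 4 * ‖RA ((A - T) (b j))‖ ^ 2 := by
    intro j
    set y := (A - T) (b j) with hy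
    set q := RT y with hq
    have hTq : T q + l • q = y := ext_inner_basis v fun i => by
      rw [inner_add_right, hT.inner_apply, inner_smul_right, hq, hRTi]
      have := (by linarith [ht i] : 0 < t i + l).ne'
      field_simp
    -- Resolvent identity, from (A + l) q = (T + l) q + (A - T) q. The last term has norm at most
    -- ‖q‖/2 and is absorbed on the left.
    have hqp : q = RA y + RA ((A - T) q) := ext_inner_basis b fun i => by
      rw [inner_add_right, hRAi, hRAi, ← hTq, sub_apply, inner_sub_right,
        inner_add_right, hA.inner_apply, inner_smul_right]
      have := (by linarith [hm i] : 0 < m i + l).ne'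
      field_simp
      ring
    have h1 : ‖q‖ ≤ ‖RA y‖ + ‖RA ((A - T) q)‖ := by
      calc ‖q‖ = ‖RA y + RA ((A - T) q)‖ := by rw [← hqp]
        _ ≤ _ := norm_add_le _ _
    have h2 : ‖RA ((A - T) q)‖ ≤ 1 / 2 * ‖q‖ := by
      refine le_of_sq_le_sq ?_ (by positivity)
      calc _ ≤ _ := hZ q
        _ = _ := by ring
    have h3 : ‖q‖ ≤ 2 * ‖RA y‖ := by linarith
    calc ‖q‖ ^ 2 ≤ (2 * ‖RA y‖) ^ 2 := by gcongr
      _ = _ := by ring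
  have hXs : ∀ s : Finset ι', ∑ j ∈ s, ‖RT ((A - T) (b j))‖ ^ 2 ≤ 1 := fun s => by
    refine (Finset.sum_le_sum fun j _ => hX j).trans ?_
    rw [← Finset.mul_sum]
    linarith [hK s]
  have h := hsBound_of_sum_norm_sq_le (v := v) hXs
  simp only [hRTi, inner_sub_apply_basis hT hA] at h
  simpa only [div_eq_inv_mul, mul_assoc] using h

/-- The energy of `A` is dominated by the shifted energy of `T`. -/
lemma inner_apply_le_of_sqSumLE (hA : IsDiag b A m) (hm : ∀ j, 0 ≤ m j) (ht : ∀ i, 0 ≤ t i)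
    (hl : 0 < l) (hK : HSBound (fun i j => (m j - t i) / (t i + l) * ⟪v i, b j⟫) 1) {w : H}
    {B : ℝ} (hw : SqSumLE (fun i => (t i + l) ^ (1 / 2 : ℝ) * ⟪v i, w⟫) B) :
    ⟪A w, w⟫ ≤ 4 * B := by
  have hml : ∀ j, 0 < m j + l := fun j => by linarith [hm j]
  have htl : ∀ i, 0 < t i + l := fun i => by linarith [ht i]
  set ζ := A w + l • w with hζ
  have hζj : ∀ j, ⟪b j, ζ⟫ = (m j + l) * ⟪b j, w⟫ := fun j => by
    rw [hζ, inner_add_right, hA.inner_apply, inner_smul_right]; ring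
  have hQ : HasSum (fun j => (m j + l) * ⟪b j, w⟫ ^ 2) ⟪ζ, w⟫ := by
    refine (hasSum_inner_basis (b := b) ζ w).congr_fun fun j => ?_
    rw [real_inner_comm (b j) ζ, hζj]; ring
  have hhalf : ∀ x : ℝ, 0 < x → (x ^ (-(1 / 2) : ℝ)) ^ 2 = x⁻¹ := fun x hx => by
    rw [← Real.rpow_natCast, ← Real.rpow_mul hx.le]
    norm_num
    rw [Real.rpow_neg_one]
  have h1 : SqSumLE (fun j => (m j + l) ^ (-(1 / 2) : ℝ) * ⟪b j, ζ⟫) ⟪ζ, w⟫ := by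
    intro s
    refine le_trans (le_of_eq ?_) (sum_le_hasSum s (fun j _ => by have := hml j; positivity) hQ)
    refine Finset.sum_congr rfl fun j _ => ?_
    rw [mul_pow, hhalf _ (hml j), hζj]
    have := (hml j).ne'
    field_simp
  have h2 := sqSumLE_rpow_transfer hm ht hl hK (p := 1 / 2) (by norm_num) (by norm_num) h1
  have hQ0 : 0 ≤ ⟪ζ, w⟫ := h1.nonneg
  -- Cauchy-Schwarz in the basis v between (T + l)^(-1/2) ζ and (T + l)^(1/2) w. The transfer bounds
  -- the first by 4 ⟪ζ, w⟫, and one factor ⟪ζ, w⟫ then cancels.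
  have h3 : ⟪ζ, w⟫ ^ 2 ≤ 4 * ⟪ζ, w⟫ * B := by
    have hlim := (hasSum_inner_basis (b := v) ζ w).pow 2
    refine le_of_tendsto' hlim fun s => ?_
    calc (∑ i ∈ s, ⟪ζ, v i⟫ * ⟪v i, w⟫) ^ 2
        = (∑ i ∈ s, ((t i + l) ^ (-(1 / 2) : ℝ) * ⟪v i, ζ⟫)
            * ((t i + l) ^ (1 / 2 : ℝ) * ⟪v i, w⟫)) ^ 2 := by
          congr 1
          refine Finset.sum_congr rfl fun i _ => ?_
          rw [Real.rpow_neg (htl i).le, real_inner_comm (v i) ζ]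
          have := (Real.rpow_pos_of_pos (htl i) (1 / 2)).ne'
          field_simp
      _ ≤ _ := Finset.sum_mul_sq_le_sq_mul_sq _ _ _
      _ ≤ 4 * ⟪ζ, w⟫ * B :=
          mul_le_mul (h2 s) (hw s) (Finset.sum_nonneg fun _ _ => sq_nonneg _) (by linarith)
  have h4 : ⟪ζ, w⟫ ≤ 4 * B := by
    rcases hQ0.eq_or_lt with h | h
    · rw [← h]; linarith [hw.nonneg]
    · have : ⟪ζ, w⟫ * ⟪ζ, w⟫ ≤ ⟪ζ, w⟫ * (4 * B) := by nlinarith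
      exact le_of_mul_le_mul_left this h
  have h5 : ⟪ζ, w⟫ = ⟪A w, w⟫ + l * ‖w‖ ^ 2 := by
    rw [hζ, inner_add_left, inner_smul_left, real_inner_self_eq_norm_sq]; rfl
  have : 0 ≤ l * ‖w‖ ^ 2 := by positivity
  linarith

end Transfer

/-! ### Deterministic error bound -/

section ErrorBound

/-- The residual function at the eigenvalue `t`, with value `1` at `0`. -/
def residual (g : ℝ → ℝ → ℝ) (l t : ℝ) : ℝ := if t = 0 then 1 else 1 - g l t * t

/-- The regularization function, with value `0` at `0`. -/
def regZero (g : ℝ → ℝ → ℝ) (l t : ℝ) : ℝ := if t = 0 then 0 else g l t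

/-- A common bound for the residual constants. -/
def residualConst (γ₀ γq : ℝ) : ℝ := max 1 (max γ₀ γq)

lemma one_le_residualConst (γ₀ γq : ℝ) : 1 ≤ residualConst γ₀ γq := le_max_left _ _

variable {g : ℝ → ℝ → ℝ} {D E γ₀ γq q l : ℝ}

/-- A qualification q implies every smaller one. For t ≤ l the uniform bound γ₀ suffices; for t > l
write t^p = t^q t^(p-q) and use t^(p-q) ≤ l^(p-q). The factor 2^p comes from t + l ≤ 2 max(t, l). -/
lemma abs_residual_mul_le (hg : IsRegularization g D E γ₀) (hgq : QualificationBound g q γq)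
    (hl : l ∈ Ioc (0 : ℝ) 1) {t : ℝ} (ht : t ∈ Icc (0 : ℝ) 1) {p : ℝ} (hp : 0 ≤ p)
    (hpq : p ≤ q) :
    |residual g l t| * (t + l) ^ p ≤ residualConst γ₀ γq * 2 ^ p * l ^ p := by
  have hG0 : 0 ≤ residualConst γ₀ γq := zero_le_one.trans (one_le_residualConst γ₀ γq)
  have hl0 : 0 < l := hl.1
  rw [mul_assoc]
  rcases le_or_gt t l with htl | htl
  · have h1 : |residual g l t| ≤ residualConst γ₀ γq := by
      rw [residual]
      split_ifs with h0
      · simpa using one_le_residualConst γ₀ γq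
      · exact (hg.residual_le l hl t ⟨ht.1.lt_of_ne (Ne.symm h0), ht.2⟩).trans
          ((le_max_left _ _).trans (le_max_right _ _))
    rw [← Real.mul_rpow (by norm_num) hl0.le]
    exact mul_le_mul h1 (Real.rpow_le_rpow (by linarith [ht.1]) (by linarith) hp)
      (Real.rpow_nonneg (by linarith [ht.1]) _) hG0
  · have ht0 : 0 < t := hl0.trans htl
    have h1 : |residual g l t| * t ^ p ≤ residualConst γ₀ γq * l ^ p := by
      rw [residual, if_neg ht0.ne']
      have e1 : t ^ p = t ^ q * t ^ (p - q) := by rw [← Real.rpow_add ht0]; ring_nf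
      have e2 : l ^ p = l ^ q * l ^ (p - q) := by rw [← Real.rpow_add hl0]; ring_nf
      rw [e1, e2, ← mul_assoc, ← mul_assoc]
      have h2 := hgq l hl t ⟨ht0, ht.2⟩
      have h3 : t ^ (p - q) ≤ l ^ (p - q) :=
        Real.rpow_le_rpow_of_nonpos hl0 htl.le (by linarith)
      have h4 : γq * l ^ q ≤ residualConst γ₀ γq * l ^ q :=
        mul_le_mul_of_nonneg_right ((le_max_right _ _).trans (le_max_right _ _)) (by positivity)
      exact mul_le_mul (h2.trans h4) h3 (by positivity) (by positivity)
    calc |residual g l t| * (t + l) ^ p ≤ |residual g l t| * (2 * t) ^ p := by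
          gcongr; linarith
      _ = 2 ^ p * (|residual g l t| * t ^ p) := by
          rw [Real.mul_rpow (by norm_num) ht0.le]; ring
      _ ≤ 2 ^ p * (residualConst γ₀ γq * l ^ p) := by gcongr
      _ = _ := by ring

lemma abs_regZero_mul_le (hg : IsRegularization g D E γ₀) (hl : l ∈ Ioc (0 : ℝ) 1) {t : ℝ}
    (ht : t ∈ Icc (0 : ℝ) 1) : |regZero g l t| * (t + l) ≤ |D| + |E| := by
  rw [regZero]
  split_ifs with h0
  · simp; positivity
  · have ht' : t ∈ Ioc (0 : ℝ) 1 := ⟨ht.1.lt_of_ne (Ne.symm h0), ht.2⟩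
    have h1 := hg.mul_le l hl t ht'
    have h2 := hg.le_div l hl t ht'
    rw [le_div_iff₀ hl.1] at h2
    rw [abs_mul, abs_of_pos ht'.1] at h1
    nlinarith [le_abs_self D, le_abs_self E]

/-- The constant in the deterministic error bound. -/
def errorConst (r D E γ₀ γq c a : ℝ) : ℝ :=
  3 * ((|D| + |E|) * a + residualConst γ₀ γq * 2 ^ (r + 1) * c * (1 + r))

variable {H : Type*} [NormedAddCommGroup H] [InnerProductSpace ℝ H] {ι ι' : Type*}
  {v : HilbertBasis ι ℝ H} {b : HilbertBasis ι' ℝ H} {A T : H →L[ℝ] H}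
  {m : ι' → ℝ} {t : ι → ℝ}

/-- Factor (T + l)^s g(T) ξ as (T + l)^(s-1/2), times g(T)(T + l), times (T + l)^(-1/2) ξ. The first
is at most l^(s-1/2) because s ≤ 1/2, the second at most |D| + |E|, and the third is transferred to
A. -/
lemma sqSumLE_noise (hg : IsRegularization g D E γ₀) (hl : l ∈ Ioc (0 : ℝ) 1)
    (hm : ∀ j, m j ∈ Icc (0 : ℝ) 1) (ht : ∀ i, t i ∈ Icc (0 : ℝ) 1)
    (hK : HSBound (fun i j => (m j - t i) / (t i + l) * ⟪v i, b j⟫) 1)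
    {s : ℝ} (hs : s ≤ 1 / 2) {ξ : H} {B : ℝ}
    (hξ : SqSumLE (fun j => (m j + l) ^ (-(1 / 2) : ℝ) * ⟪b j, ξ⟫) (B ^ 2)) :
    SqSumLE (fun i => (t i + l) ^ s * (regZero g l (t i) * ⟪v i, ξ⟫))
      (((|D| + |E|) * l ^ (s - 1 / 2)) ^ 2 * (4 * B ^ 2)) := by
  have h := sqSumLE_rpow_transfer (fun j => (hm j).1) (fun i => (ht i).1) hl.1 hK
    (p := 1 / 2) (by norm_num) (by norm_num) hξ
  refine h.mono_mul fun i => ?_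
  have hl0 := hl.1
  have htl : 0 < t i + l := by linarith [(ht i).1]
  have h1 := abs_regZero_mul_le hg hl (ht i)
  rw [abs_mul, abs_mul, abs_mul, abs_of_pos (Real.rpow_pos_of_pos htl _),
    abs_of_pos (Real.rpow_pos_of_pos htl _)]
  have e1 : (t i + l) ^ s = (t i + l) ^ (s - 1 / 2) * ((t i + l) ^ (-(1 / 2) : ℝ) * (t i + l)) := by
    nth_rewrite 4 [← Real.rpow_one (t i + l)]
    rw [← Real.rpow_add htl, ← Real.rpow_add htl]
    ring_nf
  have h2 : (t i + l) ^ (s - 1 / 2) ≤ l ^ (s - 1 / 2) :=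
    Real.rpow_le_rpow_of_nonpos hl0 (by linarith [(ht i).1]) (by linarith)
  calc (t i + l) ^ s * (|regZero g l (t i)| * |⟪v i, ξ⟫|)
      = (t i + l) ^ (s - 1 / 2) * (|regZero g l (t i)| * (t i + l))
          * ((t i + l) ^ (-(1 / 2) : ℝ) * |⟪v i, ξ⟫|) := by rw [e1]; ring
    _ ≤ l ^ (s - 1 / 2) * (|D| + |E|) * ((t i + l) ^ (-(1 / 2) : ℝ) * |⟪v i, ξ⟫|) := by
        gcongr
    _ = _ := by ring

lemma sqSumLE_approx (hg : IsRegularization g D E γ₀) (hgq : QualificationBound g q γq)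
    (hl : l ∈ Ioc (0 : ℝ) 1) (hm : ∀ j, m j ∈ Icc (0 : ℝ) 1) (ht : ∀ i, t i ∈ Icc (0 : ℝ) 1)
    (hK : HSBound (fun i j => (m j - t i) / (t i + l) * ⟪v i, b j⟫) 1)
    {r s R L c : ℝ} (hr : 0 < r) (hs0 : 0 ≤ s) (hs : s ≤ 1 / 2) (hrs : r + s ≤ q) (hL : 1 ≤ L)
    (hc : 0 ≤ c) (hR : 0 ≤ R) (hΔ : HSBound (fun i j => (m j - t i) * ⟪v i, b j⟫) ((L * l ^ r) ^ 2))
    {f h : H} (hh : ‖h‖ ≤ R) (hf : ∀ j, ⟪b j, f⟫ = c * m j ^ r * ⟪b j, h⟫) :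
    SqSumLE (fun i => (t i + l) ^ s * (residual g l (t i) * ⟪v i, f⟫))
      (4 * (residualConst γ₀ γq * 2 ^ (r + 1) * c * (1 + r) * (L * R * l ^ (r + s))) ^ 2) := by
  have hl0 := hl.1
  set Γ := residualConst γ₀ γq with hΓ
  have hΓ0 : 0 < Γ := zero_lt_one.trans_le (one_le_residualConst γ₀ γq)
  have htl : ∀ i, 0 < t i + l := fun i => by linarith [(ht i).1]
  have h2 : (2 : ℝ) ^ (r + s) ≤ 2 ^ (r + 1) :=
    Real.rpow_le_rpow_of_exponent_le (by norm_num) (by linarith)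
  have h2s : (2 : ℝ) ^ s ≤ 2 ^ (r + 1) :=
    Real.rpow_le_rpow_of_exponent_le (by norm_num) (by linarith)
  have hls : 0 < l ^ (r + s) := Real.rpow_pos_of_pos hl0 _
  have hres : ∀ p, 0 ≤ p → p ≤ q → ∀ i, |residual g l (t i)| * (t i + l) ^ p ≤ Γ * 2 ^ p * l ^ p :=
    fun p hp hpq i => abs_residual_mul_le hg hgq hl (ht i) hp hpq
  have hR2 : ‖h‖ ^ 2 ≤ R ^ 2 := by gcongr
  rcases le_total r 1 with hr1 | hr1
  -- For r ≤ 1 the whole source condition transfers: (T + l)^(-r) f is bounded by 2 c R, and the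
  -- residual absorbs (T + l)^(r+s).
  · have hfB : SqSumLE (fun j => (m j + l) ^ (-r) * ⟪b j, f⟫) (c ^ 2 * R ^ 2) := by
      refine ((sqSumLE_inner b h).mono_right hR2).mono_mul fun j => ?_
      have hml : 0 < m j + l := by linarith [(hm j).1]
      rw [hf, abs_mul, abs_mul, abs_mul, abs_of_pos (Real.rpow_pos_of_pos hml _), abs_of_nonneg hc,
        abs_of_nonneg (Real.rpow_nonneg (hm j).1 _), Real.rpow_neg hml.le]
      have h3 : m j ^ r ≤ (m j + l) ^ r := Real.rpow_le_rpow (hm j).1 (by linarith) hr.le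
      have h4 : ((m j + l) ^ r)⁻¹ * m j ^ r ≤ 1 := by
        rw [inv_mul_le_iff₀ (Real.rpow_pos_of_pos hml _), mul_one]; exact h3
      calc ((m j + l) ^ r)⁻¹ * (c * m j ^ r * |⟪b j, h⟫|)
          = ((m j + l) ^ r)⁻¹ * m j ^ r * (c * |⟪b j, h⟫|) := by ring
        _ ≤ 1 * (c * |⟪b j, h⟫|) := by gcongr
        _ = _ := one_mul _
    have h5 := sqSumLE_rpow_transfer (fun j => (hm j).1) (fun i => (ht i).1) hl0 hK hr.le hr1 hfB
    refine (h5.mono_mul (a' := fun i => (t i + l) ^ s * (residual g l (t i) * ⟪v i, f⟫))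
      (c := Γ * 2 ^ (r + 1) * l ^ (r + s)) fun i => ?_).mono_right ?_
    · rw [abs_mul, abs_mul, abs_mul, abs_of_pos (Real.rpow_pos_of_pos (htl i) _),
        abs_of_pos (Real.rpow_pos_of_pos (htl i) _)]
      have e1 : (t i + l) ^ s = (t i + l) ^ (r + s) * (t i + l) ^ (-r) := by
        rw [← Real.rpow_add (htl i)]; ring_nf
      calc (t i + l) ^ s * (|residual g l (t i)| * |⟪v i, f⟫|)
          = |residual g l (t i)| * (t i + l) ^ (r + s) * ((t i + l) ^ (-r) * |⟪v i, f⟫|) := by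
            rw [e1]; ring
        _ ≤ Γ * 2 ^ (r + s) * l ^ (r + s) * ((t i + l) ^ (-r) * |⟪v i, f⟫|) := by
            have := htl i
            exact mul_le_mul_of_nonneg_right (hres _ (by linarith) hrs i) (by positivity)
        _ ≤ _ := by
            have := htl i
            gcongr
    · have h6 : Γ * 2 ^ (r + 1) * l ^ (r + s) * c * R
          ≤ Γ * 2 ^ (r + 1) * c * (1 + r) * (L * R * l ^ (r + s)) := by
        have h7 : 1 ≤ (1 + r) * L := by nlinarith
        have h8 : 0 ≤ Γ * 2 ^ (r + 1) * l ^ (r + s) * c * R := by positivity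
        nlinarith
      have h9 : 0 ≤ Γ * 2 ^ (r + 1) * l ^ (r + s) * c * R := by positivity
      nlinarith [pow_le_pow_left₀ h9 h6 2]
  -- For r ≥ 1 the transfer of (A + l)^(-r) is unavailable. Instead f = T^r(c h) + (A^r - T^r)(c h):
  -- the first part satisfies a source condition for T, the second already has size L l^r.
  · have hf' : ∀ j, ⟪b j, f⟫ = m j ^ r * ⟪b j, c • h⟫ := fun j => by
      rw [hf, inner_smul_right]; ring
    have h3 := sqSumLE_rpow_sub hm ht hr1 hΔ hf'
    have hch : ‖c • h‖ ^ 2 ≤ (c * R) ^ 2 := by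
      rw [norm_smul, Real.norm_of_nonneg hc]
      gcongr
    have h4 := (h3.mono_right (mul_le_mul_of_nonneg_left hch (by positivity))).mono_mul
      (a' := fun i => (t i + l) ^ s * residual g l (t i) * (⟪v i, f⟫ - t i ^ r * ⟪v i, c • h⟫))
      (c := Γ * 2 ^ (r + 1) * l ^ s) fun i => by
        rw [abs_mul, abs_mul, abs_of_pos (Real.rpow_pos_of_pos (htl i) _)]
        refine mul_le_mul_of_nonneg_right ?_ (abs_nonneg _)
        rw [mul_comm]
        refine (hres s hs0 (by linarith) i).trans ?_
        gcongr
    have h5 := ((sqSumLE_inner v (c • h)).mono_right hch).mono_mul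
      (a' := fun i => (t i + l) ^ s * residual g l (t i) * (t i ^ r * ⟪v i, c • h⟫))
      (c := Γ * 2 ^ (r + 1) * l ^ (r + s)) fun i => by
        rw [abs_mul, abs_mul, abs_mul, abs_of_pos (Real.rpow_pos_of_pos (htl i) _),
          abs_of_nonneg (Real.rpow_nonneg (ht i).1 _), ← mul_assoc]
        refine mul_le_mul_of_nonneg_right ?_ (abs_nonneg _)
        calc (t i + l) ^ s * |residual g l (t i)| * t i ^ r
            ≤ (t i + l) ^ s * |residual g l (t i)| * (t i + l) ^ r := by
              have := htl i
              gcongr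
              · exact (ht i).1
              · linarith
          _ = |residual g l (t i)| * (t i + l) ^ (r + s) := by
              rw [Real.rpow_add (htl i)]; ring
          _ ≤ Γ * 2 ^ (r + s) * l ^ (r + s) := hres _ (by linarith) hrs i
          _ ≤ _ := by gcongr
    have h6 := h4.add h5
    have e : (fun i => (t i + l) ^ s * residual g l (t i) * (⟪v i, f⟫ - t i ^ r * ⟪v i, c • h⟫)
        + (t i + l) ^ s * residual g l (t i) * (t i ^ r * ⟪v i, c • h⟫))
        = fun i => (t i + l) ^ s * (residual g l (t i) * ⟪v i, f⟫) := by
      funext i; ring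
    rw [e] at h6
    refine h6.mono_right ?_
    have e2 : l ^ (r + s) = l ^ r * l ^ s := Real.rpow_add hl0 _ _
    set x := Γ * 2 ^ (r + 1) * l ^ (r + s) * (c * R) with hx
    have hx0 : 0 ≤ x := by positivity
    have e3 : 2 * ((Γ * 2 ^ (r + 1) * l ^ s) ^ 2 * (r ^ 2 * (L * l ^ r) ^ 2 * (c * R) ^ 2))
        + 2 * ((Γ * 2 ^ (r + 1) * l ^ (r + s)) ^ 2 * (c * R) ^ 2)
        = 2 * (x * (r * L)) ^ 2 + 2 * x ^ 2 := by rw [hx, e2]; ring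
    have e4 : Γ * 2 ^ (r + 1) * c * (1 + r) * (L * R * l ^ (r + s)) = x * ((1 + r) * L) := by
      rw [hx]; ring
    rw [e3, e4]
    have h7 : (r * L) ^ 2 + 1 ≤ ((1 + r) * L) ^ 2 := by
      have hL0 : 0 ≤ L := by linarith
      nlinarith [mul_nonneg (mul_nonneg hr.le hL0) hL0]
    have h8 := mul_le_mul_of_nonneg_left h7 (sq_nonneg x)
    nlinarith [sq_nonneg (x * ((1 + r) * L))]

/-- The deterministic error bound for spectral regularization. -/
lemma sqSumLE_error (hg : IsRegularization g D E γ₀) (hgq : QualificationBound g q γq)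
    (hl : l ∈ Ioc (0 : ℝ) 1) (hm : ∀ j, m j ∈ Icc (0 : ℝ) 1) (ht : ∀ i, t i ∈ Icc (0 : ℝ) 1)
    (hK : HSBound (fun i j => (m j - t i) / (t i + l) * ⟪v i, b j⟫) 1)
    {r s R L c a : ℝ} (hr : 0 < r) (hs0 : 0 ≤ s) (hs : s ≤ 1 / 2) (hrs : r + s ≤ q) (hL : 1 ≤ L)
    (hc : 0 ≤ c) (hR : 0 ≤ R) (ha : 0 ≤ a)
    (hΔ : HSBound (fun i j => (m j - t i) * ⟪v i, b j⟫) ((L * l ^ r) ^ 2))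
    {f h ξ w : H} (hh : ‖h‖ ≤ R) (hf : ∀ j, ⟪b j, f⟫ = c * m j ^ r * ⟪b j, h⟫)
    (hξ : SqSumLE (fun j => (m j + l) ^ (-(1 / 2) : ℝ) * ⟪b j, ξ⟫)
      ((a * (L * R * l ^ (r + 1 / 2))) ^ 2))
    (hw : ∀ i, ⟪v i, w⟫ = residual g l (t i) * ⟪v i, f⟫ - regZero g l (t i) * ⟪v i, ξ⟫) :
    SqSumLE (fun i => (t i + l) ^ s * ⟪v i, w⟫)
      ((errorConst r D E γ₀ γq c a * (L * R * l ^ (r + s))) ^ 2) := by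
  have hl0 := hl.1
  have h1 := sqSumLE_approx hg hgq hl hm ht hK hr hs0 hs hrs hL hc hR hΔ hh hf
  have h2 := (sqSumLE_noise hg hl hm ht hK hs hξ).mono_mul
    (a' := fun i => -((t i + l) ^ s * (regZero g l (t i) * ⟪v i, ξ⟫))) (c := 1)
    fun i => by rw [abs_neg, one_mul]
  have h3 := h1.add h2
  have e : (fun i => (t i + l) ^ s * (residual g l (t i) * ⟪v i, f⟫)
      + -((t i + l) ^ s * (regZero g l (t i) * ⟪v i, ξ⟫)))
      = fun i => (t i + l) ^ s * ⟪v i, w⟫ := by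
    funext i; rw [hw]; ring
  rw [e] at h3
  refine h3.mono_right ?_
  have e1 : l ^ (s - 1 / 2) * l ^ (r + 1 / 2) = l ^ (r + s) := by
    rw [← Real.rpow_add hl0]; ring_nf
  have e2 : ((|D| + |E|) * l ^ (s - 1 / 2)) ^ 2 * (4 * (a * (L * R * l ^ (r + 1 / 2))) ^ 2)
      = 4 * ((|D| + |E|) * a * (L * R * l ^ (r + s))) ^ 2 := by rw [← e1]; ring
  rw [one_pow, one_mul, e2, errorConst]
  have hΓ0 : 0 < residualConst γ₀ γq := zero_lt_one.trans_le (one_le_residualConst γ₀ γq)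
  set x := (|D| + |E|) * a * (L * R * l ^ (r + s)) with hx
  set y := residualConst γ₀ γq * 2 ^ (r + 1) * c * (1 + r) * (L * R * l ^ (r + s)) with hy
  have hx0 : 0 ≤ x := by positivity
  have hy0 : 0 ≤ y := by positivity
  have e3 : 3 * ((|D| + |E|) * a + residualConst γ₀ γq * 2 ^ (r + 1) * c * (1 + r))
      * (L * R * l ^ (r + s)) = 3 * (x + y) := by rw [hx, hy]; ring
  rw [e3]
  -- 8 x² + 8 y² ≤ 9 (x + y)², whence the 3 in `errorConst`.
  nlinarith [mul_nonneg hx0 hy0, sq_nonneg x, sq_nonneg y]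

end ErrorBound

/-! ### Concentration of bounded vectors and of Hilbert-Schmidt operators -/

section Concentration

section Centered

variable {G : Type*} [NormedAddCommGroup G] [InnerProductSpace ℝ G] [CompleteSpace G]
  {Ω : Type*} [MeasurableSpace Ω] (P : Measure Ω) [IsProbabilityMeasure P]

lemma lintegral_norm_sub_integral_sq_le {ξ : Ω → G} (hξ : Integrable ξ P)
    (hξ2 : Integrable (fun x => ‖ξ x‖ ^ 2) P) :
    ∫⁻ x, ENNReal.ofReal (‖ξ x - ∫ y, ξ y ∂P‖ ^ 2) ∂P ≤ ∫⁻ x, ENNReal.ofReal (‖ξ x‖ ^ 2) ∂P := by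
  set c := ∫ y, ξ y ∂P with hc
  have hi : Integrable (fun x => 2 * ⟪c, ξ x⟫) P := (hξ.const_inner c).const_mul 2
  have heq : ∀ x, ‖ξ x - c‖ ^ 2 = ‖ξ x‖ ^ 2 - 2 * ⟪c, ξ x⟫ + ‖c‖ ^ 2 := fun x => by
    rw [norm_sub_sq_real, real_inner_comm]
  have hint : Integrable (fun x => ‖ξ x - c‖ ^ 2) P := by
    simp_rw [heq]
    exact (hξ2.sub hi).add (integrable_const _)
  rw [← ofReal_integral_eq_lintegral_ofReal hint (ae_of_all _ fun x => sq_nonneg _),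
    ← ofReal_integral_eq_lintegral_ofReal hξ2 (ae_of_all _ fun x => sq_nonneg _)]
  apply ENNReal.ofReal_le_ofReal
  simp_rw [heq]
  have h1 : ∫ x, (‖ξ x‖ ^ 2 - 2 * ⟪c, ξ x⟫ + ‖c‖ ^ 2) ∂P
      = ∫ x, (‖ξ x‖ ^ 2 - 2 * ⟪c, ξ x⟫) ∂P + ∫ _, ‖c‖ ^ 2 ∂P :=
    integral_add (hξ2.sub hi) (integrable_const _)
  have h2 : ∫ x, (‖ξ x‖ ^ 2 - 2 * ⟪c, ξ x⟫) ∂P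
      = ∫ x, ‖ξ x‖ ^ 2 ∂P - ∫ x, 2 * ⟪c, ξ x⟫ ∂P := integral_sub hξ2 hi
  have h3 : ∫ x, 2 * ⟪c, ξ x⟫ ∂P = 2 * ‖c‖ ^ 2 := by
    rw [integral_const_mul, integral_inner hξ, ← hc, real_inner_self_eq_norm_sq]
  rw [h1, h2, h3]
  simp only [integral_const, probReal_univ, one_smul]
  nlinarith [sq_nonneg ‖c‖]

/-- Bernstein's inequality for the deviation of bounded random vectors from their mean. -/
lemma bernstein_norm_sum_sub_integral {ξ : Ω → G} (hm : StronglyMeasurable ξ) {v L l : ℝ}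
    (hL : 0 < L) (hv : 0 ≤ v) (hl : 0 < l) (hb : ∀ x, ‖ξ x‖ ≤ L)
    (hvar : ∫⁻ x, ENNReal.ofReal (‖ξ x‖ ^ 2) ∂P ≤ ENNReal.ofReal v) (n : ℕ) :
    (Measure.pi fun _ : Fin n => P)
        {z | 4 * L * l + 2 * √(2 * n * v * l) < ‖∑ i, (ξ (z i) - ∫ y, ξ y ∂P)‖}
      ≤ ENNReal.ofReal (2 * Real.exp (-l)) := by
  have hint : Integrable ξ P := .of_bound hm.aestronglyMeasurable L (ae_of_all _ hb)
  have hint2 : Integrable (fun x => ‖ξ x‖ ^ 2) P :=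
    .of_bound (hm.norm.pow 2).aestronglyMeasurable (L ^ 2) (ae_of_all _ fun x => by
      rw [Real.norm_of_nonneg (sq_nonneg _)]
      exact pow_le_pow_left₀ (norm_nonneg _) (hb x) 2)
  set c := ∫ y, ξ y ∂P with hc
  have hcL : ‖c‖ ≤ L := by
    have := norm_integral_le_of_norm_le_const (μ := P) (ae_of_all _ hb)
    simpa using this
  have hb2 : ∀ x, ‖ξ x - c‖ ≤ 2 * L := fun x => by
    have := norm_sub_le (ξ x) c
    linarith [hb x]
  -- Centring doubles the sup bound to 2 L, so the linear term of the deviation becomes 4 L l; the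
  -- second moment does not grow.
  have h := bernstein_norm_sum P (ξ := fun x => ξ x - c) (hm.sub stronglyMeasurable_const)
    (hint.sub (integrable_const c))
    (by rw [integral_sub hint (integrable_const c)]; simp [← hc]) (v := v) (L := 2 * L) hv
    (by positivity) hl (fun p => ?_) n
  · convert h using 5
    ring
  · calc ∫⁻ x, ENNReal.ofReal (‖ξ x - c‖ ^ (2 * (p + 1))) ∂P
        ≤ ∫⁻ x, ENNReal.ofReal ((2 * L) ^ (2 * p)) * ENNReal.ofReal (‖ξ x - c‖ ^ 2) ∂P := by
          refine lintegral_mono fun x => ?_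
          rw [← ENNReal.ofReal_mul (by positivity), mul_add, mul_one, pow_add]
          gcongr
          exact hb2 x
      _ = ENNReal.ofReal ((2 * L) ^ (2 * p)) * ∫⁻ x, ENNReal.ofReal (‖ξ x - c‖ ^ 2) ∂P :=
          lintegral_const_mul' _ _ ENNReal.ofReal_ne_top
      _ ≤ ENNReal.ofReal ((2 * L) ^ (2 * p)) * ENNReal.ofReal v := by
          gcongr
          exact (lintegral_norm_sub_integral_sq_le P hint hint2).trans hvar
      _ ≤ _ := by
          rw [← ENNReal.ofReal_mul (by positivity)]
          apply ENNReal.ofReal_le_ofReal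
          have h2 : (2 : ℝ) ≤ ((2 * (p + 1)).factorial : ℝ) := by
            have : 2 * (p + 1) ≤ (2 * (p + 1)).factorial := Nat.self_le_factorial _
            have h3 : 2 ≤ (2 * (p + 1)).factorial := by omega
            exact_mod_cast h3
          have h4 : 0 ≤ (2 * L) ^ (2 * p) * v := by positivity
          nlinarith

end Centered

section HilbertSchmidt

lemma hasSum_norm_sq_lp {H : Type*} [NormedAddCommGroup H] {ι : Type*}
    (F : lp (fun _ : ι => H) 2) : HasSum (fun j => ‖F j‖ ^ 2) (‖F‖ ^ 2) := by
  simpa using lp.hasSum_norm (p := 2) (by norm_num) F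

variable {H : Type*} [NormedAddCommGroup H] [InnerProductSpace ℝ H] {ι : Type*}
  (b : HilbertBasis ι ℝ H)

lemma memℓp_tensor (x y : H) : Memℓp (fun j => ⟪b j, x⟫ • y) 2 := by
  refine memℓp_gen ?_
  have := (hasSum_sq_inner b x).summable.mul_right (‖y‖ ^ 2)
  simpa [norm_smul, mul_pow] using this

/-- The rank one operator `⟨x, ·⟩ y`, as an element of the space of Hilbert-Schmidt operators
(represented by their values on the basis `b`). -/
def tensor (x y : H) : lp (fun _ : ι => H) 2 := ⟨fun j => ⟪b j, x⟫ • y, memℓp_tensor b x y⟩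

lemma tensor_apply (x y : H) (j : ι) : tensor b x y j = ⟪b j, x⟫ • y := rfl

lemma norm_tensor (x y : H) : ‖tensor b x y‖ = ‖x‖ * ‖y‖ := by
  have h1 := hasSum_norm_sq_lp (tensor b x y)
  have h2 := (hasSum_sq_inner b x).mul_right (‖y‖ ^ 2)
  have h3 : ‖tensor b x y‖ ^ 2 = (‖x‖ * ‖y‖) ^ 2 := by
    rw [mul_pow]
    refine h1.unique (h2.congr_fun fun j => ?_)
    rw [tensor_apply, norm_smul, mul_pow, Real.norm_eq_abs, sq_abs]
  exact (sq_eq_sq₀ (norm_nonneg _) (by positivity)).1 h3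

/-- Continuity makes the random rank one operators strongly measurable in the Hilbert space of
square-summable families, so Bernstein's inequality applies there. -/
lemma continuous_tensor : Continuous fun p : H × H => tensor b p.1 p.2 := by
  have : IsBoundedBilinearMap ℝ fun p : H × H => tensor b p.1 p.2 :=
    { add_left := fun x x' y => by
        ext j; simp [tensor_apply, inner_add_right, add_smul]
      smul_left := fun c x y => by
        ext j; simp [tensor_apply, inner_smul_right, mul_smul]
      add_right := fun x y y' => by
        ext j; simp [tensor_apply]
      smul_right := fun c x y => by
        ext j; simp [tensor_apply, smul_comm c]
      bound := ⟨1, one_pos, fun x y => by rw [norm_tensor, one_mul]⟩ }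
  exact this.continuous

variable [CompleteSpace H] {Ω : Type*} [MeasurableSpace Ω] (P : Measure Ω)
  [IsProbabilityMeasure P]

/-- Concentration, in Hilbert-Schmidt norm, of the empirical covariance operator. -/
lemma measure_hs_deviation_le {φ : Ω → H} (hφ : StronglyMeasurable φ) (hφ1 : ∀ x, ‖φ x‖ ≤ 1)
    {A : H →L[ℝ] H} (hA : ∀ w, A w = ∫ x, ⟪φ x, w⟫ • φ x ∂P) (S : H →L[ℝ] H) {L v l : ℝ}
    (hL : 0 < L) (hv : 0 ≤ v) (hl : 0 < l) (hSL : ∀ x, ‖S (φ x)‖ ≤ L)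
    (hSv : ∫⁻ x, ENNReal.ofReal (‖S (φ x)‖ ^ 2) ∂P ≤ ENNReal.ofReal v) {n : ℕ} (hn : 0 < n)
    (T : (Fin n → Ω) → H →L[ℝ] H)
    (hT : ∀ z w, T z w = (n : ℝ)⁻¹ • ∑ k, ⟪φ (z k), w⟫ • φ (z k)) :
    (Measure.pi fun _ : Fin n => P)
        {z | ∀ s : Finset ι, ∑ j ∈ s, ‖S ((A - T z) (b j))‖ ^ 2
          ≤ ((4 * L * l + 2 * √(2 * n * v * l)) / n) ^ 2}ᶜ
      ≤ ENNReal.ofReal (2 * Real.exp (-l)) := by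
  -- The summand S ∘ (φ ⊗ φ), stored by its columns; its mean is S A, and ‖φ‖ ≤ 1 reduces its norm
  -- to ‖S φ‖.
  set ξ : Ω → lp (fun _ : ι => H) 2 := fun x => tensor b (φ x) (S (φ x)) with hξ
  have hnorm : ∀ x, ‖ξ x‖ ≤ ‖S (φ x)‖ := fun x => by
    rw [hξ]; simp only [norm_tensor]
    exact mul_le_of_le_one_left (norm_nonneg _) (hφ1 x)
  have hξm : StronglyMeasurable ξ :=
    (continuous_tensor b).comp_stronglyMeasurable
      (hφ.prodMk (S.continuous.comp_stronglyMeasurable hφ))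
  have hξb : ∀ x, ‖ξ x‖ ≤ L := fun x => (hnorm x).trans (hSL x)
  have hint : Integrable ξ P := .of_bound hξm.aestronglyMeasurable L (ae_of_all _ hξb)
  refine le_trans (measure_mono ?_) (bernstein_norm_sum_sub_integral P hξm hL hv hl hξb
    (le_trans (lintegral_mono fun x => ENNReal.ofReal_le_ofReal
      (pow_le_pow_left₀ (norm_nonneg _) (hnorm x) 2)) hSv) n)
  intro z hz
  by_contra hle
  simp only [mem_ofPred_eq, not_lt] at hle
  refine hz fun s => ?_
  have hn0 : (n : ℝ) ≠ 0 := by exact_mod_cast hn.ne'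
  set W := ∑ i, (ξ (z i) - ∫ y, ξ y ∂P) with hW
  have hmean : ∀ j, (∫ y, ξ y ∂P : lp (fun _ : ι => H) 2) j = S (A (b j)) := by
    intro j
    have h1 := (lp.evalCLM ℝ (fun _ : ι => H) 2 j).integral_comp_comm hint
    have hφi : Integrable (fun x => ⟪φ x, b j⟫ • φ x) P := by
      refine .of_bound ((hφ.inner stronglyMeasurable_const).smul hφ).aestronglyMeasurable 1
        (ae_of_all _ fun x => ?_)
      rw [norm_smul]
      have h2 := norm_inner_le_norm (𝕜 := ℝ) (φ x) (b j)
      rw [b.orthonormal.1 j, mul_one] at h2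
      exact mul_le_one₀ (h2.trans (hφ1 x)) (norm_nonneg _) (hφ1 x)
    have h2 := S.integral_comp_comm hφi
    rw [hA, ← h2]
    refine h1.symm.trans (integral_congr_ae (ae_of_all _ fun x => ?_))
    change ⟪b j, φ x⟫ • S (φ x) = S (⟪φ x, b j⟫ • φ x)
    rw [map_smul, real_inner_comm]
  have hcoord : ∀ j, S ((A - T z) (b j)) = -((n : ℝ)⁻¹ • W j) := by
    intro j
    have h1 : W j = ∑ k, (⟪b j, φ (z k)⟫ • S (φ (z k)) - S (A (b j))) := by
      rw [hW, lp.coeFn_sum, Finset.sum_apply]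
      refine Finset.sum_congr rfl fun k _ => ?_
      rw [lp.coeFn_sub, Pi.sub_apply, hmean]
      rfl
    rw [h1, sub_apply, hT, map_sub, map_smul, map_sum, Finset.sum_sub_distrib, smul_sub]
    simp only [map_smul, Finset.sum_const, Finset.card_univ, Fintype.card_fin]
    rw [← Nat.cast_smul_eq_nsmul ℝ, smul_smul, inv_mul_cancel₀ hn0, one_smul, neg_sub]
    congr 2
    exact Finset.sum_congr rfl fun k _ => by rw [real_inner_comm]
  calc ∑ j ∈ s, ‖S ((A - T z) (b j))‖ ^ 2 = ((n : ℝ)⁻¹) ^ 2 * ∑ j ∈ s, ‖W j‖ ^ 2 := by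
        rw [Finset.mul_sum]
        refine Finset.sum_congr rfl fun j _ => ?_
        rw [hcoord, norm_neg, norm_smul, mul_pow, Real.norm_of_nonneg (by positivity)]
    _ ≤ ((n : ℝ)⁻¹) ^ 2 * ‖W‖ ^ 2 := by
        gcongr
        exact sum_le_hasSum s (fun _ _ => sq_nonneg _) (hasSum_norm_sq_lp W)
    _ ≤ ((n : ℝ)⁻¹) ^ 2 * (4 * L * l + 2 * √(2 * n * v * l)) ^ 2 := by gcongr
    _ = _ := by rw [div_eq_inv_mul]; ring

end HilbertSchmidt

end Concentration

/-! ### Second moments of transformed features -/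

section Moments

variable {H : Type*} [NormedAddCommGroup H] [InnerProductSpace ℝ H] {ι : Type*}

lemma countable_of_hilbertBasis [TopologicalSpace.SeparableSpace H] (b : HilbertBasis ι ℝ H) :
    Countable ι := by
  refine Pairwise.countable_of_isOpen_disjoint (s := fun i => Metric.ball (b i) (1 / 2))
    (fun i j hij => Metric.ball_disjoint_ball ?_) (fun _ => Metric.isOpen_ball)
    fun i => ⟨b i, Metric.mem_ball_self (by norm_num)⟩
  have h1 : ‖b i - b j‖ ^ 2 = 2 := by
    rw [norm_sub_sq_real, b.orthonormal.1 i, b.orthonormal.1 j, b.orthonormal.2 hij]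
    norm_num
  rw [dist_eq_norm]
  nlinarith [norm_nonneg (b i - b j)]

variable (b : HilbertBasis ι ℝ H) {Ω : Type*} [MeasurableSpace Ω]
  (P : Measure Ω) [IsProbabilityMeasure P]

lemma integrable_inner_smul {φ : Ω → H} (hφ : StronglyMeasurable φ) (hφ1 : ∀ x, ‖φ x‖ ≤ 1)
    (w : H) : Integrable (fun x => ⟪φ x, w⟫ • φ x) P := by
  refine .of_bound ((hφ.inner stronglyMeasurable_const).smul hφ).aestronglyMeasurable ‖w‖
    (ae_of_all _ fun x => ?_)
  rw [norm_smul]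
  have h2 := norm_inner_le_norm (𝕜 := ℝ) (φ x) w
  have h3 := hφ1 x
  have h4 := norm_nonneg w
  calc _ ≤ ‖φ x‖ * ‖w‖ * ‖φ x‖ := by gcongr
    _ ≤ 1 * ‖w‖ * 1 := by gcongr
    _ = ‖w‖ := by ring

variable [CompleteSpace H]

lemma integral_inner_mul_inner {φ : Ω → H} (hφ : StronglyMeasurable φ) (hφ1 : ∀ x, ‖φ x‖ ≤ 1)
    {A : H →L[ℝ] H} (hA : ∀ w, A w = ∫ x, ⟪φ x, w⟫ • φ x ∂P) (w w' : H) :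
    ⟪A w, w'⟫ = ∫ x, ⟪φ x, w⟫ * ⟪φ x, w'⟫ ∂P := by
  rw [hA, real_inner_comm, ← integral_inner (integrable_inner_smul P hφ hφ1 w)]
  refine integral_congr_ae (ae_of_all _ fun x => ?_)
  simp only [inner_smul_right]
  rw [real_inner_comm (φ x) w']

variable {b} in
lemma eigenvalue_mem_Icc {φ : Ω → H} (hφ : StronglyMeasurable φ) (hφ1 : ∀ x, ‖φ x‖ ≤ 1)
    {A : H →L[ℝ] H} (hA : ∀ w, A w = ∫ x, ⟪φ x, w⟫ • φ x ∂P) {m : ι → ℝ} (hm : IsDiag b A m)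
    (j : ι) : m j = ∫ x, ⟪b j, φ x⟫ ^ 2 ∂P ∧ m j ∈ Icc (0 : ℝ) 1 := by
  have h1 : m j = ∫ x, ⟪b j, φ x⟫ ^ 2 ∂P := by
    have h2 := integral_inner_mul_inner P hφ hφ1 hA (b j) (b j)
    rw [hm j, inner_smul_left, real_inner_self_eq_norm_sq, b.orthonormal.1 j] at h2
    simp only [one_pow, mul_one, conj_trivial] at h2
    rw [h2]
    refine integral_congr_ae (ae_of_all _ fun x => ?_)
    simp only [real_inner_comm, sq]
  have hle : ∀ x, ⟪b j, φ x⟫ ^ 2 ≤ 1 := fun x => by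
    have h2 := abs_real_inner_le_norm (b j) (φ x)
    rw [b.orthonormal.1 j, one_mul] at h2
    rw [← sq_abs]
    exact pow_le_one₀ (abs_nonneg _) (h2.trans (hφ1 x))
  refine ⟨h1, ?_, ?_⟩
  · rw [h1]; exact integral_nonneg fun x => sq_nonneg _
  · rw [h1]
    calc ∫ x, ⟪b j, φ x⟫ ^ 2 ∂P ≤ ∫ _, (1 : ℝ) ∂P :=
          integral_mono_of_nonneg (ae_of_all _ fun x => sq_nonneg _) (integrable_const 1)
            (ae_of_all _ hle)
      _ = 1 := by simp

variable {b} in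
/-- The second moment of a diagonal transform of the features is a weighted trace. -/
lemma lintegral_norm_diagOp_sq_le [Countable ι] {φ : Ω → H} (hφ : StronglyMeasurable φ)
    (hφ1 : ∀ x, ‖φ x‖ ≤ 1) {A : H →L[ℝ] H} (hA : ∀ w, A w = ∫ x, ⟪φ x, w⟫ • φ x ∂P) {m : ι → ℝ}
    (hm : IsDiag b A m) {c : ι → ℝ} {C N : ℝ} (hc : ∀ i, |c i| ≤ C)
    (hN : ∀ s : Finset ι, ∑ j ∈ s, c j ^ 2 * m j ≤ N) :
    ∫⁻ x, ENNReal.ofReal (‖diagOp b c (φ x)‖ ^ 2) ∂P ≤ ENNReal.ofReal N := by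
  have hser : ∀ x, ENNReal.ofReal (‖diagOp b c (φ x)‖ ^ 2)
      = ∑' j, ENNReal.ofReal (c j ^ 2 * ⟪b j, φ x⟫ ^ 2) := by
    intro x
    have h1 := hasSum_sq_inner b (diagOp b c (φ x))
    simp only [inner_diagOp b hc, mul_pow] at h1
    rw [← h1.tsum_eq, ENNReal.ofReal_tsum_of_nonneg (fun j => by positivity) h1.summable]
  simp_rw [hser]
  rw [lintegral_tsum fun j => ((((stronglyMeasurable_const.inner hφ).measurable.pow_const
    2).const_mul _).ennreal_ofReal).aemeasurable]
  have hterm : ∀ j, ∫⁻ x, ENNReal.ofReal (c j ^ 2 * ⟪b j, φ x⟫ ^ 2) ∂P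
      = ENNReal.ofReal (c j ^ 2 * m j) := by
    intro j
    rw [(eigenvalue_mem_Icc P hφ hφ1 hA hm j).1, ← integral_const_mul]
    refine (ofReal_integral_eq_lintegral_ofReal ?_ (ae_of_all _ fun x => by positivity)).symm
    refine Integrable.const_mul (.of_bound
      ((stronglyMeasurable_const.inner hφ).pow 2).aestronglyMeasurable 1
      (ae_of_all _ fun x => ?_)) _
    have h2 := abs_real_inner_le_norm (b j) (φ x)
    rw [b.orthonormal.1 j, one_mul] at h2
    rw [Real.norm_eq_abs, abs_pow]
    exact pow_le_one₀ (abs_nonneg _) (h2.trans (hφ1 x))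
  simp_rw [hterm]
  rw [ENNReal.tsum_eq_iSup_sum]
  refine iSup_le fun s => ?_
  have hm0 : ∀ j, 0 ≤ m j := fun j => (eigenvalue_mem_Icc P hφ hφ1 hA hm j).2.1
  rw [← ENNReal.ofReal_sum_of_nonneg fun j _ => mul_nonneg (sq_nonneg _) (hm0 j)]
  exact ENNReal.ofReal_le_ofReal (hN s)

end Moments

/-! ### Noise moments and concentration -/

section Noise

variable {X : Type*} [MeasurableSpace X] {H : Type*} [NormedAddCommGroup H]
  [InnerProductSpace ℝ H]

/-- Conditionally on x the vector ψ(x) is fixed and the even noise moment is bounded by hypothesis;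
2p factors ‖ψ‖ are replaced by L, and the two that remain integrate to N. -/
lemma lintegral_noise_moment_le (P : Measure (X × ℝ)) [IsProbabilityMeasure P] {F : X → ℝ}
    (hF : Measurable F) {ψ : X → H} (hψ : StronglyMeasurable ψ) {σ M L N : ℝ} (hM : 0 ≤ M)
    (hL : 0 ≤ L)
    (hbern : ∀ m : ℕ, 2 ≤ m → ∀ᵐ x ∂P.fst,
      Integrable (fun y => (y - F x) ^ m) (P.condKernel x) ∧
        ∫ y, (y - F x) ^ m ∂(P.condKernel x) ≤ 1 / 2 * (m.factorial : ℝ) * σ ^ 2 * M ^ (m - 2))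
    (hψL : ∀ x, ‖ψ x‖ ≤ L)
    (hψN : ∫⁻ x, ENNReal.ofReal (‖ψ x‖ ^ 2) ∂P.fst ≤ ENNReal.ofReal N) (p : ℕ) :
    ∫⁻ z, ENNReal.ofReal (‖(z.2 - F z.1) • ψ z.1‖ ^ (2 * (p + 1))) ∂P
      ≤ ENNReal.ofReal (1 / 2 * (2 * (p + 1)).factorial * (σ ^ 2 * N) * (M * L) ^ (2 * p)) := by
  have hmeas : Measurable fun z : X × ℝ =>
      ENNReal.ofReal (‖(z.2 - F z.1) • ψ z.1‖ ^ (2 * (p + 1))) := by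
    refine Measurable.ennreal_ofReal (Measurable.pow_const ?_ _)
    exact ((measurable_snd.sub (hF.comp measurable_fst)).stronglyMeasurable.smul
      (hψ.comp_measurable measurable_fst)).norm.measurable
  set K := 1 / 2 * ((2 * (p + 1)).factorial : ℝ) * σ ^ 2 * M ^ (2 * p) with hK
  have hK0 : 0 ≤ K := by positivity
  have hinner : ∀ᵐ x ∂P.fst, ∫⁻ y, ENNReal.ofReal (‖(y - F x) • ψ x‖ ^ (2 * (p + 1)))
      ∂(P.condKernel x)
      ≤ ENNReal.ofReal (L ^ (2 * p) * K) * ENNReal.ofReal (‖ψ x‖ ^ 2) := by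
    filter_upwards [hbern (2 * (p + 1)) (by omega)] with x hx
    have e1 : ∀ y : ℝ, ENNReal.ofReal (‖(y - F x) • ψ x‖ ^ (2 * (p + 1)))
        = ENNReal.ofReal (‖ψ x‖ ^ (2 * (p + 1))) * ENNReal.ofReal ((y - F x) ^ (2 * (p + 1))) := by
      intro y
      rw [← ENNReal.ofReal_mul (by positivity), norm_smul, mul_pow, Real.norm_eq_abs,
        (even_two_mul (p + 1)).pow_abs, mul_comm]
    simp_rw [e1]
    rw [lintegral_const_mul' _ _ ENNReal.ofReal_ne_top, ← ofReal_integral_eq_lintegral_ofReal hx.1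
      (ae_of_all _ fun y => (even_two_mul (p + 1)).pow_nonneg _),
      ← ENNReal.ofReal_mul (by positivity), ← ENNReal.ofReal_mul (by positivity)]
    apply ENNReal.ofReal_le_ofReal
    have h2 := hx.2
    rw [show 2 * (p + 1) - 2 = 2 * p by omega] at h2
    calc ‖ψ x‖ ^ (2 * (p + 1)) * ∫ y, (y - F x) ^ (2 * (p + 1)) ∂(P.condKernel x)
        ≤ ‖ψ x‖ ^ (2 * (p + 1)) * K := by gcongr
      _ = ‖ψ x‖ ^ (2 * p) * (K * ‖ψ x‖ ^ 2) := by ring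
      _ ≤ L ^ (2 * p) * (K * ‖ψ x‖ ^ 2) := by
          gcongr
          exact hψL x
      _ = _ := by ring
  rw [← Measure.lintegral_condKernel hmeas]
  refine (lintegral_mono_ae hinner).trans ?_
  rw [lintegral_const_mul' _ _ ENNReal.ofReal_ne_top]
  refine (mul_le_mul_right hψN _).trans ?_
  rw [← ENNReal.ofReal_mul (by positivity)]
  apply ENNReal.ofReal_le_ofReal
  rw [hK]
  exact le_of_eq (by ring)

/-- Concentration of the transformed noise vector. -/
lemma measure_noise_le [CompleteSpace H] (P : Measure (X × ℝ)) [IsProbabilityMeasure P] {F : X → ℝ}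
    (hF : Measurable F) {ψ : X → H} (hψ : StronglyMeasurable ψ) {σ M L N l : ℝ} (hM : 0 < M)
    (hL : 0 < L) (hN : 0 ≤ N) (hl : 0 < l)
    (hreg : ∀ᵐ x ∂P.fst, Integrable (fun y => y) (P.condKernel x) ∧
      ∫ y, y ∂(P.condKernel x) = F x)
    (hbern : ∀ m : ℕ, 2 ≤ m → ∀ᵐ x ∂P.fst,
      Integrable (fun y => (y - F x) ^ m) (P.condKernel x) ∧
        ∫ y, (y - F x) ^ m ∂(P.condKernel x) ≤ 1 / 2 * (m.factorial : ℝ) * σ ^ 2 * M ^ (m - 2))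
    (hψL : ∀ x, ‖ψ x‖ ≤ L)
    (hψN : ∫⁻ x, ENNReal.ofReal (‖ψ x‖ ^ 2) ∂P.fst ≤ ENNReal.ofReal N) (n : ℕ) :
    (Measure.pi fun _ : Fin n => P)
        {z | 2 * (M * L) * l + 2 * √(2 * n * (σ ^ 2 * N) * l)
          < ‖∑ k, ((z k).2 - F (z k).1) • ψ (z k).1‖}
      ≤ ENNReal.ofReal (2 * Real.exp (-l)) := by
  have hmom := lintegral_noise_moment_le P hF hψ hM.le hL.le hbern hψL hψN
  have hm : StronglyMeasurable fun z : X × ℝ => (z.2 - F z.1) • ψ z.1 :=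
    (measurable_snd.sub (hF.comp measurable_fst)).stronglyMeasurable.smul
      (hψ.comp_measurable measurable_fst)
  have hint : Integrable (fun z : X × ℝ => (z.2 - F z.1) • ψ z.1) P := by
    have h2 := hmom 0
    have h3 : Integrable (fun z : X × ℝ => ‖(z.2 - F z.1) • ψ z.1‖ ^ 2) P :=
      (lintegral_ofReal_ne_top_iff_integrable (hm.norm.pow 2).aestronglyMeasurable
        (ae_of_all _ fun z => sq_nonneg _)).1 (h2.trans_lt ENNReal.ofReal_lt_top).ne
    exact ((memLp_two_iff_integrable_sq_norm hm.aestronglyMeasurable).2 h3).integrable one_le_two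
  have h0 : ∫ z : X × ℝ, (z.2 - F z.1) • ψ z.1 ∂P = 0 := by
    rw [← Measure.integral_condKernel hint]
    refine integral_eq_zero_of_ae ?_
    filter_upwards [hreg] with x hx
    simp only [Pi.zero_apply]
    rw [integral_smul_const, integral_sub hx.1 (integrable_const _), hx.2]
    simp
  exact bernstein_norm_sum P hm hint h0 (v := σ ^ 2 * N) (L := M * L) (by positivity)
    (by positivity) hl hmom n

end Noise

/-! ### The feature map and the covariance operator -/

section Kernel

variable {X H : Type*} [NormedAddCommGroup H] [InnerProductSpace ℝ H] [CompleteSpace H]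
  [RKHS ℝ H X ℝ]

lemma inner_feature (x : X) (f : H) : ⟪feature H x, f⟫ = f x := by
  rw [feature, RKHS.kerFun_inner]
  simp

lemma kern_eq_inner (x y : X) : kern H x y = ⟪feature H x, feature H y⟫ := by
  rw [inner_feature, kern, feature, RKHS.kerFun_apply]

lemma norm_feature_le {κ : ℝ} (hκ : 0 < κ) (hk : ∀ x : X, kern H x x ≤ κ ^ 2) (x : X) :
    ‖feature H x‖ ≤ κ := by
  refine le_of_sq_le_sq ?_ hκ.le
  rw [← real_inner_self_eq_norm_sq, ← kern_eq_inner]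
  exact hk x

/-- The normalized feature map `κ⁻¹ Φ`. -/
def nfeature (κ : ℝ) (x : X) : H := κ⁻¹ • feature H x

lemma norm_nfeature_le {κ : ℝ} (hκ : 0 < κ) (hk : ∀ x : X, kern H x x ≤ κ ^ 2) (x : X) :
    ‖(nfeature κ x : H)‖ ≤ 1 := by
  rw [nfeature, norm_smul, Real.norm_of_nonneg (by positivity), inv_mul_le_iff₀ hκ, mul_one]
  exact norm_feature_le hκ hk x

variable [MeasurableSpace X]

/-- Kernel sections are measurable and span a dense subspace; norm convergence in H implies
pointwise convergence, which preserves measurability. -/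
lemma measurable_apply (hk : Measurable fun p : X × X => kern H p.1 p.2) (f : H) :
    Measurable fun x => f x := by
  have hspan : ∀ h ∈ Submodule.span ℝ {RKHS.kerFun H x v | (x : X) (v : ℝ)},
      Measurable fun x => h x := by
    intro h hh
    induction hh using Submodule.span_induction with
    | mem h hh =>
      obtain ⟨y, a, rfl⟩ := hh
      have : (fun x => (RKHS.kerFun H y a) x) = fun x => a * kern H x y := by
        funext x
        rw [RKHS.kerFun_apply, kern]
        have := (RKHS.kernel H x y).map_smul a (1 : ℝ)
        simpa using this
      rw [this]
      exact (hk.comp (measurable_id.prodMk measurable_const)).const_mul a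
    | zero => simp only [RKHS.coe_zero]; exact measurable_const
    | add x y _ _ hx hy => simp only [RKHS.coe_add]; exact hx.add hy
    | smul a x _ hx => simp only [RKHS.coe_smul]; exact hx.const_smul a
  have hf : f ∈ closure (Submodule.span ℝ {RKHS.kerFun H x v | (x : X) (v : ℝ)} : Set H) := by
    have : f ∈ (Submodule.span ℝ {RKHS.kerFun H x v | (x : X) (v : ℝ)}).topologicalClosure := by
      rw [RKHS.kerFun_dense]; trivial
    exact this
  obtain ⟨u, hu, hlim⟩ := mem_closure_iff_seq_limit.1 hf
  refine measurable_of_tendsto_metrizable (fun n => hspan (u n) (hu n)) ?_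
  rw [tendsto_pi_nhds]
  exact fun x => ((RKHS.continuous_eval x).tendsto f).comp hlim

/-- By the reproducing property Φ(x) = ∑ b_i(x) b_i over a basis that separability makes countable,
a limit of measurable finite sums. -/
lemma stronglyMeasurable_feature [TopologicalSpace.SeparableSpace H]
    (hk : Measurable fun p : X × X => kern H p.1 p.2) : StronglyMeasurable (feature H : X → H) := by
  obtain ⟨w, b, -⟩ := exists_hilbertBasis ℝ H
  have := countable_of_hilbertBasis b
  refine stronglyMeasurable_of_tendsto (atTop : Filter (Finset w))
    (f := fun (s : Finset w) (x : X) => ∑ i ∈ s, (b i : H) x • b i) (fun s => ?_) ?_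
  · exact Finset.stronglyMeasurable_fun_sum _ fun i _ =>
      (measurable_apply hk (b i)).stronglyMeasurable.smul_const _
  · rw [tendsto_pi_nhds]
    intro x
    have h := b.hasSum_repr (feature H x)
    refine (h.congr_fun fun i => ?_)
    rw [b.repr_apply_apply, real_inner_comm, inner_feature]

lemma smul_covOp_apply [TopologicalSpace.SeparableSpace H] {κ : ℝ} (hκ : 0 < κ)
    (hkm : Measurable fun p : X × X => kern H p.1 p.2) (hk : ∀ x : X, kern H x x ≤ κ ^ 2)
    (ν : Measure X) [IsProbabilityMeasure ν] (w : H) :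
    ((κ ^ 2)⁻¹ • covOp H ν) w = ∫ x, ⟪(nfeature κ x : H), w⟫ • (nfeature κ x : H) ∂ν := by
  have hsm := stronglyMeasurable_feature (H := H) hkm
  have hcont : Continuous fun h : H => InnerProductSpace.rankOne ℝ h h := by
    have h1 : Continuous fun p : H × H => InnerProductSpace.rankOne ℝ p.1 p.2 :=
      (InnerProductSpace.rankOne ℝ (E := H) (F := H)).continuous₂
    exact h1.comp (continuous_id.prodMk continuous_id)
  have hint : Integrable (fun x => InnerProductSpace.rankOne ℝ (feature H x) (feature H x)) ν := by
    refine .of_bound (hcont.comp_stronglyMeasurable hsm).aestronglyMeasurable (κ * κ)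
      (ae_of_all _ fun x => ?_)
    rw [InnerProductSpace.norm_rankOne]
    have := norm_feature_le hκ hk x
    gcongr
  rw [smul_apply, covOp, ContinuousLinearMap.integral_apply hint, ← integral_smul]
  refine integral_congr_ae (ae_of_all _ fun x => ?_)
  simp only [InnerProductSpace.rankOne_apply, nfeature, inner_smul_left, smul_smul, conj_trivial]
  congr 1
  field_simp

end Kernel

/-! ### The empirical operator and the estimator -/

section Empirical

variable {X H : Type*} [NormedAddCommGroup H] [InnerProductSpace ℝ H] [CompleteSpace H]
  [RKHS ℝ H X ℝ] {κ : ℝ} {n : ℕ}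

lemma samplingAdj_apply (x : Fin n → X) (y : Fin n → ℝ) :
    samplingAdj H x y = (n : ℝ)⁻¹ • ∑ k, y k • feature H (x k) := by
  simp [samplingAdj, sum_apply]

lemma empCov_apply (x : Fin n → X) (w : H) :
    empCov H x w = (n : ℝ)⁻¹ • ∑ k, ⟪feature H (x k), w⟫ • feature H (x k) := by
  rw [empCov, ContinuousLinearMap.comp_apply, samplingAdj_apply]
  simp [sampling]

lemma smul_feature (hκ : 0 < κ) (x : X) : feature H x = κ • (nfeature κ x : H) := by
  rw [nfeature, smul_smul, mul_inv_cancel₀ hκ.ne', one_smul]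

lemma smul_empCov_apply (hκ : 0 < κ) (x : Fin n → X) (w : H) :
    ((κ ^ 2)⁻¹ • empCov H x) w
      = (n : ℝ)⁻¹ • ∑ k, ⟪(nfeature κ (x k) : H), w⟫ • (nfeature κ (x k) : H) := by
  rw [smul_apply, empCov_apply, smul_comm, Finset.smul_sum]
  congr 1
  refine Finset.sum_congr rfl fun k _ => ?_
  simp only [nfeature, inner_smul_left, smul_smul, conj_trivial]
  congr 1
  field_simp

/-- The averaged noise `κ⁻² S_x^* (y - S_x f)`. -/
def noiseVec (κ : ℝ) (f : H) (z : Fin n → X × ℝ) : H :=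
  (κ⁻¹ * (n : ℝ)⁻¹) • ∑ k, ((z k).2 - f (z k).1) • (nfeature κ (z k).1 : H)

lemma smul_samplingAdj_eq (hκ : 0 < κ) (f : H) (z : Fin n → X × ℝ) :
    (κ ^ 2)⁻¹ • samplingAdj H (fun i => (z i).1) (fun i => (z i).2)
      = ((κ ^ 2)⁻¹ • empCov H fun i => (z i).1) f + noiseVec κ f z := by
  rw [samplingAdj_apply, smul_empCov_apply hκ, noiseVec, mul_comm κ⁻¹, mul_smul, ← smul_add,
    smul_comm]
  congr 1
  rw [Finset.smul_sum, Finset.smul_sum, ← Finset.sum_add_distrib]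
  refine Finset.sum_congr rfl fun k _ => ?_
  have h1 : ⟪(nfeature κ (z k).1 : H), f⟫ = κ⁻¹ * f (z k).1 := by
    rw [nfeature, inner_smul_left, inner_feature]; simp
  rw [h1, smul_feature hκ, smul_smul, smul_smul, smul_smul, ← add_smul]
  congr 1
  field_simp
  ring

lemma exists_eigenbasis_empCov (hκ : 0 < κ) (x : Fin n → X) :
    ∃ (s : Set H) (v : HilbertBasis s ℝ H) (t : s → ℝ),
      IsDiag v ((κ ^ 2)⁻¹ • empCov H x) t := by
  refine exists_hilbertBasis_isDiag_sum
    (fun k => (√(n : ℝ))⁻¹ • (nfeature κ (x k) : H)) _ fun w => ?_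
  rw [smul_empCov_apply hκ, Finset.smul_sum]
  refine Finset.sum_congr rfl fun k _ => ?_
  simp only [inner_smul_left, smul_smul, conj_trivial]
  congr 1
  have : (√(n : ℝ))⁻¹ * (√(n : ℝ))⁻¹ = (n : ℝ)⁻¹ := by
    rw [← mul_inv, Real.mul_self_sqrt (Nat.cast_nonneg n)]
  rw [← this]; ring

variable {ι : Type*} {v : HilbertBasis ι ℝ H} {t : ι → ℝ}

lemma eigenvalue_empCov_eq (hκ : 0 < κ) {x : Fin n → X}
    (hT : IsDiag v ((κ ^ 2)⁻¹ • empCov H x) t) (i : ι) :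
    t i = (n : ℝ)⁻¹ * ∑ k, ⟪(nfeature κ (x k) : H), v i⟫ ^ 2 := by
  have h1 : ⟪v i, ((κ ^ 2)⁻¹ • empCov H x) (v i)⟫ = t i := by
    rw [hT i, inner_smul_right, real_inner_self_eq_norm_sq, v.orthonormal.1 i]; simp
  rw [← h1, smul_empCov_apply hκ, inner_smul_right, inner_sum]
  congr 1
  refine Finset.sum_congr rfl fun k _ => ?_
  rw [inner_smul_right, real_inner_comm (nfeature κ (x k) : H) (v i), sq]

lemma eigenvalue_empCov_mem_Icc (hκ : 0 < κ) (hk : ∀ x : X, kern H x x ≤ κ ^ 2) (hn : 0 < n)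
    {x : Fin n → X} (hT : IsDiag v ((κ ^ 2)⁻¹ • empCov H x) t) (i : ι) :
    t i ∈ Icc (0 : ℝ) 1 := by
  rw [eigenvalue_empCov_eq hκ hT]
  refine ⟨by positivity, ?_⟩
  have hn' : (0 : ℝ) < n := by exact_mod_cast hn
  rw [inv_mul_le_iff₀ hn', mul_one]
  calc ∑ k, ⟪(nfeature κ (x k) : H), v i⟫ ^ 2 ≤ ∑ _k : Fin n, (1 : ℝ) := by
        refine Finset.sum_le_sum fun k _ => ?_
        have h2 := abs_real_inner_le_norm (nfeature κ (x k) : H) (v i)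
        rw [v.orthonormal.1 i, mul_one] at h2
        rw [← sq_abs]
        exact pow_le_one₀ (abs_nonneg _) (h2.trans (norm_nfeature_le hκ hk _))
    _ = n := by simp

/-- An eigenvalue t_i is an average of the squares ⟪φ(x_k), v_i⟫², so t_i = 0 makes v_i orthogonal
to all sampled features. -/
lemma inner_noiseVec_eq_zero (hκ : 0 < κ) (hn : 0 < n) (f : H) {z : Fin n → X × ℝ}
    (hT : IsDiag v ((κ ^ 2)⁻¹ • empCov H fun k => (z k).1) t) {i : ι} (hi : t i = 0) :
    ⟪v i, noiseVec κ f z⟫ = 0 := by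
  have hn' : (n : ℝ)⁻¹ ≠ 0 := inv_ne_zero (by exact_mod_cast hn.ne')
  have h1 := eigenvalue_empCov_eq hκ hT i
  rw [hi] at h1
  have h2 := (mul_eq_zero.1 h1.symm).resolve_left hn'
  rw [Finset.sum_eq_zero_iff_of_nonneg fun _ _ => sq_nonneg _] at h2
  rw [noiseVec, inner_smul_right, inner_sum, Finset.sum_eq_zero, mul_zero]
  intro k hk
  rw [inner_smul_right, real_inner_comm, pow_eq_zero_iff two_ne_zero |>.1 (h2 k hk), mul_zero]

/-- On the kernel of T the data vector has no component, so the estimator vanishes there whatever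
g_l(0) is. This dictates the values at 0 of `residual` and `regZero`. -/
lemma inner_sub_estimator {g : ℝ → ℝ → ℝ} {D E γ₀ l : ℝ} (hg : IsRegularization g D E γ₀)
    (hl : l ∈ Ioc (0 : ℝ) 1) (hκ : 0 < κ) (hk : ∀ x : X, kern H x x ≤ κ ^ 2) (hn : 0 < n) (f : H)
    {z : Fin n → X × ℝ} (hT : IsDiag v ((κ ^ 2)⁻¹ • empCov H fun k => (z k).1) t) (i : ι) :
    ⟪v i, f - estimator κ g l z⟫
      = residual g l (t i) * ⟪v i, f⟫ - regZero g l (t i) * ⟪v i, noiseVec κ f z⟫ := by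
  have ht := eigenvalue_empCov_mem_Icc hκ hk hn hT
  -- Nothing is assumed about g_l(0), so it enters the bound as it stands.
  have hgb : ∀ i, |g l (t i)| ≤ max |g l 0| (E / l) := by
    intro i
    by_cases h0 : t i = 0
    · rw [h0]; exact le_max_left _ _
    · exact (hg.le_div l hl _ ⟨(ht i).1.lt_of_ne (Ne.symm h0), (ht i).2⟩).trans (le_max_right _ _)
  rw [inner_sub_right, estimator, hT.inner_spectralApply hgb, smul_samplingAdj_eq hκ f z,
    inner_add_right, hT.inner_apply, residual, regZero]
  split_ifs with h0
  · rw [h0, inner_noiseVec_eq_zero hκ hn f hT h0]; ring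
  · ring

/-- The error bounds on the event where the three concentration estimates hold. -/
lemma error_bounds_of_concentration {g : ℝ → ℝ → ℝ} {D E γ₀ γq q l r R L c a : ℝ}
    (hg : IsRegularization g D E γ₀) (hgq : QualificationBound g q γq)
    (hl : l ∈ Ioc (0 : ℝ) 1) (hκ : 0 < κ) (hk : ∀ x : X, kern H x x ≤ κ ^ 2) (hn : 0 < n)
    (hr : 0 < r) (hrq : r ≤ q) (hL : 1 ≤ L) (hc : 0 ≤ c) (hR : 0 ≤ R) (ha : 0 ≤ a)
    {ι' : Type*} {b : HilbertBasis ι' ℝ H} {A : H →L[ℝ] H} {m : ι' → ℝ} (hA : IsDiag b A m)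
    (hm : ∀ j, m j ∈ Icc (0 : ℝ) 1) {f h : H} (hh : ‖h‖ ≤ R)
    (hf : ∀ j, ⟪b j, f⟫ = c * m j ^ r * ⟪b j, h⟫) {z : Fin n → X × ℝ}
    (h1 : ∀ s : Finset ι', ∑ j ∈ s, ‖diagOp b (fun j => (m j + l)⁻¹)
      ((A - (κ ^ 2)⁻¹ • empCov H fun k => (z k).1) (b j))‖ ^ 2 ≤ 1 / 4)
    (h2 : ∀ s : Finset ι', ∑ j ∈ s,
      ‖(A - (κ ^ 2)⁻¹ • empCov H fun k => (z k).1) (b j)‖ ^ 2 ≤ (L * l ^ r) ^ 2)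
    (h3 : ‖diagOp b (fun j => (m j + l) ^ (-(1 / 2) : ℝ)) (noiseVec κ f z)‖
      ≤ a * (L * R * l ^ (r + 1 / 2))) :
    ‖f - estimator κ g l z‖ ≤ errorConst r D E γ₀ γq c a * (L * R * l ^ r) ∧
      (r + 1 / 2 ≤ q → ⟪A (f - estimator κ g l z), f - estimator κ g l z⟫
        ≤ 4 * (errorConst r D E γ₀ γq c a * (L * R * l ^ (r + 1 / 2))) ^ 2) := by
  obtain ⟨s, v, t, hT⟩ := exists_eigenbasis_empCov (H := H) hκ fun k => (z k).1
  have hl0 := hl.1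
  have ht := eigenvalue_empCov_mem_Icc hκ hk hn hT
  have hK := hsBound_resolvent hT hA (fun j => (hm j).1) (fun i => (ht i).1) hl.1 h1
  have hΔ := hsBound_sub hT hA h2
  have hξ : SqSumLE (fun j => (m j + l) ^ (-(1 / 2) : ℝ) * ⟪b j, noiseVec κ f z⟫)
      ((a * (L * R * l ^ (r + 1 / 2))) ^ 2) := by
    have hb : ∀ j, |(m j + l) ^ (-(1 / 2) : ℝ)| ≤ l ^ (-(1 / 2) : ℝ) := fun j => by
      have := (hm j).1
      rw [abs_of_nonneg (by positivity)]
      exact Real.rpow_le_rpow_of_nonpos hl0 (by linarith) (by norm_num)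
    have h4 := (sqSumLE_inner b (diagOp b (fun j => (m j + l) ^ (-(1 / 2) : ℝ))
      (noiseVec κ f z))).mono_right (pow_le_pow_left₀ (norm_nonneg _) h3 2)
    simpa only [inner_diagOp b hb] using h4
  have hw := inner_sub_estimator hg hl hκ hk hn f hT
  have hΓ : 0 < residualConst γ₀ γq := zero_lt_one.trans_le (one_le_residualConst γ₀ γq)
  have hC0 : 0 ≤ errorConst r D E γ₀ γq c a := by
    rw [errorConst]; positivity
  -- Used with s = 0 for the norm of H and with s = 1/2 for the energy ⟪A w, w⟫.
  have key : ∀ s : ℝ, 0 ≤ s → s ≤ 1 / 2 → r + s ≤ q → _ := fun s hs0 hs hrs =>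
    sqSumLE_error hg hgq hl hm ht hK hr hs0 hs hrs hL hc hR ha hΔ hh hf hξ hw
  constructor
  · have h5 := key 0 le_rfl (by norm_num) (by linarith)
    simp only [Real.rpow_zero, one_mul, add_zero] at h5
    exact le_of_sq_le_sq (norm_sq_le_of_sqSumLE v h5) (by positivity)
  · intro hq
    exact inner_apply_le_of_sqSumLE hA (fun j => (hm j).1) (fun i => (ht i).1) hl.1 hK
      (key (1 / 2) (by norm_num) le_rfl hq)

end Empirical

/-! ### Calibration of the deviations at l = G⁻¹(u) -/

section Parameter

/-- The constant in front of the noise bound. -/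
def noiseConst (νs κ : ℝ) : ℝ := κ⁻¹ * (1 + 2 * √(2 * effDimConst νs κ))

variable {r C σ M R κ c₀ N l L : ℝ} {n : ℕ}

/-- The only place where log(8/η) ≤ C l^(-r) is needed: (N/n) L/l is at most c₀ ω l^(2r) · C l^(-r),
a multiple of l^r, hence small. -/
lemma resolvent_deviation_le (hl : 0 < l) (hn : 0 < n) (hc₀ : 0 ≤ c₀) {ω : ℝ}
    (hω : 0 ≤ ω) (hn1 : (n : ℝ)⁻¹ ≤ ω * l ^ (2 * r + 1)) (hN : N / n ≤ c₀ * ω * l ^ (2 * r + 1))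
    (hL0 : 0 ≤ L) (hL : L ≤ C * l ^ (-r)) (h1 : 16 * C * ω * l ^ r ≤ 1)
    (h2 : 128 * c₀ * ω * C * l ^ r ≤ 1) :
    ((4 * l⁻¹ * L + 2 * √(2 * n * (N / l) * L)) / n) ^ 2 ≤ 1 / 4 := by
  have hn' : (0 : ℝ) < n := by exact_mod_cast hn
  have hlr : 0 < l ^ r := Real.rpow_pos_of_pos hl r
  have e1 : l ^ (2 * r + 1) = l ^ r * l ^ r * l := by
    rw [Real.rpow_add hl, Real.rpow_one, two_mul, Real.rpow_add hl]
  have e2 : L * l ^ r ≤ C := by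
    rw [Real.rpow_neg hl.le] at hL
    calc L * l ^ r ≤ C * (l ^ r)⁻¹ * l ^ r := by gcongr
      _ = C := by field_simp
  have h3 : 4 * l⁻¹ * L / n ≤ 1 / 4 := by
    calc 4 * l⁻¹ * L / n = 4 * l⁻¹ * L * (n : ℝ)⁻¹ := by rw [div_eq_mul_inv]
      _ ≤ 4 * l⁻¹ * L * (ω * l ^ (2 * r + 1)) := by gcongr
      _ = 4 * (L * l ^ r) * ω * l ^ r := by rw [e1]; field_simp
      _ ≤ 4 * C * ω * l ^ r := by gcongr
      _ ≤ 1 / 4 := by linarith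
  have h4 : 2 * √(2 * n * (N / l) * L) / n ≤ 1 / 4 := by
    have h5 : √(2 * n * (N / l) * L) ≤ n / 8 := by
      apply Real.sqrt_le_iff.2 ⟨by positivity, ?_⟩
      have h6 : N / n * L / l ≤ 1 / 128 := by
        calc N / n * L / l ≤ c₀ * ω * l ^ (2 * r + 1) * L / l := by gcongr
          _ = c₀ * ω * (L * l ^ r) * l ^ r := by rw [e1]; field_simp
          _ ≤ c₀ * ω * C * l ^ r := by gcongr
          _ ≤ 1 / 128 := by linarith
      calc 2 * n * (N / l) * L = 2 * n ^ 2 * (N / n * L / l) := by field_simp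
        _ ≤ 2 * n ^ 2 * (1 / 128) := by gcongr
        _ = (n / 8) ^ 2 := by ring
    rw [div_le_iff₀ hn']
    linarith
  have h7 : (4 * l⁻¹ * L + 2 * √(2 * n * (N / l) * L)) / n ≤ 1 / 2 := by
    rw [add_div]; linarith
  have h8 : 0 ≤ (4 * l⁻¹ * L + 2 * √(2 * n * (N / l) * L)) / n := by positivity
  nlinarith

/-- n^(-1/2) is at most √(ω l) l^r, and the spare √l beats all constants; √L ≤ L because L ≥ 1. -/
lemma covariance_deviation_le (hl : 0 < l) (hl1 : l ≤ 1) (hn : 0 < n) {ω : ℝ}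
    (hn1 : (n : ℝ)⁻¹ ≤ ω * l ^ (2 * r + 1)) (hL1 : 1 ≤ L)
    (h1 : 8 * ω * l ^ r ≤ 1) (h2 : 32 * ω * l ≤ 1) :
    ((4 * 1 * L + 2 * √(2 * n * 1 * L)) / n) ^ 2 ≤ (L * l ^ r) ^ 2 := by
  have hn' : (0 : ℝ) < n := by exact_mod_cast hn
  have hlr : 0 < l ^ r := Real.rpow_pos_of_pos hl r
  have hL0 : 0 < L := by linarith
  have e1 : l ^ (2 * r + 1) = l ^ r * l ^ r * l := by
    rw [Real.rpow_add hl, Real.rpow_one, two_mul, Real.rpow_add hl]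
  have h3 : 4 * 1 * L / n ≤ L * l ^ r / 2 := by
    calc 4 * 1 * L / n = 4 * L * (n : ℝ)⁻¹ := by rw [div_eq_mul_inv]; ring
      _ ≤ 4 * L * (ω * l ^ (2 * r + 1)) := by gcongr
      _ = (8 * ω * l ^ r) * l * (L * l ^ r / 2) := by rw [e1]; ring
      _ ≤ 1 * 1 * (L * l ^ r / 2) := by gcongr
      _ = _ := by ring
  have h4 : 2 * √(2 * n * 1 * L) / n ≤ L * l ^ r / 2 := by
    have h5 : √(2 * n * 1 * L) ≤ n * (L * l ^ r) / 4 := by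
      apply Real.sqrt_le_iff.2 ⟨by positivity, ?_⟩
      have h6 : (n : ℝ)⁻¹ * 32 ≤ l ^ r * l ^ r := by
        calc (n : ℝ)⁻¹ * 32 ≤ ω * l ^ (2 * r + 1) * 32 := by gcongr
          _ = (32 * ω * l) * (l ^ r * l ^ r) := by rw [e1]; ring
          _ ≤ 1 * (l ^ r * l ^ r) := by gcongr
          _ = _ := one_mul _
      have h7 : 32 ≤ n * (l ^ r * l ^ r) := by
        rw [inv_mul_le_iff₀ hn'] at h6; exact h6
      calc 2 * n * 1 * L = n * L * 32 / 16 := by ring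
        _ ≤ n * L * (n * (l ^ r * l ^ r)) / 16 := by gcongr
        _ = n * L * 1 * (n * (l ^ r * l ^ r)) / 16 := by ring
        _ ≤ n * L * L * (n * (l ^ r * l ^ r)) / 16 := by gcongr
        _ = (n * (L * l ^ r) / 4) ^ 2 := by ring
    rw [div_le_iff₀ hn']
    linarith
  have h7 : (4 * 1 * L + 2 * √(2 * n * 1 * L)) / n ≤ L * l ^ r := by
    rw [add_div]; linarith
  have h8 : 0 ≤ (4 * 1 * L + 2 * √(2 * n * 1 * L)) / n := by positivity
  gcongr

/-- The variance term σ √(N L/n) has exactly the order R l^(r+1/2). The term with M carries an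
additional l^r, so M affects only how small l must be, not the constant. -/
lemma noise_deviation_le (hl : 0 < l) (hn : 0 < n) (hκ : 0 < κ) (hσ : 0 < σ)
    (hM : 0 < M) (hR : 0 < R) (hc₀ : 0 ≤ c₀)
    (hn1 : (n : ℝ)⁻¹ ≤ R ^ 2 / σ ^ 2 * l ^ (2 * r + 1))
    (hN : N / n ≤ c₀ * (R ^ 2 / σ ^ 2) * l ^ (2 * r + 1)) (hL1 : 1 ≤ L)
    (h1 : 2 * M * (R ^ 2 / σ ^ 2) * l ^ r ≤ R) :
    κ⁻¹ * (n : ℝ)⁻¹ * (2 * (M * l ^ (-(1 / 2) : ℝ)) * L + 2 * √(2 * n * (σ ^ 2 * N) * L))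
      ≤ κ⁻¹ * (1 + 2 * √(2 * c₀)) * (L * R * l ^ (r + 1 / 2)) := by
  have hn' : (0 : ℝ) < n := by exact_mod_cast hn
  have hlr : 0 < l ^ r := Real.rpow_pos_of_pos hl r
  set h := l ^ (1 / 2 : ℝ) with hh
  have hh0 : 0 < h := Real.rpow_pos_of_pos hl _
  have hL0 : 0 < L := by linarith
  have eh : h * h = l := by rw [hh, ← Real.rpow_add hl]; norm_num
  have e1 : l ^ (2 * r + 1) = l ^ r * l ^ r * (h * h) := by
    rw [Real.rpow_add hl, Real.rpow_one, two_mul, Real.rpow_add hl, eh]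
  have e2 : l ^ (r + 1 / 2) = l ^ r * h := Real.rpow_add hl _ _
  have e3 : l ^ (-(1 / 2) : ℝ) = h⁻¹ := Real.rpow_neg hl.le _
  have h3 : (n : ℝ)⁻¹ * (2 * (M * l ^ (-(1 / 2) : ℝ)) * L) ≤ L * R * l ^ (r + 1 / 2) := by
    calc (n : ℝ)⁻¹ * (2 * (M * l ^ (-(1 / 2) : ℝ)) * L)
        ≤ R ^ 2 / σ ^ 2 * l ^ (2 * r + 1) * (2 * (M * l ^ (-(1 / 2) : ℝ)) * L) := by gcongr
      _ = (2 * M * (R ^ 2 / σ ^ 2) * l ^ r) * (L * (l ^ r * h)) := by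
          rw [e1, e3]; field_simp
      _ ≤ R * (L * (l ^ r * h)) := by gcongr
      _ = _ := by rw [e2]; ring
  have h4 : (n : ℝ)⁻¹ * (2 * √(2 * n * (σ ^ 2 * N) * L))
      ≤ 2 * √(2 * c₀) * (L * R * l ^ (r + 1 / 2)) := by
    have h5 : √(2 * n * (σ ^ 2 * N) * L) ≤ n * (√(2 * c₀) * (L * R * l ^ (r + 1 / 2))) := by
      apply Real.sqrt_le_iff.2 ⟨by positivity, ?_⟩
      have h6 : σ ^ 2 * (N / n) ≤ c₀ * R ^ 2 * (l ^ r * h) ^ 2 := by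
        calc σ ^ 2 * (N / n) ≤ σ ^ 2 * (c₀ * (R ^ 2 / σ ^ 2) * l ^ (2 * r + 1)) := by gcongr
          _ = _ := by rw [e1]; field_simp
      calc 2 * n * (σ ^ 2 * N) * L = 2 * n ^ 2 * L * (σ ^ 2 * (N / n)) := by field_simp
        _ ≤ 2 * n ^ 2 * L * (c₀ * R ^ 2 * (l ^ r * h) ^ 2) := by gcongr
        _ = 2 * n ^ 2 * (L * 1) * (c₀ * R ^ 2 * (l ^ r * h) ^ 2) := by ring
        _ ≤ 2 * n ^ 2 * (L * L) * (c₀ * R ^ 2 * (l ^ r * h) ^ 2) := by gcongr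
        _ = (n * (√(2 * c₀) * (L * R * l ^ (r + 1 / 2)))) ^ 2 := by
            rw [e2]
            linear_combination
              (-(n ^ 2 * (L * R * (l ^ r * h)) ^ 2)) * Real.sq_sqrt (by positivity : 0 ≤ 2 * c₀)
    rw [inv_mul_le_iff₀ hn']
    linarith
  linear_combination mul_le_mul_of_nonneg_left (add_le_add h3 h4) (inv_nonneg.2 hκ.le)

end Parameter

/-! ### Assembly of the probabilistic and deterministic bounds -/

section Main

lemma norm_diagOp_le {H : Type*} [NormedAddCommGroup H] [InnerProductSpace ℝ H] {ι : Type*}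
    (b : HilbertBasis ι ℝ H) {c : ι → ℝ} {C : ℝ} (hC : 0 ≤ C) (hc : ∀ i, |c i| ≤ C) {w : H}
    (hw : ‖w‖ ≤ 1) : ‖diagOp b c w‖ ≤ C := by
  refine le_of_sq_le_sq ?_ hC
  have h1 := (sqSumLE_inner b w).mono_mul (a' := fun i => ⟪b i, diagOp b c w⟫) (c := C) fun i => by
    rw [inner_diagOp b hc, abs_mul]
    exact mul_le_mul_of_nonneg_right (hc i) (abs_nonneg _)
  refine (norm_sq_le_of_sqSumLE b h1).trans ?_
  have h2 : ‖w‖ ^ 2 ≤ 1 := pow_le_one₀ (norm_nonneg _) hw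
  nlinarith [sq_nonneg C]

lemma exists_small_parameter {r Λ K₁ K₂ : ℝ} (hr : 0 < r) (hΛ : 0 < Λ) :
    ∃ ε : ℝ, 0 < ε ∧ ∀ l, 0 < l → l ≤ ε → l ≤ 1 ∧ l < Λ ∧ K₁ * l ^ r ≤ 1 ∧ K₂ * l ≤ 1 := by
  have h1 : Tendsto (fun l : ℝ => K₁ * l ^ r) (nhds 0) (nhds 0) := by
    have := (Real.continuousAt_rpow_const 0 r (Or.inr hr.le)).tendsto.const_mul K₁
    simpa [Real.zero_rpow hr.ne'] using this
  have h2 : Tendsto (fun l : ℝ => K₂ * l) (nhds 0) (nhds 0) := by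
    have := (continuous_const_mul K₂).tendsto (0 : ℝ)
    simpa using this
  have h3 : ∀ᶠ l : ℝ in nhds 0, l ≤ 1 ∧ l < Λ ∧ K₁ * l ^ r ≤ 1 ∧ K₂ * l ≤ 1 := by
    filter_upwards [ge_mem_nhds one_pos, gt_mem_nhds hΛ, h1.eventually (ge_mem_nhds one_pos),
      h2.eventually (ge_mem_nhds one_pos)] with l a b c d using ⟨a, b, c, d⟩
  obtain ⟨ε, hε, hε'⟩ := Metric.eventually_nhds_iff.1 h3
  refine ⟨ε / 2, by positivity, fun l hl hlε => hε' ?_⟩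
  rw [Real.dist_eq, sub_zero, abs_of_pos hl]
  linarith

lemma one_le_log_eight_div {η : ℝ} (hη : 0 < η) (hη1 : η < 1) : 1 ≤ Real.log (8 / η) := by
  rw [Real.le_log_iff_exp_le (by positivity), le_div_iff₀ hη]
  nlinarith [Real.exp_one_lt_d9, Real.exp_pos 1]

variable {X H : Type*} [MeasurableSpace X] [NormedAddCommGroup H] [InnerProductSpace ℝ H]
  [CompleteSpace H] [RKHS ℝ H X ℝ] {κ : ℝ}

/-- An eigenbasis of the normalized covariance operator, with the coefficients of a function that
satisfies the source condition. -/
lemma exists_eigenbasis_covOp {ν : Measure X} {μ : ℕ+ → ℝ} {e : ℕ+ → H} (hκ : 0 < κ)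
    (he : IsEigendecomposition (covOp H ν) μ e) :
    ∃ (w : Set H) (b : HilbertBasis w ℝ H) (m : w → ℝ),
      IsDiag b (covOp H ν) (fun i => κ ^ 2 * m i) ∧ IsDiag b ((κ ^ 2)⁻¹ • covOp H ν) m ∧
      ∀ l N : ℝ, (∀ s : Finset ℕ+, ∑ j ∈ s, μ j / (μ j + κ ^ 2 * l) ≤ N) →
        ∀ s : Finset w, ∑ i ∈ s, m i / (m i + l) ≤ N := by
  classical
  obtain ⟨w, b, m, ι, hb, hι, hmι, hm0⟩ := he.exists_hilbertBasis
  have hκ2 : κ ^ 2 ≠ 0 := by positivity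
  refine ⟨w, b, fun i => (κ ^ 2)⁻¹ * m i, ?_, ?_, ?_⟩
  · intro i
    rw [hb i]
    simp only [mul_inv_cancel_left₀ hκ2]
  · intro i
    rw [smul_apply, hb i, smul_smul]
  · intro l N hN s
    rw [← Finset.sum_preimage ι s hι.injOn
      (fun i => (κ ^ 2)⁻¹ * m i / ((κ ^ 2)⁻¹ * m i + l)) fun i _ hi => by simp [hm0 i hi]]
    refine le_trans (le_of_eq (Finset.sum_congr rfl fun j _ => ?_)) (hN (s.preimage ι hι.injOn))
    rw [hmι, ← mul_div_mul_left _ _ hκ2, mul_add, mul_inv_cancel_left₀ hκ2]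

lemma SourceCondition.exists_inner_eq {ν : Measure X} {r R : ℝ} {f : H} (hr : 0 < r)
    (hκ : 0 < κ) (hf : SourceCondition ν r R f) {ι : Type*} {b : HilbertBasis ι ℝ H} {m : ι → ℝ}
    (hb : IsDiag b (covOp H ν) fun i => κ ^ 2 * m i) (hm : ∀ j, m j ∈ Icc (0 : ℝ) 1) :
    ∃ h : H, ‖h‖ ≤ R ∧ ∀ j, ⟪b j, f⟫ = (κ ^ 2) ^ r * m j ^ r * ⟪b j, h⟫ := by
  obtain ⟨h, hh, rfl⟩ := hf
  refine ⟨h, hh, fun j => ?_⟩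
  have hmul : ∀ j, (κ ^ 2 * m j) ^ r = (κ ^ 2) ^ r * m j ^ r := fun j =>
    Real.mul_rpow (by positivity) (hm j).1
  rw [hb.inner_spectralApply (C := (κ ^ 2) ^ r), hmul]
  intro i
  have h1 := (hm i).1
  rw [hmul, abs_of_nonneg (by positivity)]
  exact mul_le_of_le_one_right (by positivity) (Real.rpow_le_one (hm i).1 (hm i).2 hr.le)

variable [TopologicalSpace.SeparableSpace H]

lemma stronglyMeasurable_nfeature (hkm : Measurable fun p : X × X => kern H p.1 p.2) :
    StronglyMeasurable (nfeature κ : X → H) :=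
  (stronglyMeasurable_feature hkm).const_smul κ⁻¹

/-- The three concentration estimates hold simultaneously with high probability. -/
lemma measure_concentration_compl_le (hκ : 0 < κ)
    (hkm : Measurable fun p : X × X => kern H p.1 p.2) (hk : ∀ x : X, kern H x x ≤ κ ^ 2)
    {ν : Measure X} (P : Measure (X × ℝ)) [IsProbabilityMeasure P] (hν : P.fst = ν) {f : H}
    {σ M : ℝ} (hM : 0 < M)
    (hreg : ∀ᵐ x ∂P.fst, Integrable (fun y => y) (P.condKernel x) ∧
      ∫ y, y ∂(P.condKernel x) = f x)
    (hbern : BernsteinNoise P σ M f) {ι : Type*} {b : HilbertBasis ι ℝ H} {m : ι → ℝ}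
    (hA : IsDiag b ((κ ^ 2)⁻¹ • covOp H ν) m) {l N : ℝ} (hl : 0 < l) (hN0 : 0 ≤ N)
    (hN : ∀ s : Finset ι, ∑ j ∈ s, m j / (m j + l) ≤ N) {n : ℕ} (hn : 0 < n) {η : ℝ}
    (hη : 0 < η) (hη1 : η < 1) {B₂ B₃ : ℝ}
    (h1 : ((4 * l⁻¹ * Real.log (8 / η) + 2 * √(2 * n * (N / l) * Real.log (8 / η))) / n) ^ 2
      ≤ 1 / 4)
    (h2 : ((4 * 1 * Real.log (8 / η) + 2 * √(2 * n * 1 * Real.log (8 / η))) / n) ^ 2 ≤ B₂)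
    (h3 : κ⁻¹ * (n : ℝ)⁻¹ * (2 * (M * l ^ (-(1 / 2) : ℝ)) * Real.log (8 / η)
      + 2 * √(2 * n * (σ ^ 2 * N) * Real.log (8 / η))) ≤ B₃) :
    (Measure.pi fun _ : Fin n => P) {z |
      (∀ s : Finset ι, ∑ j ∈ s, ‖diagOp b (fun j => (m j + l)⁻¹)
        (((κ ^ 2)⁻¹ • covOp H ν - (κ ^ 2)⁻¹ • empCov H fun k => (z k).1) (b j))‖ ^ 2 ≤ 1 / 4) ∧
      (∀ s : Finset ι, ∑ j ∈ s,
        ‖((κ ^ 2)⁻¹ • covOp H ν - (κ ^ 2)⁻¹ • empCov H fun k => (z k).1) (b j)‖ ^ 2 ≤ B₂) ∧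
      ‖diagOp b (fun j => (m j + l) ^ (-(1 / 2) : ℝ)) (noiseVec κ f z)‖ ≤ B₃}ᶜ
      ≤ ENNReal.ofReal η := by
  subst hν
  have hcount := countable_of_hilbertBasis b
  set L := Real.log (8 / η) with hL
  have hL0 : 0 < L := Real.log_pos (by rw [lt_div_iff₀ hη]; linarith)
  -- Each of the three events fails with probability at most η/4, so the union bound costs 3η/4.
  have hexp : 2 * Real.exp (-L) = η / 4 := by
    rw [Real.exp_neg, hL, Real.exp_log (by positivity)]; field_simp; norm_num
  set A := (κ ^ 2)⁻¹ • covOp H P.fst with hAdef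
  have hsm : StronglyMeasurable (nfeature κ : X → H) := stronglyMeasurable_nfeature hkm
  have hAν : ∀ w, A w = ∫ x, ⟪(nfeature κ x : H), w⟫ • (nfeature κ x : H) ∂P.fst :=
    smul_covOp_apply hκ hkm hk P.fst
  have hφ1 : ∀ x : X, ‖(nfeature κ x : H)‖ ≤ 1 := norm_nfeature_le hκ hk
  have hm : ∀ j, m j ∈ Icc (0 : ℝ) 1 := fun j => (eigenvalue_mem_Icc P.fst hsm hφ1 hAν hA j).2
  have hml : ∀ j, 0 < m j + l := fun j => by linarith [(hm j).1]
  have hsm' : StronglyMeasurable fun z : X × ℝ => (nfeature κ z.1 : H) :=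
    hsm.comp_measurable measurable_fst
  have hAP : ∀ w, A w = ∫ z : X × ℝ, ⟪(nfeature κ z.1 : H), w⟫ • (nfeature κ z.1 : H) ∂P := by
    intro w
    rw [hAν]
    exact integral_map measurable_fst.aemeasurable
      ((hsm.inner stronglyMeasurable_const).smul hsm).aestronglyMeasurable
  have hlint : ∀ S : H →L[ℝ] H, ∫⁻ z : X × ℝ, ENNReal.ofReal (‖S (nfeature κ z.1)‖ ^ 2) ∂P
      = ∫⁻ x, ENNReal.ofReal (‖S (nfeature κ x)‖ ^ 2) ∂P.fst := fun S => by
    rw [Measure.fst, lintegral_map (((S.continuous.comp_stronglyMeasurable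
      hsm).norm.measurable.pow_const 2).ennreal_ofReal) measurable_fst]
  have hTz : ∀ (z : Fin n → X × ℝ) (w : H), ((κ ^ 2)⁻¹ • empCov H fun k => (z k).1) w
      = (n : ℝ)⁻¹ • ∑ k, ⟪(nfeature κ (z k).1 : H), w⟫ • (nfeature κ (z k).1 : H) := fun z w =>
    smul_empCov_apply hκ _ w
  have hc1 : ∀ j, |(m j + l)⁻¹| ≤ l⁻¹ := fun j => abs_inv_add_le (hm j).1 hl
  have hc2 : ∀ j, |(m j + l) ^ (-(1 / 2) : ℝ)| ≤ l ^ (-(1 / 2) : ℝ) := fun j => by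
    have := hml j
    rw [abs_of_nonneg (by positivity)]
    exact Real.rpow_le_rpow_of_nonpos hl (by linarith [(hm j).1]) (by norm_num)
  have hl2 : 0 < l ^ (-(1 / 2) : ℝ) := Real.rpow_pos_of_pos hl _
  -- One resolvent factor is spent on l⁻¹; the other forms the effective dimension.
  have hv1 : ∀ s : Finset ι, ∑ j ∈ s, ((m j + l)⁻¹) ^ 2 * m j ≤ N / l := fun s => by
    rw [div_eq_inv_mul]
    refine le_trans ?_ (mul_le_mul_of_nonneg_left (hN s) (inv_nonneg.2 hl.le))
    rw [Finset.mul_sum]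
    refine Finset.sum_le_sum fun j _ => ?_
    have h4 := hml j
    have h5 := (hm j).1
    have h6 : (m j + l)⁻¹ ≤ l⁻¹ := by gcongr; linarith
    calc ((m j + l)⁻¹) ^ 2 * m j = (m j + l)⁻¹ * (m j / (m j + l)) := by
          rw [div_eq_inv_mul]; ring
      _ ≤ _ := by gcongr
  have hv2 : ∀ s : Finset ι, ∑ j ∈ s, ((m j + l) ^ (-(1 / 2) : ℝ)) ^ 2 * m j ≤ N := fun s => by
    refine le_trans (le_of_eq (Finset.sum_congr rfl fun j _ => ?_)) (hN s)
    rw [← Real.rpow_natCast, ← Real.rpow_mul (hml j).le]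
    norm_num
    rw [Real.rpow_neg_one, div_eq_inv_mul]
  have E1 := measure_hs_deviation_le b P hsm' (fun z => hφ1 z.1) hAP
    (diagOp b fun j => (m j + l)⁻¹) (L := l⁻¹) (v := N / l) (l := L) (inv_pos.2 hl)
    (by positivity) hL0 (fun z => norm_diagOp_le b (by positivity) hc1 (hφ1 z.1))
    ((hlint _).trans_le (lintegral_norm_diagOp_sq_le P.fst hsm hφ1 hAν hA hc1 hv1)) hn _ hTz
  have E2 := measure_hs_deviation_le b P hsm' (fun z => hφ1 z.1) hAP
    (ContinuousLinearMap.id ℝ H) (L := 1) (v := 1) (l := L) one_pos zero_le_one hL0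
    (fun z => hφ1 z.1) (by
      calc ∫⁻ z : X × ℝ, ENNReal.ofReal (‖(nfeature κ z.1 : H)‖ ^ 2) ∂P
          ≤ ∫⁻ _, ENNReal.ofReal 1 ∂P := lintegral_mono fun z =>
            ENNReal.ofReal_le_ofReal (pow_le_one₀ (norm_nonneg _) (hφ1 z.1))
        _ = ENNReal.ofReal 1 := by simp) hn _ hTz
  have E3 := measure_noise_le P (measurable_apply hkm f)
    (ψ := fun x => diagOp b (fun j => (m j + l) ^ (-(1 / 2) : ℝ)) (nfeature κ x))
    ((diagOp b _).continuous.comp_stronglyMeasurable hsm) hM hl2 hN0 hL0 hreg hbern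
    (fun x => norm_diagOp_le b hl2.le hc2 (hφ1 x))
    (lintegral_norm_diagOp_sq_le P.fst hsm hφ1 hAν hA hc2 hv2) n
  rw [hexp] at E1 E2 E3
  refine le_trans (measure_mono ?_) ((measure_union_le _ _).trans
    ((add_le_add ((measure_union_le _ _).trans (add_le_add E1 E2)) E3).trans ?_))
  · intro z hz
    by_contra hcon
    simp only [mem_union, mem_compl_iff, mem_ofPred_eq, not_or, not_not, not_lt] at hcon
    obtain ⟨⟨hz1, hz2⟩, hz3⟩ := hcon
    refine hz ⟨fun s => (hz1 s).trans h1, fun s => (hz2 s).trans h2, le_trans ?_ h3⟩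
    rw [noiseVec, map_smul, norm_smul, Real.norm_of_nonneg (by positivity), map_sum]
    refine mul_le_mul_of_nonneg_left ?_ (by positivity)
    simpa only [map_smul] using hz3
  · rw [← ENNReal.ofReal_add (by positivity) (by positivity),
      ← ENNReal.ofReal_add (by positivity) (by positivity)]
    exact ENNReal.ofReal_le_ofReal (by linarith)

/-- By the reproducing property the squared L² norm of w is κ² ⟪A w, w⟫. -/
lemma eLpNorm_apply_le (hκ : 0 < κ) (hkm : Measurable fun p : X × X => kern H p.1 p.2)
    (hk : ∀ x : X, kern H x x ≤ κ ^ 2) (ν : Measure X) [IsProbabilityMeasure ν] (w : H) {B : ℝ}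
    (hB : 0 ≤ B) (hw : ⟪((κ ^ 2)⁻¹ • covOp H ν) w, w⟫ ≤ B ^ 2) :
    eLpNorm (fun x => w x) 2 ν ≤ ENNReal.ofReal (κ * B) := by
  have hwx : ∀ x : X, w x = κ * ⟪(nfeature κ x : H), w⟫ := fun x => by
    rw [nfeature, inner_smul_left, inner_feature]
    simp only [conj_trivial]
    field_simp
  have hbound : ∀ x : X, ‖w x‖ ≤ κ * ‖w‖ := fun x => by
    rw [hwx, norm_mul, Real.norm_of_nonneg hκ.le]
    refine mul_le_mul_of_nonneg_left ?_ hκ.le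
    refine (norm_inner_le_norm _ _).trans ?_
    exact mul_le_of_le_one_left (norm_nonneg _) (norm_nfeature_le hκ hk x)
  have hmem : MemLp (fun x => w x) 2 ν :=
    MemLp.of_bound (measurable_apply hkm w).aestronglyMeasurable _ (ae_of_all _ hbound)
  rw [hmem.eLpNorm_eq_integral_rpow_norm two_ne_zero ENNReal.ofNat_ne_top]
  apply ENNReal.ofReal_le_ofReal
  have h1 : ∫ x, ‖w x‖ ^ (2 : ℝ≥0∞).toReal ∂ν = κ ^ 2 * ⟪((κ ^ 2)⁻¹ • covOp H ν) w, w⟫ := by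
    rw [integral_inner_mul_inner ν (stronglyMeasurable_nfeature hkm) (norm_nfeature_le hκ hk)
      (smul_covOp_apply hκ hkm hk ν), ← integral_const_mul]
    refine integral_congr_ae (ae_of_all _ fun x => ?_)
    simp only [ENNReal.toReal_ofNat, Real.rpow_two, Real.norm_eq_abs, sq_abs]
    rw [hwx]; ring
  rw [h1, ENNReal.toReal_ofNat, ← one_div (2 : ℝ), ← Real.sqrt_eq_rpow]
  apply Real.sqrt_le_iff.2 ⟨by positivity, ?_⟩
  rw [mul_pow]
  gcongr

end Main

end KernelRegression

end

open KernelRegression in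
theorem theorem3p2 (r νs κ q D E γ₀ γq : ℝ) (hr : 0 < r) (hνs : 1 < νs) (hκ : 0 < κ)
    (hq : r ≤ q) :
    ∃ C : ℝ, 0 < C ∧
      ∀ (X : Type*) [MeasurableSpace X] [StandardBorelSpace X]
        (H : Type*) [NormedAddCommGroup H] [InnerProductSpace ℝ H] [CompleteSpace H]
        [TopologicalSpace.SeparableSpace H] [RKHS ℝ H X ℝ]
        (ν : Measure X) [IsProbabilityMeasure ν] (μ : ℕ+ → ℝ) (e : ℕ+ → H) (g : ℝ → ℝ → ℝ)
        (σ M R : ℝ),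
        Measurable (fun p : X × X => kern H p.1 p.2) →
        (∀ x : X, kern H x x ≤ κ ^ 2) →
        IsEigendecomposition (covOp H ν) μ e →
        EigUpper μ νs →
        IsRegularization g D E γ₀ →
        QualificationBound g q γq →
        0 < σ → 0 < M → 0 < R →
        ∃ n₀ : ℕ, ∀ (P : Measure (X × ℝ)) [IsProbabilityMeasure P] (f : H),
          InModel ν r M σ R P f →
          ∀ n : ℕ, n₀ ≤ n → ∀ η : ℝ, 0 < η → η < 1 →
            Real.log (8 / η) ≤ C * lambdaSeq μ r σ R n ^ (-r) →
            -- an event of probability at least `1 - η`: its complement has measure at most `η`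
            (Measure.pi fun _ : Fin n => P)
                {z | ‖f - estimator κ g (lambdaSeq μ r σ R n) z‖ ≤
                  C * Real.log (8 / η) * (R * invG μ r (σ ^ 2 / (R ^ 2 * n)) ^ r)}ᶜ
              ≤ ENNReal.ofReal η ∧
            (r + 1 / 2 ≤ q →
              (Measure.pi fun _ : Fin n => P)
                  {z | eLpNorm
                      (fun x => f x - (estimator κ g (lambdaSeq μ r σ R n) z : H) x) 2 ν ≤
                    ENNReal.ofReal (C * Real.log (8 / η) *
                      (R * invG μ r (σ ^ 2 / (R ^ 2 * n)) ^ (r + 1 / 2)))}ᶜ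
                ≤ ENNReal.ofReal η) := by
  have hc₀ : 1 ≤ effDimConst νs κ := one_le_effDimConst hνs κ
  have hc₀' : 0 ≤ effDimConst νs κ := zero_le_one.trans hc₀
  have ha : 0 ≤ noiseConst νs κ := by rw [noiseConst]; positivity
  have hΓ : 0 < residualConst γ₀ γq := zero_lt_one.trans_le (one_le_residualConst γ₀ γq)
  set K := errorConst r D E γ₀ γq ((κ ^ 2) ^ r) (noiseConst νs κ) with hK
  have hK0 : 0 < K := by rw [hK, errorConst]; positivity
  -- K serves the norm of H and 2 κ K the L² norm; the sum covers both and is also used in the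
  -- condition on log(8/η).
  refine ⟨(1 + 2 * κ) * K, by positivity, ?_⟩
  set C := (1 + 2 * κ) * K with hC
  have hC0 : 0 < C := by positivity
  have hCK : C = K + κ * (2 * K) := by rw [hC]; ring
  have hKC : K ≤ C := by rw [hCK]; exact le_add_of_nonneg_right (by positivity)
  have hKC2 : κ * (2 * K) ≤ C := by rw [hCK]; exact le_add_of_nonneg_left hK0.le
  intro X _ _ H _ _ _ _ _ ν _ μ e g σ M R hkm hk he hdecay hg hgq hσ hM hR
  set ω := R ^ 2 / σ ^ 2 with hω
  have hω0 : 0 < ω := by positivity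
  obtain ⟨Λ, hΛ, hdim⟩ :=
    exists_effDim_le he.antitone he.pos he.tendsto_zero hνs hκ hdecay
  -- K₁ adds up the coefficients of l^r in the smallness conditions of the deviation lemmas; all are
  -- nonnegative, so each condition follows from the sum. M, σ and R enter here and hence only
  -- affect n₀.
  obtain ⟨ε, hε, hsmall⟩ := exists_small_parameter (r := r) (Λ := Λ)
    (K₁ := 16 * C * ω + 128 * effDimConst νs κ * ω * C + 8 * ω + 2 * M * ω / R) (K₂ := 32 * ω)
    hr hΛ
  obtain ⟨δ, hδ, hinv⟩ := exists_invG_le (r := r) he.antitone he.pos he.tendsto_zero hr hε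
  obtain ⟨w, b, m, hbB, hbA, htrace⟩ := exists_eigenbasis_covOp (κ := κ) hκ he
  -- Beyond this n the argument u of G⁻¹ is below δ, so l ≤ ε. The choice precedes P, f and η.
  obtain ⟨n₀, hn₀⟩ := exists_nat_gt (σ ^ 2 / (R ^ 2 * δ))
  refine ⟨n₀ + 1, fun P _ f hP n hn η hη hη1 hlog => ?_⟩
  have hn0 : 0 < n := by omega
  have hn' : (0 : ℝ) < n := by exact_mod_cast hn0
  have hlt : σ ^ 2 / (R ^ 2 * n) < δ := by
    have h1 : (n₀ : ℝ) < n := by exact_mod_cast hn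
    have h2 := hn₀.trans h1
    rw [div_lt_iff₀ (by positivity)] at h2 ⊢
    linarith
  set u := σ ^ 2 / (R ^ 2 * n) with hu
  have hu0 : 0 < u := by positivity
  set l := invG μ r u with hl
  have hl0 : 0 < l := invG_pos he.antitone he.pos he.tendsto_zero hr hu0
  obtain ⟨hl1, hlΛ, hsm, hsm2⟩ := hsmall l hl0 (hinv u hu0 hlt)
  -- For such n the truncation of λ_n at 1 is inactive.
  have hlam : lambdaSeq μ r σ R n = l := min_eq_left hl1
  rw [hlam] at hlog ⊢
  have hlr : 0 < l ^ r := Real.rpow_pos_of_pos hl0 r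
  have hterms : 16 * C * ω * l ^ r ≤ 1 ∧ 128 * effDimConst νs κ * ω * C * l ^ r ≤ 1 ∧
      8 * ω * l ^ r ≤ 1 ∧ 2 * M * ω / R * l ^ r ≤ 1 := by
    have t1 : 0 ≤ 16 * C * ω * l ^ r := by positivity
    have t2 : 0 ≤ 128 * effDimConst νs κ * ω * C * l ^ r := by positivity
    have t3 : 0 ≤ 8 * ω * l ^ r := by positivity
    have t4 : 0 ≤ 2 * M * ω / R * l ^ r := by positivity
    have e1 := hsm
    rw [add_mul, add_mul, add_mul] at e1
    exact ⟨by linarith, by linarith, by linarith, by linarith⟩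
  obtain ⟨k, hkl, hks⟩ := hdim l hl0 hlΛ
  have huk : u * k ≤ l ^ (2 * r + 1) :=
    mul_le_invG_rpow he.antitone he.pos he.tendsto_zero hr hu0 hkl
  have hk1 : (1 : ℝ) ≤ k := by exact_mod_cast k.pos
  have hninv : (n : ℝ)⁻¹ = ω * u := by rw [hω, hu]; field_simp
  have hn1 : (n : ℝ)⁻¹ ≤ ω * l ^ (2 * r + 1) := by
    rw [hninv]
    gcongr
    exact (le_mul_of_one_le_right hu0.le hk1).trans huk
  have hNn : effDimConst νs κ * k / n ≤ effDimConst νs κ * ω * l ^ (2 * r + 1) := by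
    calc effDimConst νs κ * k / n = effDimConst νs κ * ω * (u * k) := by
          rw [div_eq_mul_inv, hninv]; ring
      _ ≤ _ := by gcongr
  have hL1 : 1 ≤ Real.log (8 / η) := one_le_log_eight_div hη hη1
  have hL0 : 0 ≤ Real.log (8 / η) := zero_le_one.trans hL1
  have hA : ∀ x, ((κ ^ 2)⁻¹ • covOp H ν) x
      = ∫ y, inner ℝ (nfeature κ y : H) x • (nfeature κ y : H) ∂ν :=
    smul_covOp_apply hκ hkm hk ν
  have hm : ∀ j, m j ∈ Icc (0 : ℝ) 1 := fun j => (eigenvalue_mem_Icc ν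
    (stronglyMeasurable_nfeature hkm) (norm_nfeature_le hκ hk) hA hbA j).2
  obtain ⟨h, hh, hf⟩ := hP.source.exists_inner_eq hr hκ hbB hm
  have hgood := measure_concentration_compl_le hκ hkm hk P hP.marginal hM hP.regression
    hP.bernstein hbA hl0 (by positivity) (htrace l _ hks) hn0 hη hη1
    (resolvent_deviation_le hl0 hn0 hc₀' hω0.le hn1 hNn hL0 hlog hterms.1 hterms.2.1)
    (covariance_deviation_le hl0 hl1 hn0 hn1 hL1 hterms.2.2.1 hsm2)
    (noise_deviation_le hl0 hn0 hκ hσ hM hR hc₀' hn1 hNn hL1 (by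
      have h5 := hterms.2.2.2
      rw [div_mul_eq_mul_div, div_le_one hR] at h5
      exact h5))
  have herr := fun (z : Fin n → X × ℝ) h1 h2 h3 =>
    error_bounds_of_concentration (z := z) hg hgq ⟨hl0, hl1⟩ hκ hk hn0 hr hq hL1
      (by positivity) hR.le ha hbA hm hh hf h1 h2 h3
  constructor
  · refine (measure_mono (compl_subset_compl.2 ?_)).trans hgood
    rintro z ⟨h1, h2, h3⟩
    refine (herr z h1 h2 h3).1.trans ?_
    rw [mul_assoc C, ← mul_assoc (Real.log (8 / η))]
    gcongr
  · intro hq2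
    refine (measure_mono (compl_subset_compl.2 ?_)).trans hgood
    rintro z ⟨h1, h2, h3⟩
    have h4 := (herr z h1 h2 h3).2 hq2
    -- The 2 is the square root of the factor 4 lost in passing from T back to A.
    have h5 := eLpNorm_apply_le hκ hkm hk ν (f - estimator κ g l z)
      (B := 2 * (K * (Real.log (8 / η) * R * l ^ (r + 1 / 2)))) (by positivity)
      (h4.trans (le_of_eq (by rw [hK]; ring)))
    simp only [RKHS.coe_sub, Pi.sub_apply] at h5
    refine h5.trans (ENNReal.ofReal_le_ofReal ?_)
    calc κ * (2 * (K * (Real.log (8 / η) * R * l ^ (r + 1 / 2))))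
        = κ * (2 * K) * (Real.log (8 / η) * (R * l ^ (r + 1 / 2))) := by ring
      _ ≤ C * (Real.log (8 / η) * (R * l ^ (r + 1 / 2))) := by gcongr
      _ = _ := by ring
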